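/- Let $V:(0,\infty)\to[0,\infty)$ be measurable with $\int_0^\infty V(x)(1+x^2)\,dx<\infty$. Let $H=-\frac{d^2}{dx^2}$ and $H'=-\frac{d^2}{dx^2}+V$ on $L^2((0,\infty))$ with a Dirichlet boundary condition at $0$, and let $H_L$, $H_L'$ be the corresponding operators on $L^2((0,L))$ with Dirichlet boundary conditions at $0$ and $L$, with eigenvalues $\lambda^L_1\le\lambda^L_2\le\dots$ and $\mu^L_1\le\mu^L_2\le\dots$, counted with multiplicity. Put $E_L^N=\sum_{n=1}^N\lambda_n^L$ and $E_L'^N=\sum_{n=1}^N\mu_n^L$. For $k>0$ let $\theta_k$ be the absolutely continuous solution on $[0,\infty)$ of $\theta_k'=k-\frac1k V\sin^2\theta_k$, $\theta_k(0)=0$, let $\delta(k)=\lim_{x\to\infty}(\theta_k(x)-kx)$ be the scattering phase shift, and put $\zeta(E)=\delta(\sqrt E)^2/\pi^2$ for $E>0$. Let $\xi$ be the spectral shift function of the pair $(H,H')$, i.e. the function on $\mathbb R$ with $\int_{\mathbb R}\frac{|\xi(x)|}{1+x^2}dx<\infty$ that vanishes on $(-\infty,0)$ and satisfies $\operatorname{tr}\big((H'+c)^{-1}-(H+c)^{-1}\big)=-\int_{\mathbb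 R}\frac{\xi(x)}{(x+c)^2}\,dx$ for all $c>0$. It exists, and has a representative that is continuous on $(0,\infty)$, which is the one used here. Then for every $E>0$ and $a\in\mathbb R$, if the system length $L$ is chosen for $N\in\mathbb N$ such that $\frac{N+a}{L}=\frac{\sqrt E}{\pi}$, there is exactly one real number $x_{FS}^a(E)$, called the finite-size energy, such that $$E_L'^N-E_L^N=\int_{-\infty}^E\xi(x)\,dx+\frac{\sqrt E\,\pi}{L}\,x_{FS}^a(E)+o\Big(\frac1L\Big)\qquad (N,L\to\infty),$$ and it is given by $$x^a_{FS}(E)=(1-2a)\,\xi(E)+\zeta(E).$$ In particular, $x_{FS}^{1/2}(E)=\zeta(E)$ and $x_{FS}^{0}(E)=\xi(E)+\zeta(E)$. The finite-size energy is thus non-universal: if $V$ is not almost everywhere zero, then $x_{FS}^a(E)\ne x_{FS}^b(E)$ whenever $a\ne b$. -/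

import Mathlib

open MeasureTheory Filter Topology Set

/-! ### Dirichlet Schrödinger operators in one dimension

Unbounded operators in a Hilbert space are represented by their graphs. -/

/-- The complex Hilbert space `L²(I)` for a set `I` of real numbers. -/
abbrev L2 (I : Set ℝ) : Type := Lp ℂ 2 (volume.restrict I)

/-- For an open interval `I` with left endpoint `0`: `u` and `v = u'` are (locally) absolutely
continuous on `closure I`, `-u'' + V u = g` almost everywhere, and `u` vanishes at the finite
endpoints of `I`. Absolute continuity is expressed by integrating the derivative. -/
structure IsDirichletSolution (V : ℝ → ℝ) (I : Set ℝ) (u v g : ℝ → ℂ) : Prop where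
  boundary : ∀ x ∈ frontier I, u x = 0
  integrable_deriv : ∀ x ∈ closure I, IntervalIntegrable v volume 0 x
  eq_integral : ∀ x ∈ closure I, u x = ∫ t in (0 : ℝ)..x, v t
  integrable_second : ∀ x ∈ closure I,
    IntervalIntegrable (fun t => (V t : ℂ) * u t - g t) volume 0 x
  deriv_eq_integral : ∀ x ∈ closure I,
    v x = v 0 + ∫ t in (0 : ℝ)..x, ((V t : ℂ) * u t - g t)

/-- The graph of the operator `-d²/dx² + V` in `L²(I)` with Dirichlet boundary conditions, for
an open interval `I` with left endpoint `0`. Its domain consists of all `u ∈ L²(I)` such that `u`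
and `u'` are locally absolutely continuous up to the finite endpoints, `u` vanishes there, and
`-u'' + V u ∈ L²(I)`. -/
def dirichletOperator (V : ℝ → ℝ) (I : Set ℝ) : Submodule ℂ (L2 I × L2 I) where
  carrier := {p | ∃ u v g : ℝ → ℂ, p.1 =ᵐ[volume.restrict I] u ∧ p.2 =ᵐ[volume.restrict I] g ∧
    IsDirichletSolution V I u v g}
  zero_mem' := by
    refine ⟨0, 0, 0, Lp.coeFn_zero _ _ _, Lp.coeFn_zero _ _ _, ?_⟩
    refine ⟨fun x _ => rfl, fun x _ => ?_, fun x _ => by simp, fun x _ => by simp, fun x _ => by simp⟩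
    exact (intervalIntegrable_const : IntervalIntegrable (fun _ => (0 : ℂ)) volume 0 x)
  add_mem' := by
    rintro p q ⟨u, v, g, hu, hg, h⟩ ⟨u', v', g', hu', hg', h'⟩
    have key : (fun t => (V t : ℂ) * (u + u') t - (g + g') t) =
        fun t => ((V t : ℂ) * u t - g t) + ((V t : ℂ) * u' t - g' t) := by
      funext t; simp only [Pi.add_apply]; ring
    refine ⟨u + u', v + v', g + g', (Lp.coeFn_add _ _).trans (hu.add hu'),
      (Lp.coeFn_add _ _).trans (hg.add hg'), ?_, ?_, ?_, ?_, ?_⟩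
    · intro x hx
      simp [h.boundary x hx, h'.boundary x hx]
    · intro x hx
      exact (h.integrable_deriv x hx).add (h'.integrable_deriv x hx)
    · intro x hx
      simp only [Pi.add_apply]
      rw [intervalIntegral.integral_add (h.integrable_deriv x hx) (h'.integrable_deriv x hx),
        h.eq_integral x hx, h'.eq_integral x hx]
    · intro x hx
      rw [key]
      exact (h.integrable_second x hx).add (h'.integrable_second x hx)
    · intro x hx
      rw [key, intervalIntegral.integral_add (h.integrable_second x hx)
        (h'.integrable_second x hx)]
      simp only [Pi.add_apply]
      rw [h.deriv_eq_integral x hx, h'.deriv_eq_integral x hx]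
      ring
  smul_mem' := by
    rintro c p ⟨u, v, g, hu, hg, h⟩
    have key : (fun t => (V t : ℂ) * (c • u) t - (c • g) t) =
        fun t => c * ((V t : ℂ) * u t - g t) := by
      funext t; simp only [Pi.smul_apply, smul_eq_mul]; ring
    refine ⟨c • u, c • v, c • g, (Lp.coeFn_smul _ _).trans (hu.const_smul c),
      (Lp.coeFn_smul _ _).trans (hg.const_smul c), ?_, ?_, ?_, ?_, ?_⟩
    · intro x hx
      simp [h.boundary x hx]
    · intro x hx
      exact (h.integrable_deriv x hx).smul c
    · intro x hx
      simp only [Pi.smul_apply, smul_eq_mul]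
      rw [intervalIntegral.integral_const_mul, h.eq_integral x hx]
    · intro x hx
      rw [key]
      exact (h.integrable_second x hx).const_mul c
    · intro x hx
      rw [key, intervalIntegral.integral_const_mul]
      simp only [Pi.smul_apply, smul_eq_mul]
      rw [h.deriv_eq_integral x hx]
      ring

section Operators

variable {H : Type} [NormedAddCommGroup H] [InnerProductSpace ℂ H]

/-- The kernel of `T - x`, for an operator with graph `T` and a real number `x`. -/
def eigenspaceAt (T : Submodule ℂ (H × H)) (x : ℝ) : Submodule ℂ H :=
  T.comap (LinearMap.prod LinearMap.id ((x : ℂ) • LinearMap.id))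

/-- The `n`-th smallest eigenvalue (`n = 1, 2, …`), counted with multiplicity, of an operator that
is bounded from below with compact resolvent: the least `x` such that the eigenvectors with
eigenvalues at most `x` span a space of dimension at least `n`. -/
noncomputable def nthEigenvalue (T : Submodule ℂ (H × H)) (n : ℕ) : ℝ :=
  sInf {x : ℝ | (n : Cardinal) ≤ Module.rank ℂ (⨆ y ∈ Iic x, eigenspaceAt T y : Submodule ℂ H)}

/-- The bounded operator `R` is the resolvent `(T + c)⁻¹`, for an operator with graph `T`. -/
def IsResolventAt (T : Submodule ℂ (H × H)) (c : ℝ) (R : H →L[ℂ] H) : Prop :=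
  ∀ f u : H, R f = u ↔ (u, f - (c : ℂ) • u) ∈ T

/-- The bounded operator `A` is of trace class with trace `τ`: for every orthonormal basis the sum
of the diagonal matrix elements converges (unconditionally) to `τ`. -/
def HasTrace (A : H →L[ℂ] H) (τ : ℂ) : Prop :=
  ∀ (ι : Type) (e : HilbertBasis ι ℂ H), HasSum (fun i => inner ℂ (e i) (A (e i))) τ

/-- `ξ` is the spectral shift function of the pair `(T, T')` of non-negative self-adjoint operators
with trace class resolvent difference. It vanishes below the spectra and satisfies Krein's trace
formula `tr ((T' + c)⁻¹ - (T + c)⁻¹) = - ∫ ξ(x) / (x + c)² dx` for every `c > 0`. These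
conditions determine `ξ` up to a Lebesgue null set. -/
structure IsSpectralShiftFunction (T T' : Submodule ℂ (H × H)) (ξ : ℝ → ℝ) : Prop where
  integrable : Integrable (fun x => ξ x / (1 + x ^ 2))
  eq_zero : ∀ᵐ x : ℝ, x < 0 → ξ x = 0
  trace_formula : ∀ c : ℝ, 0 < c → ∃ R R' : H →L[ℂ] H,
    IsResolventAt T c R ∧ IsResolventAt T' c R' ∧
      HasTrace (R' - R) ((-∫ x : ℝ, ξ x / (x + c) ^ 2 : ℝ) : ℂ)

end Operators

/-! ### The scattering phase shift -/

/-- `θ` is the absolutely continuous solution on `[0, ∞)` of the variable phase equation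
`θ' = k - V sin² θ / k` with `θ(0) = 0`. -/
def IsPruferAngle (V : ℝ → ℝ) (k : ℝ) (θ : ℝ → ℝ) : Prop :=
  ContinuousOn θ (Ici 0) ∧
    ∀ x : ℝ, 0 ≤ x → θ x = ∫ t in (0 : ℝ)..x, (k - V t * Real.sin (θ t) ^ 2 / k)

/-- The Prüfer angle; it is unique on `[0, ∞)`. -/
noncomputable def pruferAngle (V : ℝ → ℝ) (k : ℝ) : ℝ → ℝ :=
  Classical.epsilon (IsPruferAngle V k)

/-- The scattering phase shift `δ(k) = lim_{x → ∞} (θ_k(x) - k x)` for `k > 0`. -/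
noncomputable def phaseShift (V : ℝ → ℝ) (k : ℝ) : ℝ :=
  limUnder atTop (fun x : ℝ => pruferAngle V k x - k * x)

/-- The Anderson exponent `ζ(E) = δ(√E)² / π²`. -/
noncomputable def andersonExponent (V : ℝ → ℝ) (E : ℝ) : ℝ :=
  phaseShift V (√E) ^ 2 / Real.pi ^ 2

/-! ### Ground-state energies and the finite-size energy -/

/-- The ground-state energy of `N` non-interacting fermions on `(0, L)` with one-particle operator
`-d²/dx² + V`: the sum of the `N` smallest eigenvalues, counted with multiplicity. -/
noncomputable def groundStateEnergy (V : ℝ → ℝ) (L : ℝ) (N : ℕ) : ℝ :=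
  ∑ n ∈ Finset.Icc 1 N, nthEigenvalue (dirichletOperator V (Ioo 0 L)) n

/-- The system length `L` with `(N + a) / L = √E / π`. -/
noncomputable def systemLength (E a : ℝ) (N : ℕ) : ℝ :=
  (N + a) * Real.pi / √E

/-- `x` is the finite-size energy at Fermi energy `E` for the thermodynamic limit
`(N + a) / L = √E / π`: the difference of the perturbed and the unperturbed ground-state energies is
`∫_{-∞}^E ξ(s) ds + (√E π / L) x + o(1 / L)` as `N, L → ∞`. -/
def IsFiniteSizeEnergy (V ξ : ℝ → ℝ) (E a x : ℝ) : Prop :=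
  (fun N : ℕ => groundStateEnergy V (systemLength E a N) N
      - groundStateEnergy 0 (systemLength E a N) N
      - (∫ s in Iic E, ξ s) - √E * Real.pi / systemLength E a N * x)
    =o[atTop] fun N : ℕ => 1 / systemLength E a N

/-! Everything is read off the Prüfer angle. In polar coordinates the regular solution at energy k²
vanishes at L exactly when θ_k(L) is a positive multiple of π, so the n-th eigenvalue on (0, L) is
k_n² with θ_{k_n}(L) = nπ (`nthEigenvalue_dirichletOperator`). Hence k_n = (nπ + d_n)/L, where d_n =
k_n L - θ_{k_n}(L) is minus the phase accumulated on [0, L]. The second moment of V makes this phase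
Lipschitz in k uniformly in L (`abs_partialPhase_sub_le`) and puts it within o(1/(k L²)) of δ(k).

Put h = π/L, q = √E and D = -δ. An exact summation by parts (`mul_sum_sq_sub_eq`) turns h Σ (k_n² -
(nh)²) into boundary terms in k_N and d_N, a negligible sum of cubed gaps, and the trapezoidal sum
of (1/L) ∫ D d(k²) over the nodes k_n. Although D is merely Lipschitz, the trapezoidal rule errs by
less than the order of the mesh (`exists_trapezoid_bound`). After multiplication of the energy
difference by L, the boundary terms tend to qD(q) - qD(q)²/π. The endpoint satisfies L(k_N - q) =
d_N - aπ, so replacing k_N by q in the integral contributes 2qD(q)(D(q) - aπ)/π. The sum is (1 - 2a)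
qD(q) + qD(q)²/π (`tendsto_energy_shift`); division by qπ gives (1 - 2a) ξ(E) + ζ(E), once ξ(x) =
-δ(√x)/π is known.

That identity for ξ comes from cutting V off at y and letting y grow. The resolvent at -κ² then
changes by -V(y) dy times the rank-one form of the Green's function G_y(y, ·) of the cut-off
problem, so the trace of the resolvent difference is -∫ V(y) ‖G_y(y, ·)‖² dy (`exists_resolvents`).
The diagonal Green's function is analytic in the momentum z in the upper half-plane, and its
boundary imaginary part is sin² θ_k(y)/k. Cauchy's formula expresses ‖G_y(y, ·)‖² as an integral
over k (`greenNormSq_eq_integral`), and Fubini with δ(k) = -∫ V sin² θ_k / k yields Krein's formula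
(`isSpectralShiftFunction_shiftFn`). The trace formula determines ξ by a moment argument
(`IsSpectralShiftFunction.eqOn`). Non-universality holds because δ(k) ≠ 0 unless V vanishes almost
everywhere (`phaseShift_ne_zero`). -/

section Primitive

/-! ### Calculus of absolutely continuous functions and Grönwall's inequality -/

variable {E : Type*} [NormedAddCommGroup E] [NormedSpace ℝ E]

/-- `f` is absolutely continuous on `[0, T]` with derivative `f'`. -/
def IsPrimitiveOn (f f' : ℝ → E) (T : ℝ) : Prop :=
  IntervalIntegrable f' volume 0 T ∧ ∀ x ∈ Icc 0 T, f x = f 0 + ∫ t in (0 : ℝ)..x, f' t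

namespace IsPrimitiveOn

variable {f f' g g' : ℝ → E} {T : ℝ}

theorem intervalIntegrable (h : IsPrimitiveOn f f' T) {x y : ℝ} (hx : x ∈ Icc 0 T)
    (hy : y ∈ Icc 0 T) : IntervalIntegrable f' volume x y := by
  refine h.1.mono_set ?_
  rw [uIcc_of_le (hx.1.trans hx.2)]
  exact (uIcc_subset_Icc hx hy)

theorem sub_eq (h : IsPrimitiveOn f f' T) {x y : ℝ} (hx : x ∈ Icc 0 T) (hy : y ∈ Icc 0 T) :
    f y - f x = ∫ t in x..y, f' t := by
  have h0 : (0 : ℝ) ∈ Icc 0 T := ⟨le_rfl, hx.1.trans hx.2⟩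
  rw [h.2 x hx, h.2 y hy, ← intervalIntegral.integral_interval_sub_left
    (h.intervalIntegrable h0 hy) (h.intervalIntegrable h0 hx)]
  abel

theorem continuousOn (h : IsPrimitiveOn f f' T) : ContinuousOn f (Icc 0 T) := by
  by_cases hT : 0 ≤ T
  · have := intervalIntegral.continuousOn_primitive_interval (μ := volume) (f := f') (a := 0) (b := T)
      (by rw [uIcc_of_le hT]; exact (intervalIntegrable_iff_integrableOn_Icc_of_le hT).1 h.1)
    rw [uIcc_of_le hT] at this
    exact (continuousOn_const.add this).congr h.2
  · simp [Icc_eq_empty hT]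

theorem congr (hT : 0 ≤ T) (h : IsPrimitiveOn f f' T) (hfg : ∀ x ∈ Icc 0 T, g x = f x)
    (hfg' : ∀ᵐ x, x ∈ Ioc 0 T → g' x = f' x) : IsPrimitiveOn g g' T := by
  have key : ∀ x ∈ Icc 0 T, ∀ᵐ t, t ∈ uIoc 0 x → f' t = g' t := by
    intro x hx
    filter_upwards [hfg'] with t ht htx
    rw [uIoc_of_le hx.1] at htx
    exact (ht ⟨htx.1, htx.2.trans hx.2⟩).symm
  refine ⟨h.1.congr_ae ?_, fun x hx => ?_⟩
  · rw [EventuallyEq, ae_restrict_iff' measurableSet_uIoc]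
    exact key T ⟨hT, le_rfl⟩
  · rw [hfg x hx, hfg 0 ⟨le_rfl, hT⟩, h.2 x hx, intervalIntegral.integral_congr_ae (key x hx)]

/-- The increments of f are dominated by those of the scalar primitive of ‖f'‖, which is absolutely
continuous. -/
theorem absolutelyContinuousOnInterval (hT : 0 ≤ T) (h : IsPrimitiveOn f f' T) :
    AbsolutelyContinuousOnInterval f 0 T := by
  have hG := h.1.norm.absolutelyContinuousOnInterval_intervalIntegral
    (c := 0) (by simp)
  rw [absolutelyContinuousOnInterval_iff] at hG ⊢
  intro ε hε
  obtain ⟨δ, hδ, H⟩ := hG ε hε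
  refine ⟨δ, hδ, fun e he hlt => lt_of_le_of_lt (Finset.sum_le_sum fun i hi => ?_) (H e he hlt)⟩
  have hmem := he.1 i hi
  rw [uIcc_of_le hT] at hmem
  have h0 : (0 : ℝ) ∈ Icc 0 T := ⟨le_rfl, hT⟩
  rw [dist_comm, dist_eq_norm, h.sub_eq hmem.1 hmem.2, dist_comm, Real.dist_eq,
    intervalIntegral.integral_interval_sub_left (h.intervalIntegrable h0 hmem.2).norm
    (h.intervalIntegrable h0 hmem.1).norm]
  exact intervalIntegral.norm_integral_le_abs_integral_norm

/-- The difference of f and the primitive of f' is absolutely continuous with zero derivative almost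
everywhere, hence constant. Product and chain rules below follow from this by checking derivatives
almost everywhere only. -/
theorem of_absolutelyContinuousOnInterval [CompleteSpace E] (hT : 0 ≤ T)
    (hf : AbsolutelyContinuousOnInterval f 0 T)
    (hint : IntervalIntegrable f' volume 0 T)
    (hd : ∀ᵐ x, x ∈ Ioo 0 T → HasDerivAt f (f' x) x) : IsPrimitiveOn f f' T := by
  have h0 : (0 : ℝ) ∈ uIcc 0 T := by simp
  have hG : IsPrimitiveOn (fun x => ∫ t in (0 : ℝ)..x, f' t) f' T :=
    ⟨hint, fun x hx => by simp⟩
  have hac := hf.fun_sub (hG.absolutelyContinuousOnInterval hT)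
  have h1 : ∀ᵐ x : ℝ, x ≠ 0 := by simp [ae_iff, measure_singleton]
  have h2 : ∀ᵐ x : ℝ, x ≠ T := by simp [ae_iff, measure_singleton]
  obtain ⟨C, hC⟩ := hac.const_of_ae_hasDerivAt_zero (by
    filter_upwards [hd, hint.ae_hasDerivAt_integral, h1, h2] with x hx hx' hx1 hx2 hmem
    have hmem' := hmem
    rw [uIcc_of_le hT] at hmem'
    have := (hx ⟨lt_of_le_of_ne hmem'.1 hx1.symm, lt_of_le_of_ne hmem'.2 hx2⟩).sub
      (hx' hmem 0 h0)
    rw [sub_self] at this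
    exact this)
  refine ⟨hint, fun x hx => ?_⟩
  have e1 := hC x (by rwa [uIcc_of_le hT])
  have e2 := hC 0 h0
  simp only [intervalIntegral.integral_same, sub_zero] at e1 e2
  rw [e2, ← e1]; abel

theorem ae_hasDerivAt [CompleteSpace E] (hT : 0 ≤ T) (h : IsPrimitiveOn f f' T) :
    ∀ᵐ x, x ∈ Ioo 0 T → HasDerivAt f (f' x) x := by
  filter_upwards [h.1.ae_hasDerivAt_integral] with x hx hmem
  have := (hx (by rw [uIcc_of_le hT]; exact Ioo_subset_Icc_self hmem) 0 (by simp)).const_add (f 0)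
  refine this.congr_of_eventuallyEq ?_
  filter_upwards [Ioo_mem_nhds hmem.1 hmem.2] with y hy
  exact h.2 y (Ioo_subset_Icc_self hy)

theorem add (hf : IsPrimitiveOn f f' T) (hg : IsPrimitiveOn g g' T) :
    IsPrimitiveOn (fun x => f x + g x) (fun x => f' x + g' x) T := by
  refine ⟨hf.1.add hg.1, fun x hx => ?_⟩
  have h0 : (0 : ℝ) ∈ Icc 0 T := ⟨le_rfl, hx.1.trans hx.2⟩
  beta_reduce
  rw [intervalIntegral.integral_add (hf.intervalIntegrable h0 hx) (hg.intervalIntegrable h0 hx),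
    hf.2 x hx, hg.2 x hx]
  abel

theorem neg (hf : IsPrimitiveOn f f' T) :
    IsPrimitiveOn (fun x => -f x) (fun x => -f' x) T := by
  refine ⟨hf.1.neg, fun x hx => ?_⟩
  beta_reduce
  rw [intervalIntegral.integral_neg, hf.2 x hx]
  abel

theorem sub (hf : IsPrimitiveOn f f' T) (hg : IsPrimitiveOn g g' T) :
    IsPrimitiveOn (fun x => f x - g x) (fun x => f' x - g' x) T := by
  simpa only [sub_eq_add_neg] using hf.add hg.neg

theorem const (c : E) : IsPrimitiveOn (fun _ => c) (fun _ => 0) T :=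
  ⟨intervalIntegrable_const, fun x _ => by simp⟩

theorem integral (hf : IntervalIntegrable f' volume 0 T) :
    IsPrimitiveOn (fun x => ∫ t in (0 : ℝ)..x, f' t) f' T :=
  ⟨hf, fun x _ => by simp⟩

theorem clm_comp {F : Type*} [NormedAddCommGroup F] [NormedSpace ℝ F] [CompleteSpace E]
    [CompleteSpace F] (A : E →L[ℝ] F)
    (hf : IsPrimitiveOn f f' T) : IsPrimitiveOn (fun x => A (f x)) (fun x => A (f' x)) T := by
  refine ⟨⟨A.integrable_comp hf.1.1, A.integrable_comp hf.1.2⟩, fun x hx => ?_⟩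
  beta_reduce
  rw [hf.2 x hx, map_add, A.intervalIntegral_comp_comm
    (hf.intervalIntegrable ⟨le_rfl, hx.1.trans hx.2⟩ hx)]

theorem ofReal {f f' : ℝ → ℝ} (hf : IsPrimitiveOn f f' T) :
    IsPrimitiveOn (fun x => (f x : ℂ)) (fun x => (f' x : ℂ)) T :=
  hf.clm_comp Complex.ofRealCLM

theorem of_hasDerivAt [CompleteSpace E] (hT : 0 ≤ T) (hd : ∀ x ∈ Icc 0 T, HasDerivAt f (f' x) x)
    (hc : ContinuousOn f' (Icc 0 T)) : IsPrimitiveOn f f' T := by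
  have hI : ∀ x ∈ Icc 0 T, IntervalIntegrable f' volume 0 x := fun x hx =>
    (hc.mono (by rw [uIcc_of_le hx.1]; exact Icc_subset_Icc le_rfl hx.2)).intervalIntegrable
  refine ⟨hI T ⟨hT, le_rfl⟩, fun x hx => ?_⟩
  rw [intervalIntegral.integral_eq_sub_of_hasDerivAt (fun t ht => hd t ?_) (hI x hx)]
  · abel
  · rw [uIcc_of_le hx.1] at ht
    exact ⟨ht.1, ht.2.trans hx.2⟩

theorem smul [CompleteSpace E] {𝕜 : Type*} [NontriviallyNormedField 𝕜] [NormedAlgebra ℝ 𝕜]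
    [NormedSpace 𝕜 E] [IsScalarTower ℝ 𝕜 E] [CompleteSpace 𝕜] {p p' : ℝ → 𝕜} (hT : 0 ≤ T)
    (hp : IsPrimitiveOn p p' T) (hf : IsPrimitiveOn f f' T) :
    IsPrimitiveOn (fun x => p x • f x) (fun x => p x • f' x + p' x • f x) T := by
  have hcp : ContinuousOn p (uIcc 0 T) := by rw [uIcc_of_le hT]; exact hp.continuousOn
  have hcf : ContinuousOn f (uIcc 0 T) := by rw [uIcc_of_le hT]; exact hf.continuousOn
  refine of_absolutelyContinuousOnInterval hT ((hp.absolutelyContinuousOnInterval hT).fun_smul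
    (hf.absolutelyContinuousOnInterval hT)) ((hf.1.continuousOn_smul hcp).add
    (hp.1.smul_continuousOn hcf)) ?_
  filter_upwards [hp.ae_hasDerivAt hT, hf.ae_hasDerivAt hT] with x h1 h2 hx
  exact (h1 hx).smul (h2 hx)

theorem mul {𝕜 : Type*} [NontriviallyNormedField 𝕜] [NormedAlgebra ℝ 𝕜]
    [CompleteSpace 𝕜] {p p' q q' : ℝ → 𝕜} (hT : 0 ≤ T)
    (hp : IsPrimitiveOn p p' T) (hq : IsPrimitiveOn q q' T) :
    IsPrimitiveOn (fun x => p x * q x) (fun x => p x * q' x + p' x * q x) T :=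
  hp.smul hT hq

/-- Absolute continuity survives composition only with a Lipschitz outer function; F is Lipschitz on
the compact interval p([0, T]) because F' is bounded there. -/
theorem comp {p p' : ℝ → ℝ} {F F' : ℝ → ℝ} {s : Set ℝ} (hT : 0 ≤ T)
    (hp : IsPrimitiveOn p p' T) (hps : ∀ x ∈ Icc 0 T, p x ∈ s)
    (hF : ∀ x ∈ s, HasDerivAt F (F' x) x) (hF' : ContinuousOn F' s) :
    IsPrimitiveOn (fun x => F (p x)) (fun x => F' (p x) * p' x) T := by
  have himg : p '' Icc 0 T ⊆ s := by rintro _ ⟨x, hx, rfl⟩; exact hps x hx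
  have hcomp : IsCompact (p '' Icc 0 T) := isCompact_Icc.image_of_continuousOn hp.continuousOn
  have hconv : Convex ℝ (p '' Icc 0 T) :=
    ((isPreconnected_Icc.image p hp.continuousOn).ordConnected).convex
  obtain ⟨C, hC⟩ := hcomp.exists_bound_of_continuousOn (hF'.mono himg)
  have hlip : LipschitzOnWith C.toNNReal F (p '' Icc 0 T) :=
    hconv.lipschitzOnWith_of_nnnorm_hasDerivWithin_le
      (fun x hx => (hF x (himg hx)).hasDerivWithinAt) (fun x hx => by
        rw [← NNReal.coe_le_coe, coe_nnnorm]
        exact (hC x hx).trans (Real.le_coe_toNNReal C))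
  have hac : AbsolutelyContinuousOnInterval (fun x => F (p x)) 0 T := by
    have := hp.absolutelyContinuousOnInterval hT
    rw [absolutelyContinuousOnInterval_iff] at this ⊢
    intro ε hε
    obtain ⟨δ, hδ, H⟩ := this (ε / (C.toNNReal + 1)) (by positivity)
    refine ⟨δ, hδ, fun e he hlt => ?_⟩
    have h1 := H e he hlt
    rw [lt_div_iff₀ (by positivity)] at h1
    refine lt_of_le_of_lt ?_ h1
    rw [Finset.sum_mul]
    refine Finset.sum_le_sum fun i hi => ?_
    have hmem := he.1 i hi
    rw [uIcc_of_le hT] at hmem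
    refine (hlip.dist_le_mul _ (mem_image_of_mem p hmem.1) _ (mem_image_of_mem p hmem.2)).trans ?_
    have := dist_nonneg (x := p (e.2 i).1) (y := p (e.2 i).2)
    nlinarith
  have hcF : ContinuousOn (fun x => F' (p x)) (uIcc 0 T) := by
    rw [uIcc_of_le hT]; exact hF'.comp hp.continuousOn hps
  refine of_absolutelyContinuousOnInterval hT hac (hp.1.continuousOn_mul hcF) ?_
  filter_upwards [hp.ae_hasDerivAt hT] with x h1 hx
  exact (hF _ (hps x (Ioo_subset_Icc_self hx))).comp x (h1 hx)

theorem comp_univ {p p' : ℝ → ℝ} {F F' : ℝ → ℝ} (hT : 0 ≤ T)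
    (hp : IsPrimitiveOn p p' T) (hF : ∀ x, HasDerivAt F (F' x) x) (hF' : Continuous F') :
    IsPrimitiveOn (fun x => F (p x)) (fun x => F' (p x) * p' x) T :=
  hp.comp hT (fun _ _ => mem_univ _) (fun x _ => hF x) hF'.continuousOn

end IsPrimitiveOn

/-- Grönwall's inequality with an integrable coefficient. -/
theorem le_mul_exp_of_le_integral {u l : ℝ → ℝ} {C T : ℝ} (hu : ContinuousOn u (Icc 0 T))
    (hl : IntervalIntegrable l volume 0 T) (hl0 : ∀ t, 0 ≤ l t)
    (h : ∀ t ∈ Icc 0 T, u t ≤ C + ∫ s in (0 : ℝ)..t, l s * u s) :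
    ∀ t ∈ Icc 0 T, u t ≤ C * Real.exp (∫ s in (0 : ℝ)..t, l s) := by
  intro t ht
  have hT : 0 ≤ T := ht.1.trans ht.2
  have hlu : IntervalIntegrable (fun s => l s * u s) volume 0 T :=
    hl.mul_continuousOn (by rwa [uIcc_of_le hT])
  have hL := IsPrimitiveOn.integral hl
  have hE := hL.neg.comp_univ hT (F := Real.exp) (F' := Real.exp)
    (fun x => Real.hasDerivAt_exp x) Real.continuous_exp
  have hG := (IsPrimitiveOn.const (T := T) C).add (IsPrimitiveOn.integral hlu)
  have key := (hG.mul hT hE).2 t ht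
  -- The right-hand side of the hypothesis times exp(-∫ l) has non-positive derivative, so it stays
  -- below its initial value C.
  have hneg : ∫ s in (0 : ℝ)..t, ((C + ∫ r in (0 : ℝ)..s, l r * u r) *
      (Real.exp (-∫ r in (0 : ℝ)..s, l r) * -l s) +
      (0 + l s * u s) * Real.exp (-∫ r in (0 : ℝ)..s, l r)) ≤ 0 := by
    rw [intervalIntegral.integral_of_le ht.1]
    refine setIntegral_nonpos measurableSet_Ioc fun s hs => ?_
    have := h s ⟨hs.1.le, hs.2.trans ht.2⟩
    have h2 := mul_nonneg (hl0 s) (Real.exp_pos (-∫ r in (0 : ℝ)..s, l r)).le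
    nlinarith
  simp only [intervalIntegral.integral_same, neg_zero, Real.exp_zero, add_zero, mul_one] at key
  have h3 : (C + ∫ r in (0 : ℝ)..t, l r * u r) * Real.exp (-∫ r in (0 : ℝ)..t, l r) ≤ C := by
    linarith
  refine (h t ht).trans ?_
  rw [Real.exp_neg, ← div_eq_mul_inv, div_le_iff₀ (Real.exp_pos _)] at h3
  exact h3

/-- A solution of `d' = ρ - β d`, `d(0) = 0` with `ρ ≥ 0` is non-negative, and positive where
`ρ` is bounded below. -/
theorem mul_le_of_linear_equation {d ρ β : ℝ → ℝ} {T : ℝ} (hT : 0 ≤ T) (h0 : d 0 = 0)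
    (hβ : IntervalIntegrable β volume 0 T)
    (h : IsPrimitiveOn d (fun t => ρ t - β t * d t) T) {m : ℝ} (hρ : ∀ t ∈ Ioc 0 T, m ≤ ρ t) :
    m * ∫ t in (0 : ℝ)..T, Real.exp (∫ s in (0 : ℝ)..t, β s) ≤
      d T * Real.exp (∫ s in (0 : ℝ)..T, β s) := by
  have hE := (IsPrimitiveOn.integral hβ).comp_univ hT (F := Real.exp) (F' := Real.exp)
    (fun x => Real.hasDerivAt_exp x) Real.continuous_exp
  have hP := h.mul hT hE
  -- With the integrating factor, (d exp ∫ β)' = ρ exp ∫ β.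
  have key := hP.2 T ⟨hT, le_rfl⟩
  simp only [h0, zero_mul, zero_add] at key
  rw [key, ← intervalIntegral.integral_const_mul]
  have hc : ContinuousOn (fun t => Real.exp (∫ s in (0 : ℝ)..t, β s)) (uIcc 0 T) := by
    rw [uIcc_of_le hT]; exact hE.continuousOn
  refine intervalIntegral.integral_mono_on_of_le_Ioo hT
    (hc.intervalIntegrable.const_mul m) hP.1 fun t ht => ?_
  have := hρ t (Ioo_subset_Ioc_self ht)
  have h2 := Real.exp_pos (∫ s in (0 : ℝ)..t, β s)
  nlinarith

end Primitive

/-! ### Carathéodory existence, uniqueness and stability -/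

section Caratheodory

variable {E : Type*} [NormedAddCommGroup E] [NormedSpace ℝ E]

open scoped BoundedContinuousFunction in
/-- Global existence for an ordinary differential equation whose right-hand side is Lipschitz with
a locally integrable constant. -/
theorem exists_caratheodory_solution [CompleteSpace E] {F : ℝ → E → E} {l : ℝ → ℝ} (x₀ : E)
    (hl : ∀ T, IntervalIntegrable l volume 0 T) (hl0 : ∀ t, 0 ≤ l t)
    (hlip : ∀ t x y, ‖F t x - F t y‖ ≤ l t * ‖x - y‖) (hb : ∀ t, ‖F t x₀‖ ≤ l t)
    (hmeas : ∀ X : ℝ → E, Continuous X → AEStronglyMeasurable (fun t => F t (X t)) volume) :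
    ∃ X : ℝ → E, Continuous X ∧ ∀ t, 0 ≤ t → X t = x₀ + ∫ s in (0 : ℝ)..t, F s (X s) := by
  set Λ : ℝ → ℝ := fun t => ∫ s in (0 : ℝ)..t, l s with hΛ
  have hΛc : Continuous Λ := intervalIntegral.continuous_primitive
    (fun a b => (hl a).symm.trans (hl b)) 0
  have hexp : ∀ T, 0 ≤ T → ∫ s in (0 : ℝ)..T, l s * Real.exp (2 * Λ s) =
      (Real.exp (2 * Λ T) - 1) / 2 := by
    intro T hT
    have := ((IsPrimitiveOn.integral (hl T)).comp_univ hT (F := fun x => Real.exp (2 * x))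
      (F' := fun x => Real.exp (2 * x) * 2) (fun x => by
        have := ((hasDerivAt_id x).const_mul 2).exp; simpa using this) (by fun_prop)).2 T
        ⟨hT, le_rfl⟩
    simp only [intervalIntegral.integral_same, mul_zero, Real.exp_zero] at this
    have h2 : ∫ s in (0 : ℝ)..T, l s * Real.exp (2 * Λ s) =
        (∫ s in (0 : ℝ)..T, Real.exp (2 * Λ s) * 2 * l s) / 2 := by
      rw [← intervalIntegral.integral_div]
      congr 1; ext s; ring
    rw [h2, hΛ]
    linarith
  have hwI : ∀ a b, IntervalIntegrable (fun s => l s * Real.exp (2 * Λ s)) volume a b := fun a b =>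
    ((hl a).symm.trans (hl b)).mul_continuousOn (by fun_prop)
  have hΛ0 : ∀ t, 0 ≤ t → 0 ≤ Λ t := fun t ht =>
    intervalIntegral.integral_nonneg ht fun s _ => hl0 s
  -- The substitution X = x₀ + exp(2Λ) Y builds a weighted sup norm into the unknown. Since ∫ l
  -- exp(2Λ) = (exp(2Λ) - 1)/2, the Picard map contracts by 1/2 on the whole half-line at once.
  set G : (ℝ →ᵇ E) → ℝ → E := fun Y s => F s (x₀ + Real.exp (2 * Λ s) • Y s) with hG
  have hGb : ∀ Y : ℝ →ᵇ E, ∀ s, 0 ≤ s → ‖G Y s‖ ≤ (1 + ‖Y‖) * (l s * Real.exp (2 * Λ s)) := by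
    intro Y s hs
    have h1 := hlip s (x₀ + Real.exp (2 * Λ s) • Y s) x₀
    have h2 : ‖G Y s‖ ≤ l s * ‖Real.exp (2 * Λ s) • Y s‖ + l s := by
      refine (norm_le_norm_sub_add _ (F s x₀)).trans (add_le_add ?_ (hb s))
      simpa using h1
    rw [norm_smul, Real.norm_of_nonneg (Real.exp_pos _).le] at h2
    have h3 := Y.norm_coe_le_norm s
    have h4 : 1 ≤ Real.exp (2 * Λ s) := Real.one_le_exp (by have := hΛ0 s hs; positivity)
    have h5 := hl0 s
    have h6 : l s * (Real.exp (2 * Λ s) * ‖Y s‖) ≤ l s * (Real.exp (2 * Λ s) * ‖Y‖) := by gcongr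
    nlinarith
  have hGm : ∀ Y : ℝ →ᵇ E, AEStronglyMeasurable (G Y) volume := fun Y =>
    hmeas (fun s => x₀ + Real.exp (2 * Λ s) • Y s) (by fun_prop)
  have hGI0 : ∀ Y : ℝ →ᵇ E, ∀ T, 0 ≤ T → IntervalIntegrable (G Y) volume 0 T := by
    intro Y T hT
    refine ((hwI 0 T).const_mul (1 + ‖Y‖)).mono_fun' (hGm Y).restrict ?_
    rw [Filter.EventuallyLE, ae_restrict_iff' measurableSet_uIoc]
    refine Eventually.of_forall fun s hs => hGb Y s ?_
    rw [uIoc_of_le hT] at hs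
    exact hs.1.le
  -- Bounded continuous functions on ℝ serve as the complete space; freezing the integral at max t 0
  -- makes the negative half-line harmless.
  have hcont : ∀ Y : ℝ →ᵇ E, Continuous fun t : ℝ => ∫ s in (0 : ℝ)..max t 0, G Y s := by
    intro Y
    have h1 : ∀ t : ℝ, ∫ s in (0 : ℝ)..max t 0, G Y s =
        ∫ s in (0 : ℝ)..max t 0, (Ioi (0 : ℝ)).indicator (G Y) s := by
      intro t
      refine intervalIntegral.integral_congr_ae (Eventually.of_forall fun s hs => ?_)
      rw [uIoc_of_le (le_max_right _ _)] at hs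
      rw [indicator_of_mem (show s ∈ Ioi 0 from hs.1)]
    simp_rw [h1]
    have h2 : ∀ T, IntervalIntegrable ((Ioi (0 : ℝ)).indicator (G Y)) volume 0 T := by
      intro T
      refine ((hwI 0 T).const_mul (1 + ‖Y‖)).mono_fun'
        ((hGm Y).indicator measurableSet_Ioi).restrict (Eventually.of_forall fun s => ?_)
      beta_reduce
      by_cases hs : s ∈ Ioi (0 : ℝ)
      · rw [indicator_of_mem hs]; exact hGb Y s (le_of_lt hs)
      · rw [indicator_of_notMem hs, norm_zero]
        have := hl0 s
        positivity
    exact (intervalIntegral.continuous_primitive (fun a b => (h2 a).symm.trans (h2 b)) 0).comp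
      (by fun_prop : Continuous fun t : ℝ => max t 0)
  have hΦb : ∀ (f : ℝ → E) (M : ℝ), 0 ≤ M →
      (∀ s, 0 ≤ s → ‖f s‖ ≤ M * (l s * Real.exp (2 * Λ s))) → ∀ t : ℝ,
      ‖Real.exp (-(2 * Λ (max t 0))) • ∫ s in (0 : ℝ)..max t 0, f s‖ ≤ M / 2 := by
    intro f M hM hf t
    have h0 : 0 ≤ max t 0 := le_max_right _ _
    have h1 : ‖∫ s in (0 : ℝ)..max t 0, f s‖ ≤
        ∫ s in (0 : ℝ)..max t 0, M * (l s * Real.exp (2 * Λ s)) :=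
      intervalIntegral.norm_integral_le_of_norm_le h0
        (Eventually.of_forall fun s hs => hf s hs.1.le) ((hwI _ _).const_mul M)
    rw [intervalIntegral.integral_const_mul, hexp _ h0] at h1
    rw [norm_smul, Real.norm_of_nonneg (Real.exp_pos _).le, Real.exp_neg,
      inv_mul_le_iff₀ (Real.exp_pos _)]
    nlinarith
  set Φ : (ℝ →ᵇ E) → (ℝ →ᵇ E) := fun Y => BoundedContinuousFunction.ofNormedAddCommGroup
    (fun t : ℝ => Real.exp (-(2 * Λ (max t 0))) • ∫ s in (0 : ℝ)..max t 0, G Y s)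
    (by have := hcont Y; fun_prop) ((1 + ‖Y‖) / 2) (hΦb _ _ (by positivity) (hGb Y)) with hΦ
  have hcontr : ContractingWith (1 / 2) Φ := by
    refine ⟨by rw [← NNReal.coe_lt_coe]; norm_num, LipschitzWith.of_dist_le_mul fun Y Z => ?_⟩
    have hc : (((1 / 2 : NNReal) : ℝ)) = 1 / 2 := by norm_num
    rw [hc, BoundedContinuousFunction.dist_le (by positivity)]
    intro t
    have h0 : 0 ≤ max t 0 := le_max_right _ _
    have := hΦb (fun s => G Y s - G Z s) (dist Y Z) dist_nonneg (fun s hs => by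
      refine (hlip s _ _).trans ?_
      rw [add_sub_add_left_eq_sub, ← smul_sub, norm_smul, Real.norm_of_nonneg (Real.exp_pos _).le]
      have h1 := Y.dist_coe_le_dist (g := Z) s
      rw [dist_eq_norm] at h1
      have h2 := hl0 s
      calc l s * (Real.exp (2 * Λ s) * ‖Y s - Z s‖) ≤ l s * (Real.exp (2 * Λ s) * dist Y Z) := by
            gcongr
        _ = _ := by ring) t
    rw [intervalIntegral.integral_sub (hGI0 Y _ h0) (hGI0 Z _ h0), smul_sub] at this
    rw [dist_eq_norm, hΦ]
    simp only [BoundedContinuousFunction.coe_ofNormedAddCommGroup]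
    linarith
  have hfix := hcontr.fixedPoint_isFixedPt
  set Y := hcontr.fixedPoint Φ
  refine ⟨fun t => x₀ + Real.exp (2 * Λ t) • Y t, by fun_prop, fun t ht => ?_⟩
  have h1 : Y t = Real.exp (-(2 * Λ (max t 0))) • ∫ s in (0 : ℝ)..max t 0, G Y s := by
    conv_lhs => rw [← hfix]
    rfl
  rw [max_eq_left ht] at h1
  beta_reduce
  rw [h1, smul_smul, ← Real.exp_add, add_neg_cancel, Real.exp_zero, one_smul]

/-- Two solutions differ at most by their defect, amplified exponentially. -/
theorem norm_sub_le_of_caratheodory {F G : ℝ → E → E} {l : ℝ → ℝ} {X Y : ℝ → E} {T C : ℝ}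
    (hX : IsPrimitiveOn X (fun t => F t (X t)) T) (hY : IsPrimitiveOn Y (fun t => G t (Y t)) T)
    (h0 : X 0 = Y 0) (hl : IntervalIntegrable l volume 0 T) (hl0 : ∀ t, 0 ≤ l t)
    (hlip : ∀ t x y, ‖F t x - F t y‖ ≤ l t * ‖x - y‖)
    (hC : ∀ t ∈ Icc 0 T, ‖∫ s in (0 : ℝ)..t, (F s (Y s) - G s (Y s))‖ ≤ C)
    (hI : IntervalIntegrable (fun s => F s (Y s)) volume 0 T) :
    ∀ t ∈ Icc 0 T, ‖X t - Y t‖ ≤ C * Real.exp (∫ s in (0 : ℝ)..t, l s) := by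
  refine le_mul_exp_of_le_integral ((hX.continuousOn.sub hY.continuousOn).norm) hl hl0 ?_
  intro t ht
  have h0t : (0 : ℝ) ∈ Icc 0 T := ⟨le_rfl, ht.1.trans ht.2⟩
  have iF := (IsPrimitiveOn.integral hI).intervalIntegrable h0t ht
  have iX := hX.intervalIntegrable h0t ht
  have iY := hY.intervalIntegrable h0t ht
  have il := (IsPrimitiveOn.integral hl).intervalIntegrable h0t ht
  have e : X t - Y t = (∫ s in (0 : ℝ)..t, (F s (Y s) - G s (Y s))) +
      ∫ s in (0 : ℝ)..t, (F s (X s) - F s (Y s)) := by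
    rw [hX.2 t ht, hY.2 t ht, h0, intervalIntegral.integral_sub iF iY,
      intervalIntegral.integral_sub iX iF]
    abel
  rw [e]
  refine (norm_add_le _ _).trans (add_le_add (hC t ht) ?_)
  refine intervalIntegral.norm_integral_le_of_norm_le ht.1
    (Eventually.of_forall fun s _ => hlip s _ _) (il.mul_continuousOn ?_)
  rw [uIcc_of_le ht.1]
  exact ((hX.continuousOn.sub hY.continuousOn).norm).mono (Icc_subset_Icc le_rfl ht.2)

theorem eqOn_of_caratheodory {F : ℝ → E → E} {l : ℝ → ℝ} {X Y : ℝ → E} {T : ℝ}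
    (hX : IsPrimitiveOn X (fun t => F t (X t)) T) (hY : IsPrimitiveOn Y (fun t => F t (Y t)) T)
    (h0 : X 0 = Y 0) (hl : IntervalIntegrable l volume 0 T) (hl0 : ∀ t, 0 ≤ l t)
    (hlip : ∀ t x y, ‖F t x - F t y‖ ≤ l t * ‖x - y‖) : EqOn X Y (Icc 0 T) := by
  intro t ht
  have := norm_sub_le_of_caratheodory hX hY h0 hl hl0 hlip (C := 0) (fun t _ => by simp) hY.1 t ht
  rw [zero_mul] at this
  exact sub_eq_zero.1 (norm_le_zero_iff.1 this)

end Caratheodory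

/-- The potentials on the half-line, extended by `0` to the whole line. -/
structure IsPotential (V : ℝ → ℝ) : Prop where
  measurable : Measurable V
  nonneg : ∀ x, 0 ≤ V x
  eq_zero : ∀ x ≤ 0, V x = 0
  integrable_moment : Integrable fun x => V x * (1 + x ^ 2)

/-! ### Moments of the potential -/

namespace IsPotential

variable {V : ℝ → ℝ}

theorem zero : IsPotential 0 :=
  ⟨measurable_zero, fun _ => le_rfl, fun _ _ => rfl, by simp⟩

theorem integrable_of_le (hV : IsPotential V) {f : ℝ → ℝ} (hf : Measurable f)
    (h : ∀ x, 0 ≤ x → |f x| ≤ 1 + x ^ 2) : Integrable fun x => V x * f x := by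
  refine hV.integrable_moment.mono (hV.measurable.mul hf).aestronglyMeasurable
    (Eventually.of_forall fun x => ?_)
  rw [norm_mul, norm_mul]
  rcases le_total x 0 with hx | hx
  · simp [hV.eq_zero x hx]
  · refine mul_le_mul_of_nonneg_left ?_ (norm_nonneg _)
    exact (h x hx).trans (le_abs_self _)

theorem integrable (hV : IsPotential V) : Integrable V := by
  have := hV.integrable_of_le (f := fun _ => 1) measurable_const (fun x _ => by
    rw [abs_one]; nlinarith)
  simpa using this

theorem integrable_mul (hV : IsPotential V) : Integrable fun x => V x * x :=
  hV.integrable_of_le measurable_id (fun x hx => by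
    simp only [abs_of_nonneg hx]; nlinarith [sq_nonneg (x - 1)])

theorem integrable_mul_sq (hV : IsPotential V) : Integrable fun x => V x * x ^ 2 :=
  hV.integrable_of_le (by fun_prop) (fun x hx => by
    rw [abs_of_nonneg (by positivity)]; linarith)

theorem intervalIntegrable (hV : IsPotential V) (a b : ℝ) : IntervalIntegrable V volume a b :=
  hV.integrable.intervalIntegrable

end IsPotential

/-! ### The regular solution and its dependence on the spectral parameter -/

section RegularSolution

variable {𝕜 : Type*} [RCLike 𝕜]

/-- The right-hand side of `u'' = (V - lam) u` as a first order system. -/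
def schrodingerField (V : ℝ → ℝ) (lam : 𝕜) (t : ℝ) (x : 𝕜 × 𝕜) : 𝕜 × 𝕜 :=
  (x.2, V t • x.1 - lam * x.1)

theorem norm_schrodingerField_le {V : ℝ → ℝ} (hV : IsPotential V) (lam : 𝕜) (t : ℝ) (x : 𝕜 × 𝕜) :
    ‖schrodingerField V lam t x‖ ≤ (1 + V t + ‖lam‖) * ‖x‖ := by
  have h1 := norm_fst_le x
  have h2 := norm_snd_le x
  have hVt := hV.nonneg t
  have h3 := norm_nonneg lam
  have h4 := norm_nonneg x
  refine (Prod.norm_def _).le.trans (max_le ?_ ?_)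
  · simp only [schrodingerField]
    nlinarith [mul_nonneg hVt h4, mul_nonneg h3 h4]
  · refine (norm_sub_le _ _).trans ?_
    rw [norm_smul, norm_mul, Real.norm_of_nonneg hVt]
    nlinarith [mul_le_mul_of_nonneg_left h1 hVt, mul_le_mul_of_nonneg_left h1 h3]

theorem schrodingerField_sub (V : ℝ → ℝ) (lam : 𝕜) (t : ℝ) (x y : 𝕜 × 𝕜) :
    schrodingerField V lam t x - schrodingerField V lam t y = schrodingerField V lam t (x - y) := by
  ext
  · simp [schrodingerField]
  · simp only [schrodingerField, Prod.snd_sub, Prod.fst_sub, smul_sub]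
    ring

theorem lipschitz_schrodingerField {V : ℝ → ℝ} (hV : IsPotential V) (lam : 𝕜) (t : ℝ)
    (x y : 𝕜 × 𝕜) : ‖schrodingerField V lam t x - schrodingerField V lam t y‖ ≤
      (1 + V t + ‖lam‖) * ‖x - y‖ := by
  rw [schrodingerField_sub]
  exact norm_schrodingerField_le hV lam t _

theorem exists_regularSolution {V : ℝ → ℝ} (hV : IsPotential V) (lam : 𝕜) :
    ∃ X : ℝ → 𝕜 × 𝕜, Continuous X ∧ X 0 = (0, 1) ∧
      ∀ T, 0 ≤ T → IsPrimitiveOn X (fun t => schrodingerField V lam t (X t)) T := by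
  have hm : ∀ X : ℝ → 𝕜 × 𝕜, Continuous X →
      AEStronglyMeasurable (fun t => schrodingerField V lam t (X t)) volume := by
    intro X hX
    have h1 := hX.measurable
    have h2 := hV.measurable
    unfold schrodingerField
    exact ((measurable_snd.comp h1).prodMk ((h2.smul (measurable_fst.comp h1)).sub
      ((measurable_fst.comp h1).const_mul lam))).aestronglyMeasurable
  have hl : ∀ T, IntervalIntegrable (fun t => 1 + V t + ‖lam‖) volume 0 T := fun T =>
    (intervalIntegrable_const.add (hV.intervalIntegrable 0 T)).add intervalIntegrable_const
  have hl0 : ∀ t, 0 ≤ 1 + V t + ‖lam‖ := fun t => by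
    have := hV.nonneg t
    positivity
  obtain ⟨X, hXc, hX⟩ := exists_caratheodory_solution (F := schrodingerField V lam)
    ((0, 1) : 𝕜 × 𝕜) hl hl0 (lipschitz_schrodingerField hV lam) (fun t => by
      have := norm_schrodingerField_le hV lam t ((0, 1) : 𝕜 × 𝕜)
      have h1 : ‖((0, 1) : 𝕜 × 𝕜)‖ = 1 := by simp [Prod.norm_def]
      rwa [h1, mul_one] at this) hm
  have hX0 : X 0 = (0, 1) := by rw [hX 0 le_rfl]; simp
  refine ⟨X, hXc, hX0, fun T hT => ⟨?_, fun x hx => by rw [hX0]; exact hX x hx.1⟩⟩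
  refine ((hl T).mul_continuousOn (g := fun t => ‖X t‖) (by fun_prop)).mono_fun' (hm X hXc).restrict
    (Eventually.of_forall fun t => norm_schrodingerField_le hV lam t _)

/-- The regular solution of `u'' = (V - lam) u`, `u(0) = 0`, `u'(0) = 1`, and its derivative. -/
noncomputable def regularPair (V : ℝ → ℝ) (lam : 𝕜) : ℝ → 𝕜 × 𝕜 :=
  Classical.epsilon fun X : ℝ → 𝕜 × 𝕜 => Continuous X ∧ X 0 = (0, 1) ∧
      ∀ T, 0 ≤ T → IsPrimitiveOn X (fun t => schrodingerField V lam t (X t)) T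

/-- The regular solution of `u'' = (V - lam) u`. -/
noncomputable def regSol (V : ℝ → ℝ) (lam : 𝕜) (x : ℝ) : 𝕜 := (regularPair V lam x).1

/-- The derivative of the regular solution of `u'' = (V - lam) u`. -/
noncomputable def regSol' (V : ℝ → ℝ) (lam : 𝕜) (x : ℝ) : 𝕜 := (regularPair V lam x).2

variable {V : ℝ → ℝ}

theorem regularPair_spec (hV : IsPotential V) (lam : 𝕜) :
    Continuous (regularPair V lam) ∧ regularPair V lam 0 = (0, 1) ∧ ∀ T, 0 ≤ T →
      IsPrimitiveOn (regularPair V lam)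
        (fun t => schrodingerField V lam t (regularPair V lam t)) T :=
  Classical.epsilon_spec (exists_regularSolution hV lam)

theorem continuous_regSol (hV : IsPotential V) (lam : 𝕜) : Continuous (regSol V lam) :=
  continuous_fst.comp (regularPair_spec hV lam).1

theorem continuous_regSol' (hV : IsPotential V) (lam : 𝕜) : Continuous (regSol' V lam) :=
  continuous_snd.comp (regularPair_spec hV lam).1

theorem regSol_zero (hV : IsPotential V) (lam : 𝕜) : regSol V lam 0 = 0 := by
  rw [regSol, (regularPair_spec hV lam).2.1]

theorem regSol'_zero (hV : IsPotential V) (lam : 𝕜) : regSol' V lam 0 = 1 := by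
  rw [regSol', (regularPair_spec hV lam).2.1]

theorem isPrimitiveOn_regSol (hV : IsPotential V) (lam : 𝕜) {T : ℝ} (hT : 0 ≤ T) :
    IsPrimitiveOn (regSol V lam) (regSol' V lam) T :=
  ((regularPair_spec hV lam).2.2 T hT).clm_comp (ContinuousLinearMap.fst ℝ 𝕜 𝕜)

theorem isPrimitiveOn_regSol' (hV : IsPotential V) (lam : 𝕜) {T : ℝ} (hT : 0 ≤ T) :
    IsPrimitiveOn (regSol' V lam) (fun t => V t • regSol V lam t - lam * regSol V lam t) T :=
  ((regularPair_spec hV lam).2.2 T hT).clm_comp (ContinuousLinearMap.snd ℝ 𝕜 𝕜)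

/-- A solution of `u'' = (V - lam) u` with `u(0) = 0` is a multiple of the regular solution. -/
theorem eq_mul_regSol (hV : IsPotential V) {lam : 𝕜} {T : ℝ} (hT : 0 ≤ T) {u v : ℝ → 𝕜}
    (h0 : u 0 = 0) (hu : IsPrimitiveOn u v T)
    (hv : IsPrimitiveOn v (fun t => V t • u t - lam * u t) T) :
    ∀ x ∈ Icc 0 T, u x = v 0 * regSol V lam x ∧ v x = v 0 * regSol' V lam x := by
  have hX : IsPrimitiveOn (fun t => (u t, v t)) (fun t => schrodingerField V lam t (u t, v t)) T := by
    have h := (hu.clm_comp (ContinuousLinearMap.inl ℝ 𝕜 𝕜)).add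
      (hv.clm_comp (ContinuousLinearMap.inr ℝ 𝕜 𝕜))
    exact h.congr hT (fun x _ => by simp)
      (Eventually.of_forall fun x _ => by simp [schrodingerField])
  have hY : IsPrimitiveOn (fun t => v 0 • regularPair V lam t)
      (fun t => schrodingerField V lam t (v 0 • regularPair V lam t)) T := by
    have h := ((regularPair_spec hV lam).2.2 T hT).clm_comp
      (((v 0) • ContinuousLinearMap.id 𝕜 (𝕜 × 𝕜)).restrictScalars ℝ)
    refine h.congr hT (fun x _ => by simp) (Eventually.of_forall fun x _ => ?_)
    ext
    · simp [schrodingerField]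
    · simp only [schrodingerField, Prod.smul_fst, Prod.smul_snd, smul_eq_mul,
        ContinuousLinearMap.coe_restrictScalars', smul_apply,
        ContinuousLinearMap.id_apply, mul_sub, mul_smul_comm]
      ring
  have := eqOn_of_caratheodory hX hY (by
      simp [h0, (regularPair_spec hV lam).2.1])
    (l := fun t => 1 + V t + ‖lam‖)
    ((intervalIntegrable_const.add (hV.intervalIntegrable 0 T)).add intervalIntegrable_const)
    (fun t => by have := hV.nonneg t; positivity) (lipschitz_schrodingerField hV lam)
  intro x hx
  have h1 := this hx
  simp only [Prod.ext_iff, Prod.smul_fst, Prod.smul_snd, smul_eq_mul] at h1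
  exact h1

theorem regSol_ofReal (hV : IsPotential V) (lam : ℝ) {x : ℝ} (hx : 0 ≤ x) :
    regSol V (lam : ℂ) x = (regSol V lam x : ℝ) ∧ regSol' V (lam : ℂ) x = (regSol' V lam x : ℝ) := by
  have h := eq_mul_regSol hV (lam := (lam : ℂ)) hx (u := fun t => ((regSol V lam t : ℝ) : ℂ))
    (v := fun t => ((regSol' V lam t : ℝ) : ℂ)) (by simp [regSol_zero hV])
    (isPrimitiveOn_regSol hV lam hx).ofReal
    ((isPrimitiveOn_regSol' hV lam hx).ofReal.congr hx (fun _ _ => rfl)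
      (Eventually.of_forall fun t _ => by simp)) x ⟨hx, le_rfl⟩
  rw [regSol'_zero hV, Complex.ofReal_one, one_mul, one_mul] at h
  exact ⟨h.1.symm, h.2.symm⟩

/-- The derivative of the Wronskian is (lam - mu) times the product of the solutions. This yields
both orthogonality of eigenfunctions and difference quotients in the spectral parameter. -/
theorem regSol_wronskian (hV : IsPotential V) (lam mu : 𝕜) {x : ℝ} (hx : 0 ≤ x) :
    regSol V lam x * regSol' V mu x - regSol V mu x * regSol' V lam x =
      (lam - mu) * ∫ t in (0 : ℝ)..x, regSol V lam t * regSol V mu t := by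
  have h := ((isPrimitiveOn_regSol hV lam hx).mul hx (isPrimitiveOn_regSol' hV mu hx)).sub
    ((isPrimitiveOn_regSol hV mu hx).mul hx (isPrimitiveOn_regSol' hV lam hx))
  have h2 := h.2 x ⟨hx, le_rfl⟩
  simp only [regSol_zero hV, zero_mul, sub_self, zero_add] at h2
  rw [h2, ← intervalIntegral.integral_const_mul]
  congr 1
  ext t
  simp only [RCLike.real_smul_eq_coe_mul]
  ring

/-- The regular solution is locally Lipschitz in the spectral parameter. -/
theorem exists_norm_regularPair_sub_le (hV : IsPotential V) (mu : 𝕜) {T : ℝ} (hT : 0 ≤ T) :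
    ∃ K, 0 ≤ K ∧ ∀ lam : 𝕜, ‖lam - mu‖ ≤ 1 → ∀ t ∈ Icc 0 T,
      ‖regularPair V lam t - regularPair V mu t‖ ≤ K * ‖lam - mu‖ := by
  have hc := (regularPair_spec hV mu).1
  obtain ⟨M, hM⟩ := isCompact_Icc.exists_bound_of_continuousOn (hc.continuousOn (s := Icc 0 T))
  have hM0 : 0 ≤ M := (norm_nonneg _).trans (hM 0 ⟨le_rfl, hT⟩)
  refine ⟨T * M * Real.exp (∫ s in (0 : ℝ)..T, (1 + V s + (‖mu‖ + 1))), by positivity,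
    fun lam hlam t ht => ?_⟩
  have hl : IntervalIntegrable (fun t => 1 + V t + (‖mu‖ + 1)) volume 0 T :=
    (intervalIntegrable_const.add (hV.intervalIntegrable 0 T)).add intervalIntegrable_const
  have hll : ‖lam‖ ≤ ‖mu‖ + 1 := by
    have := norm_le_norm_sub_add lam mu; linarith
  have hl0 : ∀ t, 0 ≤ 1 + V t + (‖mu‖ + 1) := fun t => by
    have := hV.nonneg t
    positivity
  have hF : IntervalIntegrable (fun s => schrodingerField V lam s (regularPair V mu s)) volume 0 T := by
    have h1 : Continuous fun s => (((0 : 𝕜), (mu - lam) * (regularPair V mu s).1) : 𝕜 × 𝕜) := by fun_prop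
    refine ((((regularPair_spec hV mu).2.2 T hT).1).add (h1.intervalIntegrable 0 T)).congr
      fun s _ => ?_
    ext
    · simp [schrodingerField]
    · simp [schrodingerField]; ring
  have key := norm_sub_le_of_caratheodory (l := fun t => 1 + V t + (‖mu‖ + 1))
    (C := T * M * ‖lam - mu‖) ((regularPair_spec hV lam).2.2 T hT)
    ((regularPair_spec hV mu).2.2 T hT)
    (by rw [(regularPair_spec hV mu).2.1, (regularPair_spec hV lam).2.1]) hl hl0
    (fun t x y => (lipschitz_schrodingerField hV lam t x y).trans (by gcongr)) (by
      intro t ht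
      refine (intervalIntegral.norm_integral_le_of_norm_le_const (C := M * ‖lam - mu‖)
        fun s hs => ?_).trans ?_
      · rw [uIoc_of_le ht.1] at hs
        have e : schrodingerField V lam s (regularPair V mu s) -
            schrodingerField V mu s (regularPair V mu s) =
            (0, (mu - lam) * (regularPair V mu s).1) := by
          ext
          · simp [schrodingerField]
          · simp [schrodingerField]; ring
        rw [e]
        refine (Prod.norm_def _).le.trans (max_le (by simp; positivity) ?_)
        rw [norm_mul, norm_sub_rev, mul_comm]
        gcongr
        exact (norm_fst_le _).trans (hM s ⟨hs.1.le, hs.2.trans ht.2⟩)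
      · rw [sub_zero, abs_of_nonneg ht.1]
        have := ht.2
        calc M * ‖lam - mu‖ * t ≤ M * ‖lam - mu‖ * T := by gcongr
          _ = _ := by ring) hF t ht
  refine key.trans ?_
  have hmono : ∫ s in (0 : ℝ)..t, (1 + V s + (‖mu‖ + 1)) ≤
      ∫ s in (0 : ℝ)..T, (1 + V s + (‖mu‖ + 1)) :=
    intervalIntegral.integral_mono_interval le_rfl ht.1 ht.2
      (Eventually.of_forall hl0) hl
  calc T * M * ‖lam - mu‖ * Real.exp (∫ s in (0 : ℝ)..t, (1 + V s + (‖mu‖ + 1)))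
      ≤ T * M * ‖lam - mu‖ * Real.exp (∫ s in (0 : ℝ)..T, (1 + V s + (‖mu‖ + 1))) := by gcongr
    _ = _ := by ring

theorem continuous_regularPair_param (hV : IsPotential V) {t : ℝ} (ht : 0 ≤ t) :
    Continuous fun lam : 𝕜 => regularPair V lam t := by
  rw [continuous_iff_continuousAt]
  intro mu
  obtain ⟨K, hK0, hK⟩ := exists_norm_regularPair_sub_le hV mu ht
  rw [ContinuousAt, tendsto_iff_norm_sub_tendsto_zero]
  have h1 : Tendsto (fun lam : 𝕜 => K * ‖lam - mu‖) (𝓝 mu) (𝓝 0) := by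
    have : Continuous fun lam : 𝕜 => K * ‖lam - mu‖ := by fun_prop
    simpa using this.tendsto mu
  refine squeeze_zero' (Eventually.of_forall fun _ => norm_nonneg _) ?_ h1
  filter_upwards [Metric.closedBall_mem_nhds mu one_pos] with lam hlam
  exact hK lam (by simpa [dist_eq_norm] using hlam) t ⟨ht, le_rfl⟩

theorem continuous_regSol_param (hV : IsPotential V) {t : ℝ} (ht : 0 ≤ t) :
    Continuous fun lam : 𝕜 => regSol V lam t :=
  continuous_fst.comp (continuous_regularPair_param hV ht)

theorem continuous_regSol'_param (hV : IsPotential V) {t : ℝ} (ht : 0 ≤ t) :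
    Continuous fun lam : 𝕜 => regSol' V lam t :=
  continuous_snd.comp (continuous_regularPair_param hV ht)

theorem continuous_integral_regSol_mul (hV : IsPotential V) (mu : 𝕜) {x : ℝ} (hx : 0 ≤ x) :
    ContinuousAt (fun lam : 𝕜 => ∫ t in (0 : ℝ)..x, regSol V lam t * regSol V mu t) mu := by
  obtain ⟨K, hK0, hK⟩ := exists_norm_regularPair_sub_le hV mu hx
  have hc := continuous_regSol hV mu
  refine intervalIntegral.continuousAt_of_dominated_interval
    (bound := fun t => (K + ‖regularPair V mu t‖) * ‖regSol V mu t‖)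
    (Eventually.of_forall fun lam =>
      ((continuous_regSol hV lam).mul hc).aestronglyMeasurable) ?_ ?_ ?_
  · filter_upwards [Metric.closedBall_mem_nhds mu one_pos] with lam hlam
    refine Eventually.of_forall fun t ht => ?_
    rw [uIoc_of_le hx] at ht
    have hlam' : ‖lam - mu‖ ≤ 1 := by simpa [dist_eq_norm] using hlam
    rw [norm_mul]
    gcongr
    refine (norm_fst_le _).trans ((norm_le_norm_sub_add _ (regularPair V mu t)).trans ?_)
    gcongr
    refine (hK lam hlam' t ⟨ht.1.le, ht.2⟩).trans ?_
    nlinarith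
  · have := (regularPair_spec hV mu).1
    exact Continuous.intervalIntegrable (by fun_prop) _ _
  · refine Eventually.of_forall fun t ht => ?_
    rw [uIoc_of_le hx] at ht
    exact ((continuous_regSol_param hV ht.1.le).mul continuous_const).continuousAt

/-- At non-positive energy (u u')' = u'² + (V - lam) u² ≥ 0, so u u' ≥ 0 and u² is nondecreasing. As
u is positive just after 0, it can never return to 0 and change sign. Then u'' = (V - lam) u ≥ 0 and
u' stays above its initial value 1. -/
theorem one_le_regSol' (hV : IsPotential V) {lam : ℝ} (hlam : lam ≤ 0) {x : ℝ} (hx : 0 ≤ x) :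
    0 ≤ regSol V lam x ∧ 1 ≤ regSol' V lam x := by
  have h0 := regSol_zero hV lam
  have hpos : ∀ T, 0 ≤ T → 0 ≤ regSol V lam T * regSol' V lam T := by
    intro T hT
    have h := ((isPrimitiveOn_regSol hV lam hT).mul hT
      (isPrimitiveOn_regSol' hV lam hT)).2 T ⟨hT, le_rfl⟩
    beta_reduce at h
    rw [h, h0, zero_mul, zero_add]
    refine intervalIntegral.integral_nonneg hT fun t _ => ?_
    have := hV.nonneg t
    simp only [smul_eq_mul]
    nlinarith [mul_nonneg this (sq_nonneg (regSol V lam t)), sq_nonneg (regSol V lam t),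
      sq_nonneg (regSol' V lam t), mul_nonneg (neg_nonneg.2 hlam) (sq_nonneg (regSol V lam t))]
  have hmono : ∀ s t, 0 ≤ s → s ≤ t → regSol V lam s ^ 2 ≤ regSol V lam t ^ 2 := by
    intro s t hs hst
    have hT := hs.trans hst
    have h := ((isPrimitiveOn_regSol hV lam hT).mul hT (isPrimitiveOn_regSol hV lam hT)).sub_eq
      ⟨hs, hst⟩ ⟨hT, le_rfl⟩
    have h2 : 0 ≤ ∫ r in s..t, (regSol V lam r * regSol' V lam r +
        regSol' V lam r * regSol V lam r) :=
      intervalIntegral.integral_nonneg hst fun r hr => by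
        have := hpos r (hs.trans hr.1); linarith
    rw [← h] at h2
    nlinarith
  have hnn : ∀ T, 0 ≤ T → 0 ≤ regSol V lam T := by
    have hev : ∀ᶠ t in 𝓝 (0 : ℝ), 0 < regSol' V lam t := by
      refine (continuous_regSol' hV lam).continuousAt.eventually_const_lt ?_
      rw [regSol'_zero hV]; exact one_pos
    obtain ⟨ε, hε, hball⟩ := Metric.eventually_nhds_iff.1 hev
    have hsmall : ∀ T, 0 < T → T ≤ ε / 2 → 0 < regSol V lam T := by
      intro T hT hTε
      rw [(isPrimitiveOn_regSol hV lam hT.le).2 T ⟨hT.le, le_rfl⟩, h0, zero_add]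
      refine intervalIntegral.intervalIntegral_pos_of_pos_on
        ((continuous_regSol' hV lam).intervalIntegrable _ _) (fun t ht => hball ?_) hT
      rw [Real.dist_eq, sub_zero, abs_of_pos ht.1]
      linarith [ht.2]
    intro T hT
    by_contra! hneg
    have hTε : ε / 2 < T := by
      by_contra! h
      rcases hT.eq_or_lt with rfl | hT'
      · rw [h0] at hneg; exact lt_irrefl _ hneg
      · exact absurd (hsmall T hT' h) (not_lt.2 hneg.le)
    obtain ⟨z, hz, hz0⟩ := intermediate_value_Icc' hTε.le
      ((continuous_regSol hV lam).continuousOn) ⟨hneg.le, (hsmall (ε / 2) (by positivity) le_rfl).le⟩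
    have h1 := hmono (ε / 2) z (by positivity) hz.1
    have h2 := hsmall (ε / 2) (by positivity) le_rfl
    rw [hz0] at h1
    nlinarith
  refine ⟨hnn x hx, ?_⟩
  rw [(isPrimitiveOn_regSol' hV lam hx).2 x ⟨hx, le_rfl⟩, regSol'_zero hV]
  have : 0 ≤ ∫ t in (0 : ℝ)..x, (V t • regSol V lam t - lam * regSol V lam t) :=
    intervalIntegral.integral_nonneg hx fun t ht => by
      have h1 := hnn t ht.1
      have h2 := hV.nonneg t
      simp only [smul_eq_mul]
      nlinarith [mul_nonneg h2 h1, mul_nonneg (neg_nonneg.2 hlam) h1]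
  linarith

theorem le_regSol (hV : IsPotential V) {lam : ℝ} (hlam : lam ≤ 0) {x : ℝ} (hx : 0 ≤ x) :
    x ≤ regSol V lam x := by
  rw [(isPrimitiveOn_regSol hV lam hx).2 x ⟨hx, le_rfl⟩, regSol_zero hV, zero_add]
  have := intervalIntegral.integral_mono_on hx (intervalIntegrable_const (μ := volume) (c := (1 : ℝ)))
    ((continuous_regSol' hV lam).intervalIntegrable 0 x)
    (fun t ht => (one_le_regSol' hV hlam ht.1).2)
  simpa using this

end RegularSolution

/-! ### The Prüfer angle: monotonicity and Lipschitz bounds in the momentum -/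

section Prufer

variable {V : ℝ → ℝ} {k : ℝ}

theorem Real.sin_sq_sub_sin_sq (a b : ℝ) :
    Real.sin a ^ 2 - Real.sin b ^ 2 = Real.sin (a + b) * Real.sin (a - b) := by
  rw [Real.sin_add, Real.sin_sub]
  nlinarith [Real.sin_sq_add_cos_sq a, Real.sin_sq_add_cos_sq b]

theorem Real.sin_eq_sinc_mul (x : ℝ) : Real.sin x = Real.sinc x * x := by
  rcases eq_or_ne x 0 with rfl | hx
  · simp
  · rw [Real.sinc_of_ne_zero hx, div_mul_cancel₀ _ hx]

theorem IsPotential.integral_le (hV : IsPotential V) {f : ℝ → ℝ}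
    (hf : Integrable fun t => V t * f t) (h : ∀ t, 0 ≤ t → 0 ≤ f t) {x : ℝ} (hx : 0 ≤ x) :
    ∫ t in (0 : ℝ)..x, V t * f t ≤ ∫ t, V t * f t := by
  rw [intervalIntegral.integral_of_le hx]
  refine setIntegral_le_integral hf (Eventually.of_forall fun t => ?_)
  rcases le_total t 0 with ht | ht
  · simp [hV.eq_zero t ht]
  · exact mul_nonneg (hV.nonneg t) (h t ht)

theorem IsPotential.integral_nonneg (hV : IsPotential V) {f : ℝ → ℝ}
    (h : ∀ t, 0 ≤ t → 0 ≤ f t) : 0 ≤ ∫ t, V t * f t := by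
  refine MeasureTheory.integral_nonneg fun t => ?_
  rcases le_total t 0 with ht | ht
  · simp [hV.eq_zero t ht]
  · exact mul_nonneg (hV.nonneg t) (h t ht)

theorem exists_isPruferAngle (hV : IsPotential V) (hk : 0 < k) : ∃ θ, IsPruferAngle V k θ := by
  have hb : ∀ t x y : ℝ, ‖(k - V t * Real.sin x ^ 2 / k) - (k - V t * Real.sin y ^ 2 / k)‖ ≤
      (k + V t / k) * ‖x - y‖ := by
    intro t x y
    have e : (k - V t * Real.sin x ^ 2 / k) - (k - V t * Real.sin y ^ 2 / k) =
        -(V t / k * (Real.sin (x + y) * Real.sin (x - y))) := by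
      rw [← Real.sin_sq_sub_sin_sq]; ring
    rw [e, norm_neg, norm_mul, norm_mul, Real.norm_of_nonneg (div_nonneg (hV.nonneg t) hk.le)]
    have h1 : ‖Real.sin (x + y)‖ ≤ 1 := Real.abs_sin_le_one _
    have h2 : ‖Real.sin (x - y)‖ ≤ ‖x - y‖ := Real.abs_sin_le_abs
    have h3 := div_nonneg (hV.nonneg t) hk.le
    calc V t / k * (‖Real.sin (x + y)‖ * ‖Real.sin (x - y)‖) ≤ V t / k * (1 * ‖x - y‖) := by
          gcongr
      _ ≤ (k + V t / k) * ‖x - y‖ := by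
          have := norm_nonneg (x - y)
          nlinarith
  obtain ⟨X, hXc, hX⟩ := exists_caratheodory_solution
    (F := fun t x => k - V t * Real.sin x ^ 2 / k) (l := fun t => k + V t / k) (0 : ℝ)
    (fun T => intervalIntegrable_const.add ((hV.intervalIntegrable 0 T).div_const k))
    (fun t => by have := hV.nonneg t; positivity) hb (fun t => by
      have := div_nonneg (hV.nonneg t) hk.le
      simp [abs_of_pos hk, this]) (fun X hX => by
      have h1 := hX.measurable
      have h2 := hV.measurable
      exact Measurable.aestronglyMeasurable (by fun_prop))
  exact ⟨X, hXc.continuousOn, fun x hx => by rw [hX x hx, zero_add]⟩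

theorem pruferAngle_spec (hV : IsPotential V) (hk : 0 < k) : IsPruferAngle V k (pruferAngle V k) :=
  Classical.epsilon_spec (exists_isPruferAngle hV hk)

theorem continuousOn_pruferAngle (hV : IsPotential V) (hk : 0 < k) {T : ℝ} :
    ContinuousOn (pruferAngle V k) (Icc 0 T) :=
  (pruferAngle_spec hV hk).1.mono fun _ hx => hx.1

theorem pruferAngle_zero (hV : IsPotential V) (hk : 0 < k) : pruferAngle V k 0 = 0 := by
  rw [(pruferAngle_spec hV hk).2 0 le_rfl, intervalIntegral.integral_same]

theorem intervalIntegrable_potential_mul (hV : IsPotential V) {T : ℝ} (hT : 0 ≤ T) {f : ℝ → ℝ}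
    (hf : ContinuousOn f (Icc 0 T)) : IntervalIntegrable (fun t => V t * f t) volume 0 T :=
  (hV.intervalIntegrable 0 T).mul_continuousOn (by rwa [uIcc_of_le hT])

theorem isPrimitiveOn_pruferAngle (hV : IsPotential V) (hk : 0 < k) {T : ℝ} (hT : 0 ≤ T) :
    IsPrimitiveOn (pruferAngle V k) (fun t => k - V t * Real.sin (pruferAngle V k t) ^ 2 / k) T := by
  refine ⟨intervalIntegrable_const.sub (IntervalIntegrable.div_const ?_ k), fun x hx => ?_⟩
  · exact intervalIntegrable_potential_mul hV hT
      ((Real.continuous_sin.comp_continuousOn (continuousOn_pruferAngle hV hk)).pow 2)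
  · rw [pruferAngle_zero hV hk, zero_add]
    exact (pruferAngle_spec hV hk).2 x hx.1

/-- Writing sin θ = sinc(θ) θ makes the Prüfer equation linear, θ' = k - βθ, with positive source k;
the integrating factor finishes. -/
theorem pruferAngle_pos (hV : IsPotential V) (hk : 0 < k) {x : ℝ} (hx : 0 < x) :
    0 < pruferAngle V k x := by
  have hc := continuousOn_pruferAngle hV hk (T := x)
  have hβ : IntervalIntegrable (fun t => V t * (Real.sin (pruferAngle V k t) *
      Real.sinc (pruferAngle V k t) / k)) volume 0 x :=
    intervalIntegrable_potential_mul hV hx.le (((Real.continuous_sin.comp_continuousOn hc).mul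
      (Real.continuous_sinc.comp_continuousOn hc)).div_const k)
  have h := mul_le_of_linear_equation hx.le (pruferAngle_zero hV hk) (ρ := fun _ => k) hβ
    ((isPrimitiveOn_pruferAngle hV hk hx.le).congr hx.le (fun _ _ => rfl)
      (Eventually.of_forall fun t _ => by
        linear_combination (V t * Real.sin (pruferAngle V k t) / k) *
          Real.sin_eq_sinc_mul (pruferAngle V k t))) (m := k) (fun _ _ => le_rfl)
  have hB : ContinuousOn (fun t => Real.exp (∫ s in (0 : ℝ)..t, V s *
      (Real.sin (pruferAngle V k s) * Real.sinc (pruferAngle V k s) / k))) (Icc 0 x) :=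
    Real.continuous_exp.comp_continuousOn (IsPrimitiveOn.integral hβ).continuousOn
  have hpos := intervalIntegral.intervalIntegral_pos_of_pos_on
    (hB.mono (by rw [uIcc_of_le hx.le])).intervalIntegrable (fun t _ => Real.exp_pos _) hx
  exact pos_of_mul_pos_left ((mul_pos hk hpos).trans_le h) (Real.exp_pos _).le

theorem pruferAngle_nonneg (hV : IsPotential V) (hk : 0 < k) {x : ℝ} (hx : 0 ≤ x) :
    0 ≤ pruferAngle V k x := by
  rcases hx.eq_or_lt with rfl | hx
  · rw [pruferAngle_zero hV hk]
  · exact (pruferAngle_pos hV hk hx).le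

/-- The difference of the two angles solves a linear equation d' = ρ - βd: the factorization of sin²
a - sin² b extracts d through `sinc`, and the source ρ is at least k₂ - k₁ because 1/k₁ ≥ 1/k₂. -/
theorem pruferAngle_strictMono (hV : IsPotential V) {k₁ k₂ : ℝ} (hk : 0 < k₁) (hkk : k₁ < k₂)
    {x : ℝ} (hx : 0 < x) : pruferAngle V k₁ x < pruferAngle V k₂ x := by
  have hk2 := hk.trans hkk
  have hc1 := continuousOn_pruferAngle hV hk (T := x)
  have hc2 := continuousOn_pruferAngle hV hk2 (T := x)
  have hβ : IntervalIntegrable (fun t => V t * (Real.sin (pruferAngle V k₂ t + pruferAngle V k₁ t) *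
      Real.sinc (pruferAngle V k₂ t - pruferAngle V k₁ t) / k₁)) volume 0 x :=
    intervalIntegrable_potential_mul hV hx.le
      (((Real.continuous_sin.comp_continuousOn (hc2.add hc1)).mul
      (Real.continuous_sinc.comp_continuousOn (hc2.sub hc1))).div_const k₁)
  have h := mul_le_of_linear_equation hx.le
    (d := fun t => pruferAngle V k₂ t - pruferAngle V k₁ t)
    (by simp [pruferAngle_zero hV hk, pruferAngle_zero hV hk2])
    (ρ := fun t => (k₂ - k₁) + V t * Real.sin (pruferAngle V k₂ t) ^ 2 * (1 / k₁ - 1 / k₂)) hβ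
    (((isPrimitiveOn_pruferAngle hV hk2 hx.le).sub (isPrimitiveOn_pruferAngle hV hk hx.le)).congr
      hx.le (fun _ _ => rfl) (Eventually.of_forall fun t _ => by
        have e : Real.sin (pruferAngle V k₁ t) ^ 2 = Real.sin (pruferAngle V k₂ t) ^ 2 -
            Real.sin (pruferAngle V k₂ t + pruferAngle V k₁ t) *
            (Real.sinc (pruferAngle V k₂ t - pruferAngle V k₁ t) *
              (pruferAngle V k₂ t - pruferAngle V k₁ t)) := by
          rw [← Real.sin_eq_sinc_mul, ← Real.sin_sq_sub_sin_sq]; ring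
        rw [e]
        ring)) (m := k₂ - k₁) (fun t _ => by
      have h1 : 0 ≤ 1 / k₁ - 1 / k₂ := sub_nonneg.2 (one_div_le_one_div_of_le hk hkk.le)
      have := mul_nonneg (mul_nonneg (hV.nonneg t) (sq_nonneg (Real.sin (pruferAngle V k₂ t)))) h1
      linarith)
  have hB : ContinuousOn (fun t => Real.exp (∫ s in (0 : ℝ)..t, V s *
      (Real.sin (pruferAngle V k₂ s + pruferAngle V k₁ s) *
      Real.sinc (pruferAngle V k₂ s - pruferAngle V k₁ s) / k₁))) (Icc 0 x) :=
    Real.continuous_exp.comp_continuousOn (IsPrimitiveOn.integral hβ).continuousOn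
  have hpos := intervalIntegral.intervalIntegral_pos_of_pos_on
    (hB.mono (by rw [uIcc_of_le hx.le])).intervalIntegrable (fun t _ => Real.exp_pos _) hx
  have := pos_of_mul_pos_left ((mul_pos (sub_pos.2 hkk) hpos).trans_le h) (Real.exp_pos _).le
  linarith

/-- The phase accumulated on `[0, x]` due to the potential. -/
noncomputable def partialPhase (V : ℝ → ℝ) (x k : ℝ) : ℝ := pruferAngle V k x - k * x

theorem partialPhase_eq (hV : IsPotential V) (hk : 0 < k) {x : ℝ} (hx : 0 ≤ x) :
    partialPhase V x k = -∫ t in (0 : ℝ)..x, V t * (Real.sin (pruferAngle V k t) ^ 2 / k) := by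
  have hc := continuousOn_pruferAngle hV hk (T := x)
  have hI : IntervalIntegrable (fun t => V t * (Real.sin (pruferAngle V k t) ^ 2 / k)) volume 0 x :=
    intervalIntegrable_potential_mul hV hx
      (((Real.continuous_sin.comp_continuousOn hc).pow 2).div_const k)
  rw [partialPhase, (pruferAngle_spec hV hk).2 x hx]
  simp_rw [mul_div_assoc]
  rw [intervalIntegral.integral_sub intervalIntegrable_const hI]
  simp
  ring

/-- A non-negative potential only slows the angle down, so 0 ≤ θ ≤ kx. -/
theorem abs_sin_pruferAngle_le (hV : IsPotential V) (hk : 0 < k) {x : ℝ} (hx : 0 ≤ x) :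
    |Real.sin (pruferAngle V k x)| ≤ k * x := by
  have h1 : partialPhase V x k ≤ 0 := by
    rw [partialPhase_eq hV hk hx, neg_nonpos]
    exact intervalIntegral.integral_nonneg hx fun t _ => mul_nonneg (hV.nonneg t) (by positivity)
  have h2 := Real.abs_sin_le_abs (x := pruferAngle V k x)
  rw [abs_of_nonneg (pruferAngle_nonneg hV hk hx)] at h2
  rw [partialPhase] at h1
  linarith

/-- The first bound is uniform in k and uses the first moment of V; the second also vanishes as k →
0, at the price of the second moment. -/
theorem sin_sq_pruferAngle_le (hV : IsPotential V) (hk : 0 < k) {x : ℝ} (hx : 0 ≤ x) :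
    Real.sin (pruferAngle V k x) ^ 2 / k ≤ x ∧ Real.sin (pruferAngle V k x) ^ 2 / k ≤ k * x ^ 2 := by
  have h1 := abs_sin_pruferAngle_le hV hk hx
  have h2 := Real.abs_sin_le_one (pruferAngle V k x)
  have h3 := abs_nonneg (Real.sin (pruferAngle V k x))
  rw [div_le_iff₀ hk, div_le_iff₀ hk, ← sq_abs]
  constructor <;> nlinarith

theorem partialPhase_nonpos (hV : IsPotential V) (hk : 0 < k) {x : ℝ} (hx : 0 ≤ x) :
    partialPhase V x k ≤ 0 := by
  rw [partialPhase_eq hV hk hx, neg_nonpos]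
  exact intervalIntegral.integral_nonneg hx fun t _ => mul_nonneg (hV.nonneg t) (by positivity)

theorem neg_partialPhase_le (hV : IsPotential V) (hk : 0 < k) {x : ℝ} (hx : 0 ≤ x) :
    -partialPhase V x k ≤ ∫ t, V t * t ∧ -partialPhase V x k ≤ k * ∫ t, V t * t ^ 2 := by
  have hc := continuousOn_pruferAngle hV hk (T := x)
  have hI : IntervalIntegrable (fun t => V t * (Real.sin (pruferAngle V k t) ^ 2 / k)) volume 0 x :=
    intervalIntegrable_potential_mul hV hx
      (((Real.continuous_sin.comp_continuousOn hc).pow 2).div_const k)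
  rw [partialPhase_eq hV hk hx, neg_neg]
  constructor
  · refine le_trans ?_ (hV.integral_le hV.integrable_mul (fun t ht => ht) hx)
    exact intervalIntegral.integral_mono_on hx hI hV.integrable_mul.intervalIntegrable fun t ht =>
      mul_le_mul_of_nonneg_left (sin_sq_pruferAngle_le hV hk ht.1).1 (hV.nonneg t)
  · refine le_trans ?_ (mul_le_mul_of_nonneg_left
      (hV.integral_le hV.integrable_mul_sq (fun t ht => sq_nonneg t) hx) hk.le)
    rw [← intervalIntegral.integral_const_mul]
    refine intervalIntegral.integral_mono_on hx hI
      (hV.integrable_mul_sq.intervalIntegrable.const_mul k) fun t ht => ?_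
    have := mul_le_mul_of_nonneg_left (sin_sq_pruferAngle_le hV hk ht.1).2 (hV.nonneg t)
    linarith

/-- A Lipschitz constant for the phase as a function of the momentum. -/
noncomputable def phaseLipschitz (V : ℝ → ℝ) : ℝ :=
  5 * (∫ t, V t * t ^ 2) * Real.exp (3 * ∫ t, V t * t)

theorem phaseLipschitz_nonneg (hV : IsPotential V) : 0 ≤ phaseLipschitz V := by
  have := hV.integral_nonneg (f := fun t => t ^ 2) (fun t _ => sq_nonneg t)
  unfold phaseLipschitz
  positivity

theorem abs_partialPhase_sub_le_aux (hV : IsPotential V) {k₁ k₂ : ℝ} (hk : 0 < k₁) (hkk : k₁ ≤ k₂)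
    {x : ℝ} (hx : 0 ≤ x) :
    |partialPhase V x k₂ - partialPhase V x k₁| ≤ phaseLipschitz V * (k₂ - k₁) := by
  have hk2 := hk.trans_le hkk
  have hM2 := hV.integral_nonneg (f := fun t => t ^ 2) (fun t _ => sq_nonneg t)
  have hM1 := hV.integral_nonneg (f := fun t => t) (fun t ht => ht)
  -- When the momenta are far apart, k₂ ≤ 2(k₂ - k₁) and the a priori bound by k times the second
  -- moment already suffices. Grönwall is needed only for k₂ ≤ 2k₁.
  by_cases h2 : 2 * k₁ < k₂
  · have a1 := partialPhase_nonpos hV hk hx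
    have a2 := partialPhase_nonpos hV hk2 hx
    have b1 := (neg_partialPhase_le hV hk hx).2
    have b2 := (neg_partialPhase_le hV hk2 hx).2
    have hexp : 1 ≤ Real.exp (3 * ∫ t, V t * t) := Real.one_le_exp (by positivity)
    have h3 : 5 * (∫ t, V t * t ^ 2) ≤ phaseLipschitz V :=
      le_mul_of_one_le_right (by positivity) hexp
    have h4 : 5 * (∫ t, V t * t ^ 2) * (k₂ - k₁) ≤ phaseLipschitz V * (k₂ - k₁) := by
      gcongr
    have h5 : k₁ * (∫ t, V t * t ^ 2) ≤ (k₂ - k₁) * ∫ t, V t * t ^ 2 := by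
      gcongr; linarith
    rw [abs_le]
    constructor <;> nlinarith
  push Not at h2
  set θ₁ := pruferAngle V k₁
  set θ₂ := pruferAngle V k₂
  have hc1 : ContinuousOn θ₁ (Icc 0 x) := continuousOn_pruferAngle hV hk
  have hc2 : ContinuousOn θ₂ (Icc 0 x) := continuousOn_pruferAngle hV hk2
  have hcu : ContinuousOn (fun t => |partialPhase V t k₂ - partialPhase V t k₁|) (Icc 0 x) := by
    unfold partialPhase
    exact ((hc2.sub (by fun_prop)).sub (hc1.sub (by fun_prop))).abs
  have hl : IntervalIntegrable (fun t => V t * (3 * |t|)) volume 0 x :=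
    intervalIntegrable_potential_mul hV hx (by fun_prop)
  -- Since k₂ ≤ 2k₁, |sin(θ₁ + θ₂)| ≤ (k₁ + k₂) t ≤ 3k₁ t, which cancels the 1/k₁ and leaves a
  -- Grönwall coefficient free of k. The 5 is 3, from the free part (k₂ - k₁) t of the angle
  -- difference, plus 2, from the change of the prefactor 1/k.
  have hpt : ∀ t, 0 ≤ t → |Real.sin (θ₂ t) ^ 2 / k₂ - Real.sin (θ₁ t) ^ 2 / k₁| ≤
      3 * |t| * |partialPhase V t k₂ - partialPhase V t k₁| + 5 * (k₂ - k₁) * t ^ 2 := by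
    intro t ht
    rw [abs_of_nonneg ht]
    have e : Real.sin (θ₂ t) ^ 2 / k₂ - Real.sin (θ₁ t) ^ 2 / k₁ =
        Real.sin (θ₂ t + θ₁ t) * Real.sin (θ₂ t - θ₁ t) / k₁ -
        Real.sin (θ₂ t) ^ 2 / k₂ * ((k₂ - k₁) / k₁) := by
      rw [← Real.sin_sq_sub_sin_sq]
      field_simp
      ring
    have s1 := abs_sin_pruferAngle_le hV hk ht
    have s2 := abs_sin_pruferAngle_le hV hk2 ht
    have c1 := Real.abs_cos_le_one (θ₁ t)
    have c2 := Real.abs_cos_le_one (θ₂ t)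
    have hsum : |Real.sin (θ₂ t + θ₁ t)| ≤ 3 * k₁ * t := by
      rw [Real.sin_add]
      refine (abs_add_le _ _).trans ?_
      rw [abs_mul, abs_mul]
      have i1 : |Real.sin (θ₂ t)| * |Real.cos (θ₁ t)| ≤ k₂ * t * 1 := by gcongr
      have i2 : |Real.cos (θ₂ t)| * |Real.sin (θ₁ t)| ≤ 1 * (k₁ * t) := by gcongr
      nlinarith
    have hdiff : |Real.sin (θ₂ t - θ₁ t)| ≤
        |partialPhase V t k₂ - partialPhase V t k₁| + (k₂ - k₁) * t := by
      refine Real.abs_sin_le_abs.trans ?_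
      have e2 : θ₂ t - θ₁ t = (partialPhase V t k₂ - partialPhase V t k₁) + (k₂ - k₁) * t := by
        unfold partialPhase; ring
      rw [e2]
      refine (abs_add_le _ _).trans ?_
      rw [abs_of_nonneg (mul_nonneg (sub_nonneg.2 hkk) ht)]
    have h6 : |Real.sin (θ₂ t + θ₁ t) * Real.sin (θ₂ t - θ₁ t) / k₁| ≤
        3 * t * (|partialPhase V t k₂ - partialPhase V t k₁| + (k₂ - k₁) * t) := by
      rw [abs_div, abs_mul, abs_of_pos hk, div_le_iff₀ hk]
      calc |Real.sin (θ₂ t + θ₁ t)| * |Real.sin (θ₂ t - θ₁ t)| ≤ 3 * k₁ * t *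
            (|partialPhase V t k₂ - partialPhase V t k₁| + (k₂ - k₁) * t) := by gcongr
        _ = _ := by ring
    have h7 : |Real.sin (θ₂ t) ^ 2 / k₂ * ((k₂ - k₁) / k₁)| ≤ 2 * (k₂ - k₁) * t ^ 2 := by
      have hkk' := sub_nonneg.2 hkk
      rw [abs_of_nonneg (by positivity), ← mul_div_assoc, div_le_iff₀ hk]
      calc Real.sin (θ₂ t) ^ 2 / k₂ * (k₂ - k₁) ≤ (k₂ * t ^ 2) * (k₂ - k₁) := by
            gcongr; exact (sin_sq_pruferAngle_le hV hk2 ht).2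
        _ ≤ (2 * k₁ * t ^ 2) * (k₂ - k₁) := by gcongr
        _ = _ := by ring
    rw [e]
    refine (abs_sub _ _).trans ?_
    nlinarith
  have key := le_mul_exp_of_le_integral (C := 5 * (k₂ - k₁) * ∫ t, V t * t ^ 2) hcu hl
    (fun t => mul_nonneg (hV.nonneg t) (by positivity)) (fun t ht => ?_) x ⟨hx, le_rfl⟩
  · refine key.trans ?_
    have hle : ∫ t in (0 : ℝ)..x, V t * (3 * |t|) ≤ 3 * ∫ t, V t * t := by
      have e1 : ∫ t in (0 : ℝ)..x, V t * (3 * |t|) = 3 * ∫ t in (0 : ℝ)..x, V t * t := by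
        rw [← intervalIntegral.integral_const_mul]
        refine intervalIntegral.integral_congr fun t ht => ?_
        rw [uIcc_of_le hx] at ht
        simp only [abs_of_nonneg ht.1]; ring
      rw [e1]
      exact mul_le_mul_of_nonneg_left (hV.integral_le hV.integrable_mul (fun t ht => ht) hx)
        (by norm_num)
    have hkk' := sub_nonneg.2 hkk
    calc _ ≤ 5 * (k₂ - k₁) * (∫ t, V t * t ^ 2) * Real.exp (3 * ∫ t, V t * t) := by gcongr
      _ = _ := by unfold phaseLipschitz; ring
  · have hcc1 : ContinuousOn θ₁ (Icc 0 t) := hc1.mono (Icc_subset_Icc le_rfl ht.2)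
    have hcc2 : ContinuousOn θ₂ (Icc 0 t) := hc2.mono (Icc_subset_Icc le_rfl ht.2)
    have I1 : IntervalIntegrable (fun s => V s * (Real.sin (θ₁ s) ^ 2 / k₁)) volume 0 t :=
      intervalIntegrable_potential_mul hV ht.1
        (((Real.continuous_sin.comp_continuousOn hcc1).pow 2).div_const _)
    have I2 : IntervalIntegrable (fun s => V s * (Real.sin (θ₂ s) ^ 2 / k₂)) volume 0 t :=
      intervalIntegrable_potential_mul hV ht.1
        (((Real.continuous_sin.comp_continuousOn hcc2).pow 2).div_const _)
    have I3 : IntervalIntegrable (fun s => V s * (3 * |s|) *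
        |partialPhase V s k₂ - partialPhase V s k₁|) volume 0 t := by
      simp_rw [mul_assoc (V _)]
      exact intervalIntegrable_potential_mul hV ht.1 (ContinuousOn.mul (by fun_prop)
        (hcu.mono (Icc_subset_Icc le_rfl ht.2)))
    have I4 : IntervalIntegrable (fun s => 5 * (k₂ - k₁) * (V s * s ^ 2)) volume 0 t :=
      hV.integrable_mul_sq.intervalIntegrable.const_mul _
    rw [partialPhase_eq hV hk2 ht.1, partialPhase_eq hV hk ht.1, neg_sub_neg, abs_sub_comm,
      ← intervalIntegral.integral_sub I2 I1]
    refine le_trans (le_of_eq (Real.norm_eq_abs _).symm) ?_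
    refine (intervalIntegral.norm_integral_le_of_norm_le ht.1 (Eventually.of_forall
      fun s hs => ?_) (I4.add I3)).trans ?_
    · rw [← mul_sub, norm_mul, Real.norm_of_nonneg (hV.nonneg s)]
      have := mul_le_mul_of_nonneg_left (hpt s hs.1.le) (hV.nonneg s)
      simp only [Real.norm_eq_abs]
      nlinarith
    · rw [intervalIntegral.integral_add I4 I3, intervalIntegral.integral_const_mul]
      gcongr
      exact hV.integral_le hV.integrable_mul_sq (fun t _ => sq_nonneg t) ht.1

theorem abs_partialPhase_sub_le (hV : IsPotential V) {k₁ k₂ : ℝ} (hk₁ : 0 < k₁) (hk₂ : 0 < k₂)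
    {x : ℝ} (hx : 0 ≤ x) :
    |partialPhase V x k₂ - partialPhase V x k₁| ≤ phaseLipschitz V * |k₂ - k₁| := by
  rcases le_total k₁ k₂ with h | h
  · rw [abs_of_nonneg (sub_nonneg.2 h)]
    exact abs_partialPhase_sub_le_aux hV hk₁ h hx
  · rw [abs_sub_comm, abs_sub_comm k₂, abs_of_nonneg (sub_nonneg.2 h)]
    exact abs_partialPhase_sub_le_aux hV hk₂ h hx

end Prufer

/-! ### The phase shift as a limit, and the quantization of momenta -/

section PhaseShift

variable {V : ℝ → ℝ} {k : ℝ}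

theorem continuousOn_pruferAngle_Ici (hV : IsPotential V) (hk : 0 < k) :
    ContinuousOn (pruferAngle V k) (Ici 0) := (pruferAngle_spec hV hk).1

theorem integrable_sin_sq_pruferAngle (hV : IsPotential V) (hk : 0 < k) :
    IntegrableOn (fun t => V t * (Real.sin (pruferAngle V k t) ^ 2 / k)) (Ioi 0) := by
  have hm : AEStronglyMeasurable (fun t => Real.sin (pruferAngle V k t) ^ 2 / k)
      (volume.restrict (Ioi 0)) :=
    (((Real.continuous_sin.comp_continuousOn
      ((continuousOn_pruferAngle_Ici hV hk).mono Ioi_subset_Ici_self)).pow 2).div_const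
        k).aestronglyMeasurable measurableSet_Ioi
  refine Integrable.mono hV.integrable_mul.integrableOn (hV.measurable.aestronglyMeasurable.mul hm) ?_
  refine (ae_restrict_iff' measurableSet_Ioi).2 (Eventually.of_forall fun t ht => ?_)
  have ht' : 0 ≤ t := le_of_lt ht
  have h0 : 0 ≤ Real.sin (pruferAngle V k t) ^ 2 / k := by positivity
  rw [norm_mul, norm_mul, Real.norm_of_nonneg ht', Real.norm_of_nonneg h0]
  exact mul_le_mul_of_nonneg_left (sin_sq_pruferAngle_le hV hk ht').1 (norm_nonneg _)

theorem tendsto_partialPhase_integral (hV : IsPotential V) (hk : 0 < k) :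
    Tendsto (fun x => partialPhase V x k) atTop
      (𝓝 (-∫ t in Ioi 0, V t * (Real.sin (pruferAngle V k t) ^ 2 / k))) := by
  have := (intervalIntegral_tendsto_integral_Ioi 0 (integrable_sin_sq_pruferAngle hV hk)
    tendsto_id).neg
  refine this.congr' ?_
  filter_upwards [eventually_ge_atTop 0] with x hx
  exact (partialPhase_eq hV hk hx).symm

theorem phaseShift_eq (hV : IsPotential V) (hk : 0 < k) :
    phaseShift V k = -∫ t in Ioi 0, V t * (Real.sin (pruferAngle V k t) ^ 2 / k) :=
  (tendsto_partialPhase_integral hV hk).limUnder_eq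

theorem tendsto_partialPhase (hV : IsPotential V) (hk : 0 < k) :
    Tendsto (fun x => partialPhase V x k) atTop (𝓝 (phaseShift V k)) := by
  rw [phaseShift_eq hV hk]
  exact tendsto_partialPhase_integral hV hk

theorem phaseShift_nonpos (hV : IsPotential V) (hk : 0 < k) : phaseShift V k ≤ 0 :=
  le_of_tendsto (tendsto_partialPhase hV hk)
    ((eventually_ge_atTop 0).mono fun _ hx => partialPhase_nonpos hV hk hx)

theorem neg_phaseShift_le (hV : IsPotential V) (hk : 0 < k) :
    -phaseShift V k ≤ ∫ t, V t * t ∧ -phaseShift V k ≤ k * ∫ t, V t * t ^ 2 :=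
  ⟨le_of_tendsto (tendsto_partialPhase hV hk).neg
    ((eventually_ge_atTop 0).mono fun _ hx => (neg_partialPhase_le hV hk hx).1),
   le_of_tendsto (tendsto_partialPhase hV hk).neg
    ((eventually_ge_atTop 0).mono fun _ hx => (neg_partialPhase_le hV hk hx).2)⟩

theorem abs_phaseShift_sub_le (hV : IsPotential V) {k₁ k₂ : ℝ} (hk₁ : 0 < k₁) (hk₂ : 0 < k₂) :
    |phaseShift V k₂ - phaseShift V k₁| ≤ phaseLipschitz V * |k₂ - k₁| :=
  le_of_tendsto ((tendsto_partialPhase hV hk₂).sub (tendsto_partialPhase hV hk₁)).abs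
    ((eventually_ge_atTop 0).mono fun _ hx => abs_partialPhase_sub_le hV hk₁ hk₂ hx)

/-- The defect is the integral of V sin² θ / k beyond x, where sin² ≤ 1 and x² ≤ t². It decays like
x⁻² times a tail of the second moment, which is fast enough for the replacement of finite-volume
phases by δ. -/
theorem abs_partialPhase_sub_phaseShift_le (hV : IsPotential V) (hk : 0 < k) {x : ℝ} (hx : 0 ≤ x) :
    k * |partialPhase V x k - phaseShift V k| * x ^ 2 ≤ ∫ t in Ioi x, V t * t ^ 2 := by
  have hI := integrable_sin_sq_pruferAngle hV hk
  have h1 : partialPhase V x k - phaseShift V k =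
      ∫ t in Ioi x, V t * (Real.sin (pruferAngle V k t) ^ 2 / k) := by
    rw [partialPhase_eq hV hk hx, phaseShift_eq hV hk, neg_sub_neg,
      ← intervalIntegral.integral_interval_add_Ioi hI
        (hI.mono_set (Ioi_subset_Ioi hx))]
    ring
  have h2 : 0 ≤ ∫ t in Ioi x, V t * (Real.sin (pruferAngle V k t) ^ 2 / k) :=
    setIntegral_nonneg measurableSet_Ioi fun t _ => mul_nonneg (hV.nonneg t) (by positivity)
  rw [h1, abs_of_nonneg h2, mul_comm k, mul_assoc, ← integral_mul_const]
  refine setIntegral_mono_on ((hI.mono_set (Ioi_subset_Ioi hx)).mul_const _)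
    hV.integrable_mul_sq.integrableOn measurableSet_Ioi fun t ht => ?_
  have h3 : Real.sin (pruferAngle V k t) ^ 2 ≤ 1 := Real.sin_sq_le_one _
  have h4 : x ^ 2 ≤ t ^ 2 := pow_le_pow_left₀ hx (le_of_lt ht) 2
  have e : V t * (Real.sin (pruferAngle V k t) ^ 2 / k) * (k * x ^ 2) =
      V t * (Real.sin (pruferAngle V k t) ^ 2 * x ^ 2) := by field_simp
  rw [e]
  refine mul_le_mul_of_nonneg_left ?_ (hV.nonneg t)
  nlinarith [sq_nonneg x]

theorem tendsto_integral_Ioi_atTop {f : ℝ → ℝ} (hf : Integrable f) :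
    Tendsto (fun x => ∫ t in Ioi x, f t) atTop (𝓝 0) := by
  have h1 := intervalIntegral_tendsto_integral_Ioi 0 hf.integrableOn tendsto_id
  have h2 := (tendsto_const_nhds (x := ∫ t in Ioi 0, f t)).sub h1
  rw [sub_self] at h2
  refine h2.congr fun x => ?_
  rw [← intervalIntegral.integral_interval_add_Ioi (b := x) hf.integrableOn hf.integrableOn]
  simp

/-- The Prüfer representation of the regular solution. -/
theorem exists_regSol_eq_prufer (hV : IsPotential V) (hk : 0 < k) {x : ℝ} (hx : 0 ≤ x) :
    ∃ r : ℝ, 0 < r ∧ k * regSol V (k ^ 2) x = r * Real.sin (pruferAngle V k x) ∧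
      regSol' V (k ^ 2) x = r * Real.cos (pruferAngle V k x) := by
  set θ := pruferAngle V k
  have hθ := isPrimitiveOn_pruferAngle hV hk hx
  have hc : ContinuousOn θ (Icc 0 x) := continuousOn_pruferAngle hV hk
  -- The amplitude satisfies r'/r = V sin θ cos θ / k; with it, (r sin θ / k, r cos θ) solves the
  -- Schrödinger system with the initial data of the regular solution.
  have hg : IntervalIntegrable (fun t => V t * (Real.sin (θ t) * Real.cos (θ t) / k)) volume 0 x :=
    intervalIntegrable_potential_mul hV hx (((Real.continuous_sin.comp_continuousOn hc).mul
      (Real.continuous_cos.comp_continuousOn hc)).div_const k)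
  have hr := (IsPrimitiveOn.integral hg).comp_univ hx (F := Real.exp) (F' := Real.exp)
    (fun x => Real.hasDerivAt_exp x) Real.continuous_exp
  have hs := hθ.comp_univ hx (F := Real.sin) (F' := Real.cos) Real.hasDerivAt_sin
    Real.continuous_cos
  have hco := hθ.comp_univ hx (F := Real.cos) (F' := fun y => -Real.sin y) Real.hasDerivAt_cos
    (by fun_prop)
  have hu := (hr.mul hx hs).mul hx (IsPrimitiveOn.const (1 / k))
  have hv := hr.mul hx hco
  have hk0 := hk.ne'
  have h := eq_mul_regSol hV (lam := k ^ 2) hx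
    (u := fun t => Real.exp (∫ s in (0 : ℝ)..t, V s * (Real.sin (θ s) * Real.cos (θ s) / k)) *
      Real.sin (θ t) * (1 / k))
    (v := fun t => Real.exp (∫ s in (0 : ℝ)..t, V s * (Real.sin (θ s) * Real.cos (θ s) / k)) *
      Real.cos (θ t)) (by simp [θ, pruferAngle_zero hV hk])
    (hu.congr hx (fun _ _ => rfl) (Eventually.of_forall fun t _ => by
      generalize Real.exp _ = r
      have := Real.sin_sq_add_cos_sq (θ t)
      field_simp
      ring))
    (hv.congr hx (fun _ _ => rfl) (Eventually.of_forall fun t _ => by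
      generalize Real.exp _ = r
      have h1 : Real.cos (θ t) ^ 2 = 1 - Real.sin (θ t) ^ 2 := by
        rw [← Real.sin_sq_add_cos_sq (θ t)]; ring
      simp only [smul_eq_mul]
      field_simp
      linear_combination (-(V t * r * Real.sin (θ t))) * h1)) x ⟨hx, le_rfl⟩
  have hv0 : Real.exp (∫ s in (0 : ℝ)..0, V s * (Real.sin (θ s) * Real.cos (θ s) / k)) *
      Real.cos (θ 0) = 1 := by simp [θ, pruferAngle_zero hV hk]
  beta_reduce at h
  rw [hv0, one_mul, one_mul] at h
  refine ⟨_, Real.exp_pos _, ?_, h.2.symm⟩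
  rw [← h.1]
  field_simp

theorem regSol_eq_zero_iff (hV : IsPotential V) (hk : 0 < k) {x : ℝ} (hx : 0 < x) :
    regSol V (k ^ 2) x = 0 ↔ ∃ n : ℕ, 1 ≤ n ∧ pruferAngle V k x = n * Real.pi := by
  obtain ⟨r, hr, h1, -⟩ := exists_regSol_eq_prufer hV hk hx.le
  have hiff : regSol V (k ^ 2) x = 0 ↔ Real.sin (pruferAngle V k x) = 0 := by
    constructor
    · intro h
      rw [h, mul_zero] at h1
      exact (mul_eq_zero.1 h1.symm).resolve_left hr.ne'
    · intro h
      rw [h, mul_zero] at h1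
      exact (mul_eq_zero.1 h1).resolve_left hk.ne'
  rw [hiff, Real.sin_eq_zero_iff]
  have hpos := pruferAngle_pos hV hk hx
  constructor
  · rintro ⟨m, hm⟩
    have hm0 : 0 < m := by
      rw [← hm] at hpos
      exact_mod_cast pos_of_mul_pos_left hpos Real.pi_pos.le
    refine ⟨m.toNat, by omega, ?_⟩
    rw [← hm]
    congr 1
    exact_mod_cast (Int.toNat_of_nonneg hm0.le).symm
  · rintro ⟨n, -, hn⟩
    exact ⟨n, by rw [hn]; simp⟩

theorem continuousOn_pruferAngle_param (hV : IsPotential V) {x : ℝ} (hx : 0 ≤ x) :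
    ContinuousOn (fun k => pruferAngle V k x) (Ioi 0) := by
  have h : LipschitzOnWith (phaseLipschitz V).toNNReal (fun k => partialPhase V x k) (Ioi 0) := by
    refine LipschitzOnWith.of_dist_le_mul fun k₁ h1 k₂ h2 => ?_
    rw [Real.dist_eq, Real.dist_eq, Real.coe_toNNReal _ (phaseLipschitz_nonneg hV)]
    exact abs_partialPhase_sub_le hV h2 h1 hx
  refine (h.continuousOn.add (g := fun k => k * x) (by fun_prop)).congr fun k _ => ?_
  simp [partialPhase]

/-- Joint continuity supplies the measurability needed to interchange the integrals over k and y
later. -/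
theorem continuousOn_pruferAngle_uncurry (hV : IsPotential V) :
    ContinuousOn (fun p : ℝ × ℝ => pruferAngle V p.1 p.2) (Ioi 0 ×ˢ Ici 0) := by
  have h : ContinuousOn (fun p : ℝ × ℝ => partialPhase V p.2 p.1) (Ioi 0 ×ˢ Ici 0) := by
    refine continuousOn_prod_of_continuousOn_lipschitzOnWith _ (phaseLipschitz V).toNNReal
      (fun k hk => ?_) (fun x hx => LipschitzOnWith.of_dist_le_mul fun k₁ h1 k₂ h2 => ?_)
    · exact (continuousOn_pruferAngle_Ici hV hk).sub (by fun_prop)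
    · rw [Real.dist_eq, Real.dist_eq, Real.coe_toNNReal _ (phaseLipschitz_nonneg hV)]
      exact abs_partialPhase_sub_le hV h2 h1 hx
  refine (h.add (g := fun p : ℝ × ℝ => p.1 * p.2) (by fun_prop)).congr fun p _ => ?_
  simp [partialPhase]

theorem exists_momentum (hV : IsPotential V) {x : ℝ} (hx : 0 < x) {n : ℕ} (hn : 1 ≤ n) :
    ∃ k : ℝ, 0 < k ∧ pruferAngle V k x = n * Real.pi := by
  have hn' : (1 : ℝ) ≤ n := by exact_mod_cast hn
  have hM := hV.integral_nonneg (f := fun t => t) (fun t ht => ht)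
  set M := ∫ t, V t * t
  have hpi := Real.pi_pos
  -- Since kx - M ≤ θ_k(x) ≤ kx with M the first moment, the angle is at most nπ at the momentum a =
  -- nπ/x and at least nπ at b = (nπ + M)/x.
  set b := (n * Real.pi + M) / x
  set a := n * Real.pi / x
  have ha : 0 < a := by positivity
  have hb : 0 < b := by positivity
  have hab : a ≤ b := by
    simp only [a, b]; gcongr; linarith
  have h1 : pruferAngle V a x ≤ n * Real.pi := by
    have := partialPhase_nonpos hV ha hx.le
    have e : a * x = n * Real.pi := by simp only [a]; field_simp
    rw [partialPhase, e] at this; linarith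
  have h2 : n * Real.pi ≤ pruferAngle V b x := by
    have := (neg_partialPhase_le hV hb hx.le).1
    have e : b * x = n * Real.pi + M := by simp only [b]; field_simp
    rw [partialPhase, e] at this; linarith
  obtain ⟨k, hk, hk'⟩ := intermediate_value_Icc hab
    ((continuousOn_pruferAngle_param hV hx.le).mono fun y hy => ha.trans_le hy.1) ⟨h1, h2⟩
  exact ⟨k, ha.trans_le hk.1, hk'⟩

end PhaseShift

/-! ### Eigenvalues of the Dirichlet operator on a bounded interval -/

section Eigenvalues

variable {V : ℝ → ℝ} {L : ℝ}

theorem memLp_of_continuous_Ioo {f : ℝ → ℂ} (hf : Continuous f) (L : ℝ) :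
    MemLp f 2 (volume.restrict (Ioo 0 L)) := by
  obtain ⟨C, hC⟩ := (isCompact_Icc (a := (0 : ℝ)) (b := L)).exists_bound_of_continuousOn
    hf.continuousOn
  exact MemLp.of_bound hf.aestronglyMeasurable C ((ae_restrict_iff' measurableSet_Ioo).2
    (Eventually.of_forall fun x hx => hC x (Ioo_subset_Icc_self hx)))

/-- The regular solution as an element of `L²(0, L)`. -/
noncomputable def regSolLp (hV : IsPotential V) (L y : ℝ) : L2 (Ioo 0 L) :=
  (memLp_of_continuous_Ioo (continuous_regSol hV (y : ℂ)) L).toLp _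

theorem coeFn_regSolLp (hV : IsPotential V) (L y : ℝ) :
    regSolLp hV L y =ᵐ[volume.restrict (Ioo 0 L)] regSol V (y : ℂ) :=
  MemLp.coeFn_toLp _

theorem isPrimitiveOn_of_isDirichletSolution (hL : 0 < L) {y : ℝ} {u v g : ℝ → ℂ}
    (h : IsDirichletSolution V (Ioo 0 L) u v g)
    (hg : ∀ᵐ x ∂volume.restrict (Ioo 0 L), g x = (y : ℂ) * u x) :
    u 0 = 0 ∧ u L = 0 ∧ IsPrimitiveOn u v L ∧
      IsPrimitiveOn v (fun t => V t • u t - (y : ℂ) * u t) L := by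
  have hcl : closure (Ioo 0 L) = Icc 0 L := closure_Ioo hL.ne
  have hLm : L ∈ closure (Ioo 0 L) := by rw [hcl]; exact ⟨hL.le, le_rfl⟩
  have h0 : u 0 = 0 := by
    rw [h.eq_integral 0 (by rw [hcl]; exact ⟨le_rfl, hL.le⟩), intervalIntegral.integral_same]
  refine ⟨h0, h.boundary L (by rw [frontier_Ioo hL]; simp), ⟨h.integrable_deriv L hLm,
    fun x hx => ?_⟩, ?_⟩
  · rw [h0, zero_add]; exact h.eq_integral x (by rwa [hcl])
  · have hp : IsPrimitiveOn v (fun t => (V t : ℂ) * u t - g t) L :=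
      ⟨h.integrable_second L hLm, fun x hx => h.deriv_eq_integral x (by rwa [hcl])⟩
    refine hp.congr hL.le (fun _ _ => rfl) ?_
    rw [ae_restrict_iff' measurableSet_Ioo] at hg
    have hne : ∀ᵐ x : ℝ, x ≠ L := by simp [ae_iff, measure_singleton]
    filter_upwards [hg, hne] with x hx hx' hmem
    rw [hx ⟨hmem.1, lt_of_le_of_ne hmem.2 hx'⟩, Complex.real_smul]

theorem mem_eigenspaceAt_iff {I : Set ℝ} {y : ℝ} {U : L2 I} :
    U ∈ eigenspaceAt (dirichletOperator V I) y ↔ (U, (y : ℂ) • U) ∈ dirichletOperator V I :=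
  Iff.rfl

theorem eq_smul_regSolLp_of_mem_eigenspaceAt (hV : IsPotential V) (hL : 0 < L) {y : ℝ}
    {U : L2 (Ioo 0 L)} (hU : U ∈ eigenspaceAt (dirichletOperator V (Ioo 0 L)) y) :
    ∃ c : ℂ, U = c • regSolLp hV L y ∧ c * regSol V (y : ℂ) L = 0 := by
  obtain ⟨u, v, g, hu, hg, h⟩ := mem_eigenspaceAt_iff.1 hU
  dsimp only at hu hg
  obtain ⟨h0, hL0, hp, hp'⟩ := isPrimitiveOn_of_isDirichletSolution (y := y) hL h (by
    filter_upwards [hu, hg, Lp.coeFn_smul (y : ℂ) U] with x h1 h2 h3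
    rw [← h2, h3, Pi.smul_apply, h1, smul_eq_mul])
  have key := eq_mul_regSol hV hL.le h0 hp hp'
  refine ⟨v 0, ?_, ?_⟩
  · refine Lp.ext ?_
    filter_upwards [hu, Lp.coeFn_smul (v 0) (regSolLp hV L y), coeFn_regSolLp hV L y,
      ae_restrict_mem measurableSet_Ioo] with x h1 h2 h3 hx
    rw [h1, h2, Pi.smul_apply, h3, smul_eq_mul]
    exact (key x (Ioo_subset_Icc_self hx)).1
  · rw [← (key L ⟨hL.le, le_rfl⟩).1, hL0]

theorem regSolLp_mem_eigenspaceAt (hV : IsPotential V) (hL : 0 < L) {y : ℝ}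
    (hy : regSol V (y : ℂ) L = 0) :
    regSolLp hV L y ∈ eigenspaceAt (dirichletOperator V (Ioo 0 L)) y := by
  have hcl : closure (Ioo 0 L) = Icc 0 L := closure_Ioo hL.ne
  have e : (fun t => (V t : ℂ) * regSol V (y : ℂ) t - (y : ℂ) * regSol V (y : ℂ) t) =
      fun t => V t • regSol V (y : ℂ) t - (y : ℂ) * regSol V (y : ℂ) t := by
    ext t; rw [Complex.real_smul]
  refine mem_eigenspaceAt_iff.2 ⟨regSol V (y : ℂ), regSol' V (y : ℂ),
    fun t => (y : ℂ) * regSol V (y : ℂ) t, coeFn_regSolLp hV L y, ?_, ?_⟩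
  · filter_upwards [Lp.coeFn_smul (y : ℂ) (regSolLp hV L y), coeFn_regSolLp hV L y] with x h1 h2
    rw [h1, Pi.smul_apply, h2, smul_eq_mul]
  · refine ⟨fun x hx => ?_, fun x _ => (continuous_regSol' hV _).intervalIntegrable _ _,
      fun x hx => ?_, fun x hx => ?_, fun x hx => ?_⟩
    · rw [frontier_Ioo hL] at hx
      rcases hx with rfl | rfl
      · exact regSol_zero hV _
      · exact hy
    all_goals rw [hcl] at hx
    · have := (isPrimitiveOn_regSol hV (y : ℂ) hx.1).2 x ⟨hx.1, le_rfl⟩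
      rwa [regSol_zero hV, zero_add] at this
    · rw [e]; exact (isPrimitiveOn_regSol' hV (y : ℂ) hx.1).1
    · rw [e]; exact (isPrimitiveOn_regSol' hV (y : ℂ) hx.1).2 x ⟨hx.1, le_rfl⟩

/-- A solution vanishing almost everywhere on (0, L) vanishes there by continuity, and so does its
derivative, contradicting u'(0) = 1. -/
theorem regSolLp_ne_zero (hV : IsPotential V) (hL : 0 < L) (y : ℝ) : regSolLp hV L y ≠ 0 := by
  intro h
  have h1 : regSol V (y : ℂ) =ᵐ[volume.restrict (Ioo 0 L)] 0 :=
    (coeFn_regSolLp hV L y).symm.trans (h ▸ Lp.coeFn_zero _ _ _)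
  have h2 : EqOn (regSol V (y : ℂ)) 0 (Ioo 0 L) :=
    Measure.eqOn_open_of_ae_eq h1 isOpen_Ioo (continuous_regSol hV _).continuousOn
      continuousOn_const
  have h3 := (isPrimitiveOn_regSol hV (y : ℂ) hL.le).ae_hasDerivAt hL.le
  have h4 : regSol' V (y : ℂ) =ᵐ[volume.restrict (Ioo 0 L)] 0 := by
    refine (ae_restrict_iff' measurableSet_Ioo).2 (h3.mono fun x hx hmem => ?_)
    refine (hx hmem).unique ((hasDerivAt_const x (0 : ℂ)).congr_of_eventuallyEq ?_)
    filter_upwards [isOpen_Ioo.mem_nhds hmem] with z hz using h2 hz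
  have h5 : EqOn (regSol' V (y : ℂ)) 0 (Ioo 0 L) :=
    Measure.eqOn_open_of_ae_eq h4 isOpen_Ioo (continuous_regSol' hV _).continuousOn
      continuousOn_const
  have h6 := h5.closure (continuous_regSol' hV _) continuous_const
  have := h6 (by rw [closure_Ioo hL.ne]; exact ⟨le_rfl, hL.le⟩ : (0 : ℝ) ∈ closure (Ioo 0 L))
  rw [regSol'_zero hV] at this
  exact one_ne_zero this

theorem inner_regSolLp (hV : IsPotential V) (hL : 0 < L) {y z : ℝ} (hyz : y ≠ z)
    (hy : regSol V (y : ℂ) L = 0) (hz : regSol V (z : ℂ) L = 0) :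
    inner ℂ (regSolLp hV L y) (regSolLp hV L z) = 0 := by
  have hw := regSol_wronskian hV (y : ℂ) (z : ℂ) hL.le
  rw [hy, hz, zero_mul, zero_mul, sub_zero] at hw
  have h1 := (mul_eq_zero.1 hw.symm).resolve_left (sub_ne_zero.2 (by exact_mod_cast hyz))
  rw [L2.inner_def, ← h1, intervalIntegral.integral_of_le hL.le,
    integral_Ioc_eq_integral_Ioo]
  refine integral_congr_ae ?_
  filter_upwards [coeFn_regSolLp hV L y, coeFn_regSolLp hV L z,
    ae_restrict_mem measurableSet_Ioo] with x h1 h2 hx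
  rw [h1, h2, RCLike.inner_apply, (regSol_ofReal hV y hx.1.le).1, Complex.conj_ofReal, mul_comm]

/-- The eigenvalues of the Dirichlet operator on `(0, L)` are the squares of the momenta whose
Prüfer angle at `L` is a multiple of `π`. -/
theorem nthEigenvalue_dirichletOperator (hV : IsPotential V) (hL : 0 < L) {k : ℕ → ℝ}
    (hk : ∀ n, 1 ≤ n → 0 < k n ∧ pruferAngle V (k n) L = n * Real.pi) {n : ℕ} (hn : 1 ≤ n) :
    nthEigenvalue (dirichletOperator V (Ioo 0 L)) n = k n ^ 2 := by
  have hmono : ∀ {a b : ℝ}, 0 < a → 0 < b → (a < b ↔ pruferAngle V a L < pruferAngle V b L) := by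
    intro a b ha hb
    constructor
    · exact fun h => pruferAngle_strictMono hV ha h hL
    · intro h
      by_contra! hle
      rcases hle.eq_or_lt with rfl | hlt
      · exact lt_irrefl _ h
      · exact lt_asymm h (pruferAngle_strictMono hV hb hlt hL)
  have hkmono : ∀ {i j : ℕ}, 1 ≤ i → 1 ≤ j → (k i < k j ↔ i < j) := by
    intro i j hi hj
    rw [hmono (hk i hi).1 (hk j hj).1, (hk i hi).2, (hk j hj).2,
      mul_lt_mul_iff_left₀ Real.pi_pos, Nat.cast_lt]
  have hzero : ∀ i, 1 ≤ i → regSol V ((k i ^ 2 : ℝ) : ℂ) L = 0 := by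
    intro i hi
    rw [(regSol_ofReal hV _ hL.le).1,
      (regSol_eq_zero_iff hV (hk i hi).1 hL).2 ⟨i, hi, (hk i hi).2⟩, Complex.ofReal_zero]
  have hall : ∀ y : ℝ, regSol V (y : ℂ) L = 0 → ∃ i, 1 ≤ i ∧ y = k i ^ 2 := by
    intro y hy
    rw [(regSol_ofReal hV _ hL.le).1, Complex.ofReal_eq_zero] at hy
    -- There are no non-positive eigenvalues: at such energies the regular solution is at least L at
    -- L.
    have hy0 : 0 < y := by
      by_contra! hneg
      have := le_regSol hV hneg hL.le
      linarith
    obtain ⟨m, hm, hθ⟩ := (regSol_eq_zero_iff hV (Real.sqrt_pos.2 hy0) hL).1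
      (by rwa [Real.sq_sqrt hy0.le])
    refine ⟨m, hm, ?_⟩
    have : √y = k m := by
      have h1 := hmono (Real.sqrt_pos.2 hy0) (hk m hm).1
      have h2 := hmono (hk m hm).1 (Real.sqrt_pos.2 hy0)
      rw [hθ, (hk m hm).2] at h1 h2
      exact le_antisymm (not_lt.1 fun h => lt_irrefl _ (h2.1 h))
        (not_lt.1 fun h => lt_irrefl _ (h1.1 h))
    rw [← this, Real.sq_sqrt hy0.le]
  -- Below k n ^ 2 only the first n - 1 regular solutions can contribute, so the rank is less than
  -- n; from k n ^ 2 on, n mutually orthogonal eigenfunctions are available.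
  have hset : {x : ℝ | (n : Cardinal) ≤ Module.rank ℂ (⨆ y ∈ Iic x, eigenspaceAt
      (dirichletOperator V (Ioo 0 L)) y : Submodule ℂ (L2 (Ioo 0 L)))} = Ici (k n ^ 2) := by
    ext x
    simp only [Set.mem_ofPred_eq, mem_Ici]
    constructor
    · intro h
      by_contra! hx
      have hle : (⨆ y ∈ Iic x, eigenspaceAt (dirichletOperator V (Ioo 0 L)) y :
          Submodule ℂ (L2 (Ioo 0 L))) ≤
          Submodule.span ℂ (range fun i : Fin (n - 1) => regSolLp hV L (k (i + 1) ^ 2)) := by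
        refine iSup₂_le fun y hy U hU => ?_
        obtain ⟨c, rfl, hc⟩ := eq_smul_regSolLp_of_mem_eigenspaceAt hV hL hU
        rcases eq_or_ne c 0 with rfl | hc0
        · rw [zero_smul]; exact Submodule.zero_mem _
        · obtain ⟨i, hi, rfl⟩ := hall y ((mul_eq_zero.1 hc).resolve_left hc0)
          have hlt : k i < k n := by
            have h1 : k i ^ 2 < k n ^ 2 := lt_of_le_of_lt hy hx
            exact lt_of_pow_lt_pow_left₀ 2 (hk n hn).1.le h1
          have hin := (hkmono hi hn).1 hlt
          refine Submodule.smul_mem _ _ (Submodule.subset_span ⟨⟨i - 1, by omega⟩, ?_⟩)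
          simp only [Nat.sub_add_cancel hi]
      have h2 := h.trans ((Submodule.rank_mono hle).trans (rank_span_le _))
      have h3 := h2.trans Cardinal.mk_range_le
      rw [Cardinal.mk_fin, Nat.cast_le] at h3
      omega
    · intro hx
      have hmem : ∀ i : Fin n, regSolLp hV L (k (i + 1) ^ 2) ∈
          (⨆ y ∈ Iic x, eigenspaceAt (dirichletOperator V (Ioo 0 L)) y :
          Submodule ℂ (L2 (Ioo 0 L))) := by
        intro i
        refine Submodule.mem_iSup_of_mem (k (i + 1) ^ 2) (Submodule.mem_iSup_of_mem ?_
          (regSolLp_mem_eigenspaceAt hV hL (hzero _ (by omega))))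
        refine le_trans ?_ hx
        have : k (i + 1) ≤ k n := by
          by_contra! hlt
          have := (hkmono hn (by omega)).1 hlt
          omega
        exact pow_le_pow_left₀ (hk _ (by omega)).1.le this 2
      have hli : LinearIndependent ℂ fun i : Fin n => regSolLp hV L (k (i + 1) ^ 2) := by
        refine linearIndependent_of_ne_zero_of_inner_eq_zero
          (fun i => regSolLp_ne_zero hV hL _) fun i j hij => ?_
        refine inner_regSolLp hV hL (fun he => hij ?_) (hzero _ (by omega)) (hzero _ (by omega))
        have := (pow_left_inj₀ (hk (i + 1) (by omega)).1.le (hk (j + 1) (by omega)).1.le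
          two_ne_zero).1 he
        have h1 := (hkmono (i := i + 1) (j := j + 1) (by omega) (by omega)).not.1 this.not_lt
        have h2 := (hkmono (i := j + 1) (j := i + 1) (by omega) (by omega)).not.1 this.not_gt
        ext
        omega
      have hli' : LinearIndependent ℂ fun i : Fin n =>
          (⟨regSolLp hV L (k (i + 1) ^ 2), hmem i⟩ :
            (⨆ y ∈ Iic x, eigenspaceAt (dirichletOperator V (Ioo 0 L)) y :
              Submodule ℂ (L2 (Ioo 0 L)))) :=
        LinearIndependent.of_comp (Submodule.subtype _) hli
      have := hli'.cardinal_le_rank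
      rwa [Cardinal.mk_fin] at this
  rw [nthEigenvalue, hset, csInf_Ici]

end Eigenvalues

/-! ### The diagonal Green's function in the upper half-plane -/

section Weyl

variable {V : ℝ → ℝ}

/-- The denominator `φ' - i z φ` at `y`, where `φ` is the regular solution at energy `z²`. -/
noncomputable def jostDenom (V : ℝ → ℝ) (y : ℝ) (z : ℂ) : ℂ :=
  regSol' V (z ^ 2) y - Complex.I * z * regSol V (z ^ 2) y

/-- The diagonal Green's function at `y` for the potential truncated to `(0, y)`. -/
noncomputable def truncGreen (V : ℝ → ℝ) (y : ℝ) (z : ℂ) : ℂ :=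
  regSol V (z ^ 2) y / jostDenom V y z

theorem normSq_sub_sub_normSq_add {p f z : ℂ} {a b n : ℝ}
    (h : p * (starRingEnd ℂ) f = (a : ℂ) + b - z ^ 2 * n) :
    Complex.normSq (p - Complex.I * z * f) - Complex.normSq (p + Complex.I * z * f) =
      4 * z.im * (a + b + Complex.normSq z * n) := by
  have hre := congrArg Complex.re h
  have him := congrArg Complex.im h
  simp [pow_two, Complex.mul_re, Complex.mul_im] at hre him
  simp only [Complex.normSq_apply, Complex.sub_re, Complex.sub_im, Complex.add_re, Complex.add_im,
    Complex.mul_re, Complex.mul_im, Complex.I_re, Complex.I_im]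
  linear_combination 4 * z.im * hre - 4 * z.re * him

/-- Integrating (φ' φ̄)' gives φ' φ̄ = ∫ |φ'|² + ∫ V |φ|² - z² ∫ |φ|², and the difference of squares
equals -4 Im(z̄ φ' φ̄). Its positivity for Im z > 0 forbids zeros of the denominator and bounds the
Green's function. -/
theorem normSq_jost_sub (hV : IsPotential V) {y : ℝ} (hy : 0 ≤ y) (z : ℂ) :
    ∃ a b n : ℝ, (0 < y → 0 < a) ∧ 0 ≤ a ∧ 0 ≤ b ∧ 0 ≤ n ∧
      Complex.normSq (jostDenom V y z) -
        Complex.normSq (regSol' V (z ^ 2) y + Complex.I * z * regSol V (z ^ 2) y) =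
      4 * z.im * (a + b + Complex.normSq z * n) := by
  set φ : ℝ → ℂ := regSol V (z ^ 2)
  set ψ : ℝ → ℂ := regSol' V (z ^ 2)
  have hφc : Continuous φ := continuous_regSol hV _
  have hψc : Continuous ψ := continuous_regSol' hV _
  have hφ := isPrimitiveOn_regSol hV (z ^ 2) hy
  have hψ := isPrimitiveOn_regSol' hV (z ^ 2) hy
  have ia : Continuous fun t => Complex.normSq (ψ t) := Complex.continuous_normSq.comp hψc
  have ib : IntervalIntegrable (fun t => V t * Complex.normSq (φ t)) volume 0 y :=
    intervalIntegrable_potential_mul hV hy (Complex.continuous_normSq.comp hφc).continuousOn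
  have ib' : IntervalIntegrable (fun t => ((V t * Complex.normSq (φ t) : ℝ) : ℂ)) volume 0 y :=
    (IsPrimitiveOn.integral ib).ofReal.1
  have inn : Continuous fun t => Complex.normSq (φ t) := Complex.continuous_normSq.comp hφc
  have h := (hψ.mul hy (hφ.clm_comp Complex.conjCLE.toContinuousLinearMap)).2 y ⟨hy, le_rfl⟩
  have hint : ∀ t, ψ t * (starRingEnd ℂ) (ψ t) + (V t • φ t - z ^ 2 * φ t) * (starRingEnd ℂ) (φ t) =
      ((Complex.normSq (ψ t) : ℝ) : ℂ) + ((V t * Complex.normSq (φ t) : ℝ) : ℂ) -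
        z ^ 2 * ((Complex.normSq (φ t) : ℝ) : ℂ) := by
    intro t
    rw [Complex.ofReal_mul, ← Complex.mul_conj, ← Complex.mul_conj, Complex.real_smul]
    ring
  have h2 : ψ y * (starRingEnd ℂ) (φ y) = ((∫ t in (0 : ℝ)..y, Complex.normSq (ψ t) : ℝ) : ℂ) +
      ((∫ t in (0 : ℝ)..y, V t * Complex.normSq (φ t) : ℝ) : ℂ) -
      z ^ 2 * ((∫ t in (0 : ℝ)..y, Complex.normSq (φ t) : ℝ) : ℂ) := by
    simp only [regSol_zero hV, map_zero, mul_zero, zero_add] at h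
    refine h.trans ?_
    have e : ∀ t, ψ t * Complex.conjCLE.toContinuousLinearMap (ψ t) +
        (V t • φ t - z ^ 2 * φ t) * Complex.conjCLE.toContinuousLinearMap (φ t) =
        ((Complex.normSq (ψ t) : ℝ) : ℂ) + ((V t * Complex.normSq (φ t) : ℝ) : ℂ) -
        z ^ 2 * ((Complex.normSq (φ t) : ℝ) : ℂ) := hint
    rw [intervalIntegral.integral_congr fun t _ => e t]
    rw [intervalIntegral.integral_sub, intervalIntegral.integral_add,
      intervalIntegral.integral_const_mul, intervalIntegral.integral_ofReal,
      intervalIntegral.integral_ofReal, intervalIntegral.integral_ofReal]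
    · exact (Complex.continuous_ofReal.comp ia).intervalIntegrable _ _
    · exact ib'
    · exact ((Complex.continuous_ofReal.comp ia).intervalIntegrable _ _).add ib'
    · exact ((Complex.continuous_ofReal.comp inn).intervalIntegrable _ _).const_mul _
  refine ⟨∫ t in (0 : ℝ)..y, Complex.normSq (ψ t), ∫ t in (0 : ℝ)..y, V t * Complex.normSq (φ t),
    ∫ t in (0 : ℝ)..y, Complex.normSq (φ t), fun hy0 => ?_,
    intervalIntegral.integral_nonneg hy fun t _ => Complex.normSq_nonneg _,
    intervalIntegral.integral_nonneg hy fun t _ => mul_nonneg (hV.nonneg t) (Complex.normSq_nonneg _),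
    intervalIntegral.integral_nonneg hy fun t _ => Complex.normSq_nonneg _, ?_⟩
  · refine intervalIntegral.integral_pos hy0 ia.continuousOn
      (fun t _ => Complex.normSq_nonneg _) ⟨0, ⟨le_rfl, hy⟩, ?_⟩
    simp only [ψ, regSol'_zero hV, map_one, one_pos]
  · generalize (∫ t in (0 : ℝ)..y, Complex.normSq (ψ t)) = a at h2 ⊢
    generalize (∫ t in (0 : ℝ)..y, V t * Complex.normSq (φ t)) = b at h2 ⊢
    generalize (∫ t in (0 : ℝ)..y, Complex.normSq (φ t)) = n at h2 ⊢
    exact normSq_sub_sub_normSq_add h2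

theorem jostDenom_ne_zero_of_im_pos (hV : IsPotential V) {y : ℝ} (hy : 0 < y) {z : ℂ}
    (hz : 0 < z.im) : jostDenom V y z ≠ 0 := by
  obtain ⟨a, b, n, ha, ha', hb, hn, h⟩ := normSq_jost_sub hV hy.le z
  intro h0
  rw [h0, map_zero, zero_sub] at h
  have h1 := Complex.normSq_nonneg (regSol' V (z ^ 2) y + Complex.I * z * regSol V (z ^ 2) y)
  have h2 : 0 < 4 * z.im * (a + b + Complex.normSq z * n) := by
    have := ha hy
    have := mul_nonneg (Complex.normSq_nonneg z) hn
    positivity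
  linarith

theorem jostDenom_ofReal (hV : IsPotential V) {y : ℝ} (hy : 0 ≤ y) {k : ℝ} (hk : k ≠ 0) :
    ∃ r : ℝ, 0 < r ∧ |k| * (regSol V ((k : ℂ) ^ 2) y) = (r * Real.sin (pruferAngle V |k| y) : ℝ) ∧
      regSol' V ((k : ℂ) ^ 2) y = (r * Real.cos (pruferAngle V |k| y) : ℝ) := by
  obtain ⟨r, hr, h1, h2⟩ := exists_regSol_eq_prufer hV (abs_pos.2 hk) hy
  rw [sq_abs] at h1 h2
  have h3 := regSol_ofReal hV (k ^ 2) hy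
  rw [Complex.ofReal_pow] at h3
  exact ⟨r, hr, by rw [h3.1, ← h1]; push_cast; rfl, by rw [h3.2, ← h2]⟩

/-- On the real axis φ and φ' are real, so for k ≠ 0 a zero of φ' - ikφ would force sin θ = cos θ =
0; at k = 0 the denominator is φ' ≥ 1. The transform is therefore regular up to the boundary. -/
theorem jostDenom_ne_zero (hV : IsPotential V) {y : ℝ} (hy : 0 < y) {z : ℂ}
    (hz : 0 ≤ z.im) : jostDenom V y z ≠ 0 := by
  rcases hz.lt_or_eq with hz | hz
  · exact jostDenom_ne_zero_of_im_pos hV hy hz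
  obtain ⟨k, rfl⟩ : ∃ k : ℝ, z = k := ⟨z.re, by apply Complex.ext <;> simp [← hz]⟩
  rcases eq_or_ne k 0 with rfl | hk
  · have h3 := regSol_ofReal hV 0 hy.le
    have h4 := (one_le_regSol' hV (le_refl (0 : ℝ)) hy.le).2
    rw [Complex.ofReal_zero] at h3
    simp only [jostDenom, Complex.ofReal_zero, ne_eq, OfNat.ofNat_ne_zero, not_false_eq_true,
      zero_pow, mul_zero, zero_mul, sub_zero]
    rw [h3.2, Complex.ofReal_eq_zero]
    linarith
  · obtain ⟨r, hr, h1, h2⟩ := jostDenom_ofReal hV hy.le hk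
    intro h0
    rw [jostDenom, h2] at h0
    have h1re := congrArg Complex.re h1
    have h1im := congrArg Complex.im h1
    have h0re := congrArg Complex.re h0
    have h0im := congrArg Complex.im h0
    simp only [Complex.mul_re, Complex.mul_im, Complex.ofReal_re, Complex.ofReal_im, zero_mul,
      sub_zero, add_zero, Complex.sub_re, Complex.sub_im, Complex.I_re, Complex.I_im,
      Complex.zero_re, Complex.zero_im, one_mul, zero_sub, zero_add, mul_zero] at *
    have him0 : (regSol V ((k : ℂ) ^ 2) y).im = 0 :=
      (mul_eq_zero.1 h1im).resolve_left (abs_pos.2 hk).ne'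
    rw [him0, mul_zero, neg_zero, sub_zero] at h0re
    have hcos := (mul_eq_zero.1 h0re).resolve_left hr.ne'
    have hre0 : (regSol V ((k : ℂ) ^ 2) y).re = 0 := by
      have := neg_eq_zero.1 h0im
      exact (mul_eq_zero.1 this).resolve_left hk
    rw [hre0, mul_zero] at h1re
    have hsin := (mul_eq_zero.1 h1re.symm).resolve_left hr.ne'
    have := Real.sin_sq_add_cos_sq (pruferAngle V |k| y)
    rw [hsin, hcos] at this
    norm_num at this

/-- The reflected quantity φ' + izφ is no larger than the denominator, and 2izφ is their difference.
This decay at infinity makes the transform to the disc continuous at the point w = 1. -/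
theorem norm_mul_truncGreen_le (hV : IsPotential V) {y : ℝ} (hy : 0 < y) {z : ℂ}
    (hz : 0 ≤ z.im) : ‖z‖ * ‖truncGreen V y z‖ ≤ 1 := by
  obtain ⟨a, b, n, ha, ha', hb, hn, h⟩ := normSq_jost_sub hV hy.le z
  have hD := jostDenom_ne_zero hV hy hz
  have h1 : Complex.normSq (regSol' V (z ^ 2) y + Complex.I * z * regSol V (z ^ 2) y) ≤
      Complex.normSq (jostDenom V y z) := by
    have := mul_nonneg (Complex.normSq_nonneg z) hn
    have : 0 ≤ 4 * z.im * (a + b + Complex.normSq z * n) := by positivity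
    linarith
  rw [Complex.normSq_eq_norm_sq, Complex.normSq_eq_norm_sq] at h1
  have h2 := le_of_sq_le_sq h1 (norm_nonneg _)
  have h3 : 2 * (‖z‖ * ‖regSol V (z ^ 2) y‖) ≤ 2 * ‖jostDenom V y z‖ := by
    have e : 2 * Complex.I * z * regSol V (z ^ 2) y =
        (regSol' V (z ^ 2) y + Complex.I * z * regSol V (z ^ 2) y) - jostDenom V y z := by
      rw [jostDenom]; ring
    have := norm_sub_le (regSol' V (z ^ 2) y + Complex.I * z * regSol V (z ^ 2) y) (jostDenom V y z)
    rw [← e] at this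
    simp only [norm_mul, Complex.norm_I, Complex.norm_ofNat, mul_one] at this
    linarith
  rw [truncGreen, norm_div, ← mul_div_assoc, div_le_one (norm_pos_iff.2 hD)]
  linarith

/-- By the Wronskian identity the difference quotient is explicit and only needs continuity in the
parameter. At z = iκ the derivative is 2iκ ‖G(y, ·)‖². -/
theorem hasDerivAt_truncGreen (hV : IsPotential V) {y : ℝ} (hy : 0 < y) {z : ℂ}
    (hz : 0 ≤ z.im) : HasDerivAt (truncGreen V y)
      ((2 * z * (∫ t in (0 : ℝ)..y, regSol V (z ^ 2) t * regSol V (z ^ 2) t) +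
        Complex.I * regSol V (z ^ 2) y ^ 2) / jostDenom V y z ^ 2) z := by
  have hD := jostDenom_ne_zero hV hy hz
  have hsq : Continuous fun w : ℂ => w ^ 2 := by fun_prop
  have hφc : Continuous fun w : ℂ => regSol V (w ^ 2) y :=
    (continuous_regSol_param hV hy.le).comp hsq
  have hψc : Continuous fun w : ℂ => regSol' V (w ^ 2) y :=
    (continuous_regSol'_param hV hy.le).comp hsq
  have hDc : Continuous (jostDenom V y) := by unfold jostDenom; fun_prop
  have hIc : ContinuousAt (fun w : ℂ => ∫ t in (0 : ℝ)..y, regSol V (w ^ 2) t * regSol V (z ^ 2) t)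
      z := ContinuousAt.comp (f := fun w : ℂ => w ^ 2)
        (continuous_integral_regSol_mul hV (z ^ 2) hy.le) hsq.continuousAt
  rw [hasDerivAt_iff_tendsto_slope]
  have hlim : Tendsto (fun w : ℂ => ((w + z) *
      (∫ t in (0 : ℝ)..y, regSol V (w ^ 2) t * regSol V (z ^ 2) t) +
        Complex.I * (regSol V (w ^ 2) y * regSol V (z ^ 2) y)) /
        (jostDenom V y w * jostDenom V y z)) (𝓝 z) (𝓝 ((2 * z *
        (∫ t in (0 : ℝ)..y, regSol V (z ^ 2) t * regSol V (z ^ 2) t) +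
        Complex.I * regSol V (z ^ 2) y ^ 2) / jostDenom V y z ^ 2)) := by
    have : ContinuousAt (fun w : ℂ => ((w + z) *
      (∫ t in (0 : ℝ)..y, regSol V (w ^ 2) t * regSol V (z ^ 2) t) +
        Complex.I * (regSol V (w ^ 2) y * regSol V (z ^ 2) y)) /
        (jostDenom V y w * jostDenom V y z)) z := by
      refine ContinuousAt.div ?_ (by fun_prop) (mul_ne_zero hD hD)
      exact ((by fun_prop : ContinuousAt (fun w : ℂ => w + z) z).mul hIc).add
        (continuous_const.mul (hφc.mul continuous_const)).continuousAt
    convert this.tendsto using 2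
    ring
  refine (hlim.mono_left nhdsWithin_le_nhds).congr' ?_
  have hev : ∀ᶠ w in 𝓝[≠] z, jostDenom V y w ≠ 0 :=
    (hDc.continuousAt.eventually_ne hD).filter_mono nhdsWithin_le_nhds
  filter_upwards [hev, self_mem_nhdsWithin] with w hw hne
  have hne' : w - z ≠ 0 := sub_ne_zero.2 hne
  have hW := regSol_wronskian hV (w ^ 2) (z ^ 2) hy.le
  rw [slope_def_field, truncGreen, truncGreen, div_sub_div _ _ hw hD, div_div,
    div_eq_div_iff (mul_ne_zero hw hD) (mul_ne_zero (mul_ne_zero hw hD) hne')]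
  have key : regSol V (w ^ 2) y * jostDenom V y z - jostDenom V y w * regSol V (z ^ 2) y =
      (w - z) * ((w + z) * (∫ t in (0 : ℝ)..y, regSol V (w ^ 2) t * regSol V (z ^ 2) t) +
        Complex.I * (regSol V (w ^ 2) y * regSol V (z ^ 2) y)) := by
    rw [jostDenom, jostDenom]
    linear_combination hW
  rw [key]
  ring

/-- In Prüfer form the Green's function at real k > 0 is sin θ / (k(cos θ - i sin θ)), so k Im G =
sin² θ. The absolute value covers k < 0, where θ is taken at |k|. -/
theorem re_I_mul_truncGreen (hV : IsPotential V) {y : ℝ} (hy : 0 < y) {k : ℝ} (hk : k ≠ 0) :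
    (Complex.I * k * truncGreen V y k).re = -Real.sin (pruferAngle V |k| y) ^ 2 := by
  have hD := jostDenom_ne_zero hV hy (z := k) (by simp)
  obtain ⟨r, hr, h1, h2⟩ := jostDenom_ofReal hV hy.le hk
  have hk' : ((|k| : ℝ) : ℂ) ≠ 0 := by simpa using hk
  have hφ : regSol V ((k : ℂ) ^ 2) y = (r * Real.sin (pruferAngle V |k| y) / |k| : ℝ) := by
    rw [eq_comm, Complex.ofReal_div, div_eq_iff hk', ← h1, mul_comm]
  set s := Real.sin (pruferAngle V |k| y)
  set c := Real.cos (pruferAngle V |k| y)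
  have hsc : s ^ 2 + c ^ 2 = 1 := Real.sin_sq_add_cos_sq _
  have habs : |k| ≠ 0 := (abs_pos.2 hk).ne'
  set e := k / |k|
  have he : e ^ 2 = 1 := by
    rw [div_pow, sq_abs, div_self (pow_ne_zero 2 hk)]
  have hke : (k : ℂ) * (r * s / |k| : ℝ) = ((r * s * e : ℝ) : ℂ) := by
    rw [← Complex.ofReal_mul]
    congr 1
    simp only [e]
    field_simp
  have hz : Complex.I * k * truncGreen V y k = ((-s ^ 2 : ℝ) : ℂ) + Complex.I * (e * s * c : ℝ) := by
    have hsc' : (s : ℂ) ^ 2 + (c : ℂ) ^ 2 = 1 := by exact_mod_cast hsc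
    have he' : (e : ℂ) ^ 2 = 1 := by exact_mod_cast he
    rw [truncGreen, mul_div_assoc', div_eq_iff hD, jostDenom, h2, hφ, mul_assoc, hke]
    push_cast
    linear_combination -(Complex.I * r * s * e) * hsc' + r * s ^ 2 * c * e ^ 2 * Complex.I_sq -
      r * s ^ 2 * c * he'
  rw [hz, Complex.add_re, Complex.ofReal_re, Complex.mul_re, Complex.I_re, Complex.I_im,
    Complex.ofReal_im]
  ring

end Weyl

/-! ### Cauchy's formula on the disc and the norm of the Green's function -/

section CircleFormula

variable {V : ℝ → ℝ} {y κ : ℝ}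

/-- The Cayley transform from the unit disc to the upper half-plane, with centre `iκ`. -/
noncomputable def cayley (κ : ℝ) (w : ℂ) : ℂ := Complex.I * κ * (1 + w) / (1 - w)

theorem cayley_im_nonneg (hκ : 0 < κ) {w : ℂ} (hw : ‖w‖ ≤ 1) : 0 ≤ (cayley κ w).im := by
  have h1 : (cayley κ w).im = κ * (1 - Complex.normSq w) / Complex.normSq (1 - w) := by
    rw [cayley, Complex.div_im]
    simp [Complex.normSq_apply]
    ring
  rw [h1, Complex.normSq_eq_norm_sq w]
  refine div_nonneg (mul_nonneg hκ.le ?_) (Complex.normSq_nonneg _)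
  nlinarith [norm_nonneg w]

theorem hasDerivAt_cayley {w : ℂ} (hw : w ≠ 1) :
    HasDerivAt (cayley κ) (2 * Complex.I * κ / (1 - w) ^ 2) w := by
  have h1 : (1 : ℂ) - w ≠ 0 := sub_ne_zero.2 hw.symm
  have := (((hasDerivAt_id w).const_add 1).const_mul (Complex.I * κ)).div
    ((hasDerivAt_id w).const_sub 1) h1
  refine this.congr_deriv ?_
  simp only [id]
  congr 1
  ring

/-- The truncated Green's function transported to the unit disc. -/
noncomputable def discGreen (V : ℝ → ℝ) (y κ : ℝ) (w : ℂ) : ℂ :=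
  if w = 1 then 0 else truncGreen V y (cayley κ w)

theorem hasDerivAt_discGreen (hV : IsPotential V) (hy : 0 < y) (hκ : 0 < κ) {w : ℂ}
    (hw : ‖w‖ ≤ 1) (hw1 : w ≠ 1) :
    HasDerivAt (discGreen V y κ) (deriv (truncGreen V y) (cayley κ w) *
      (2 * Complex.I * κ / (1 - w) ^ 2)) w := by
  have h := (hasDerivAt_truncGreen hV hy (cayley_im_nonneg hκ hw)).differentiableAt.hasDerivAt
  refine (h.comp w (hasDerivAt_cayley hw1)).congr_of_eventuallyEq ?_
  filter_upwards [isOpen_ne.mem_nhds hw1] with v hv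
  rw [discGreen, if_neg hv]; rfl

theorem diffContOnCl_discGreen (hV : IsPotential V) (hy : 0 < y) (hκ : 0 < κ) :
    DiffContOnCl ℂ (discGreen V y κ) (Metric.ball 0 1) := by
  refine ⟨fun w hw => ?_, ?_⟩
  · have hw' : ‖w‖ < 1 := by simpa using hw
    exact (hasDerivAt_discGreen hV hy hκ hw'.le (by
      rintro rfl; simp at hw')).differentiableAt.differentiableWithinAt
  · rw [closure_ball _ one_ne_zero]
    intro w hw
    have hw' : ‖w‖ ≤ 1 := by simpa using hw
    by_cases hw1 : w = 1
    · subst hw1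
      rw [ContinuousWithinAt, discGreen, if_pos rfl]
      -- At w = 1, the image of infinity, |G| ≤ 1/|z| = |1 - w| / (κ|1 + w|) → 0, which matches the
      -- value 0 assigned there.
      have hlim : Tendsto (fun w : ℂ => ‖1 - w‖ / (κ * ‖1 + w‖)) (𝓝[Metric.closedBall 0 1] 1)
          (𝓝 0) := by
        have : ContinuousAt (fun w : ℂ => ‖1 - w‖ / (κ * ‖1 + w‖)) 1 := by
          refine ContinuousAt.div (by fun_prop) (by fun_prop) ?_
          have : ‖(1 : ℂ) + 1‖ = 2 := by norm_num
          rw [this]; positivity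
        have h2 := this.tendsto
        rw [sub_self, norm_zero, zero_div] at h2
        exact h2.mono_left nhdsWithin_le_nhds
      have hne : ∀ᶠ w : ℂ in 𝓝[Metric.closedBall 0 1] 1, 1 + w ≠ 0 := by
        refine Filter.Eventually.filter_mono nhdsWithin_le_nhds ?_
        exact (by fun_prop : ContinuousAt (fun w : ℂ => 1 + w) 1).eventually_ne (by norm_num)
      refine squeeze_zero_norm' ?_ hlim
      filter_upwards [hne, self_mem_nhdsWithin] with v hv hvm
      have hv1 : ‖v‖ ≤ 1 := by simpa using hvm
      by_cases hvv : v = 1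
      · rw [discGreen, if_pos hvv, norm_zero]; positivity
      · rw [discGreen, if_neg hvv]
        have hb := norm_mul_truncGreen_le hV hy (cayley_im_nonneg hκ hv1)
        have h1 : 0 < ‖1 - v‖ := norm_pos_iff.2 (sub_ne_zero.2 (Ne.symm hvv))
        have h2 : 0 < ‖1 + v‖ := norm_pos_iff.2 hv
        have hn : ‖cayley κ v‖ = κ * ‖1 + v‖ / ‖1 - v‖ := by
          rw [cayley, norm_div, norm_mul, norm_mul, Complex.norm_I, one_mul, Complex.norm_real,
            Real.norm_of_nonneg hκ.le]
        rw [hn, div_mul_eq_mul_div, div_le_one h1] at hb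
        rw [le_div_iff₀ (by positivity), mul_comm]
        exact hb
    · exact (hasDerivAt_discGreen hV hy hκ hw' hw1).continuousAt.continuousWithinAt

/-- Cauchy's formula for the derivative at 0 gives the w⁻¹ term, while the w term integrates to 0.
Subtracting it makes the weight w⁻¹ - w purely imaginary on the circle, so that taking real parts
leaves only Im G, that is sin² θ. -/
theorem integral_circle_discGreen (hV : IsPotential V) (hy : 0 < y) (hκ : 0 < κ) :
    ∫ t in (0 : ℝ)..2 * Real.pi, ((circleMap 0 1 t)⁻¹ - circleMap 0 1 t) *
      discGreen V y κ (circleMap 0 1 t) = 2 * Real.pi * deriv (discGreen V y κ) 0 := by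
  have hd := diffContOnCl_discGreen hV hy hκ
  have h1 := hd.deriv_eq_smul_circleIntegral one_pos
  have h2 := hd.circleIntegral_eq_zero zero_le_one
  have hc : Continuous fun t => discGreen V y κ (circleMap 0 1 t) := by
    refine hd.continuousOn.comp_continuous (continuous_circleMap 0 1) fun t => ?_
    rw [closure_ball _ one_ne_zero]
    exact circleMap_mem_closedBall 0 zero_le_one t
  have hci : Continuous fun t => (circleMap 0 1 t)⁻¹ :=
    (continuous_circleMap 0 1).inv₀ fun t => circleMap_ne_center one_ne_zero
  simp only [circleIntegral, deriv_circleMap, smul_eq_mul, sub_zero] at h1 h2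
  have h3 : ∀ t : ℝ, Complex.I * (((circleMap 0 1 t)⁻¹ - circleMap 0 1 t) *
      discGreen V y κ (circleMap 0 1 t)) = circleMap 0 1 t * Complex.I *
      (1 / circleMap 0 1 t ^ 2 * discGreen V y κ (circleMap 0 1 t)) -
      circleMap 0 1 t * Complex.I * discGreen V y κ (circleMap 0 1 t) := by
    intro t
    have : circleMap 0 1 t ≠ 0 := circleMap_ne_center one_ne_zero
    field_simp
  have hc1 : Continuous (circleMap 0 1) := continuous_circleMap 0 1
  have h4 := congrArg₂ (· - ·) h1 h2
  beta_reduce at h4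
  rw [sub_zero, ← intervalIntegral.integral_sub, ← intervalIntegral.integral_congr
    (fun t _ => h3 t), intervalIntegral.integral_const_mul] at h4
  · refine mul_left_cancel₀ Complex.I_ne_zero (h4.trans ?_)
    ring
  · have : Continuous fun t => 1 / circleMap 0 1 t ^ 2 := by
      simp only [one_div, ← inv_pow]
      exact hci.pow 2
    exact Continuous.intervalIntegrable (by fun_prop) _ _
  · exact Continuous.intervalIntegrable (by fun_prop) _ _

/-- The squared norm of the Green's function `G(y, ·)` for the potential truncated to `(0, y)` at
energy `-κ²`. -/
noncomputable def greenNormSq (V : ℝ → ℝ) (κ y : ℝ) : ℝ :=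
  ((∫ t in (0 : ℝ)..y, regSol V (-κ ^ 2) t ^ 2) + regSol V (-κ ^ 2) y ^ 2 / (2 * κ)) /
    (regSol' V (-κ ^ 2) y + κ * regSol V (-κ ^ 2) y) ^ 2

/-- The centre of the disc corresponds to z = iκ. Both the Cayley derivative and the z-derivative of
G carry a factor 2iκ, whence -4κ². -/
theorem deriv_discGreen_zero (hV : IsPotential V) (hy : 0 < y) (hκ : 0 < κ) :
    deriv (discGreen V y κ) 0 = ((-4 * κ ^ 2 * greenNormSq V κ y : ℝ) : ℂ) := by
  rw [(hasDerivAt_discGreen hV hy hκ (w := 0) (by simp) zero_ne_one).deriv]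
  have hc : cayley κ 0 = Complex.I * κ := by simp [cayley]
  have hsq : (Complex.I * κ) ^ 2 = ((-κ ^ 2 : ℝ) : ℂ) := by
    rw [mul_pow, Complex.I_sq]; push_cast; ring
  have hreg := fun t (ht : 0 ≤ t) => regSol_ofReal hV (-κ ^ 2) (x := t) ht
  have hint : ∫ t in (0 : ℝ)..y, regSol V ((-κ ^ 2 : ℝ) : ℂ) t * regSol V ((-κ ^ 2 : ℝ) : ℂ) t =
      ((∫ t in (0 : ℝ)..y, regSol V (-κ ^ 2) t ^ 2 : ℝ) : ℂ) := by
    rw [← intervalIntegral.integral_ofReal]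
    refine intervalIntegral.integral_congr fun t ht => ?_
    rw [uIcc_of_le hy.le] at ht
    simp only [(hreg t ht.1).1]
    push_cast; ring
  have hpos := one_le_regSol' hV (lam := -κ ^ 2) (by nlinarith) hy.le
  have hD : 0 < regSol' V (-κ ^ 2) y + κ * regSol V (-κ ^ 2) y := by
    have := mul_nonneg hκ.le hpos.1
    linarith [hpos.2]
  have him : 0 ≤ (Complex.I * (κ : ℂ)).im := by simp [hκ.le]
  rw [hc, (hasDerivAt_truncGreen hV hy him).deriv, jostDenom, hsq, hint, (hreg y hy.le).1,
    (hreg y hy.le).2]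
  have hD' : ((regSol' V (-κ ^ 2) y : ℝ) : ℂ) -
      Complex.I * (Complex.I * κ) * ((regSol V (-κ ^ 2) y : ℝ) : ℂ) =
      ((regSol' V (-κ ^ 2) y + κ * regSol V (-κ ^ 2) y : ℝ) : ℂ) := by
    push_cast
    linear_combination -(κ : ℂ) * ((regSol V (-κ ^ 2) y : ℝ) : ℂ) * Complex.I_sq
  rw [hD', greenNormSq]
  generalize regSol' V (-κ ^ 2) y + κ * regSol V (-κ ^ 2) y = D at hD
  generalize (∫ t in (0 : ℝ)..y, regSol V (-κ ^ 2) t ^ 2) = A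
  generalize regSol V (-κ ^ 2) y = p
  have hDc : (D : ℂ) ≠ 0 := by exact_mod_cast hD.ne'
  have hκc : (κ : ℂ) ≠ 0 := by exact_mod_cast hκ.ne'
  push_cast
  field_simp
  ring_nf
  simp only [Complex.I_sq]
  ring

/-- The boundary point that the Cayley transform sends to the real momentum k; the substitution has
dt = 2κ/(k² + κ²) dk. -/
theorem circleMap_arctan (hκ : 0 < κ) (k : ℝ) :
    circleMap 0 1 (2 * Real.arctan (k / κ) + Real.pi) =
      (k - Complex.I * κ) / (k + Complex.I * κ) := by
  have h1 : circleMap 0 1 (2 * Real.arctan (k / κ) + Real.pi) =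
      -(Complex.exp (Real.arctan (k / κ) * Complex.I)) ^ 2 := by
    rw [circleMap, ← Complex.exp_nat_mul]
    push_cast
    rw [add_mul, Complex.exp_add, Complex.exp_pi_mul_I, zero_add, one_mul, mul_neg_one]
    congr 2
    ring
  rw [h1, Complex.exp_mul_I, ← Complex.ofReal_cos, ← Complex.ofReal_sin, Real.cos_arctan,
    Real.sin_arctan]
  have hpos : 0 < 1 + (k / κ) ^ 2 := by positivity
  set s := √(1 + (k / κ) ^ 2)
  have hs : s ^ 2 = 1 + (k / κ) ^ 2 := Real.sq_sqrt hpos.le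
  have hs0 : (s : ℂ) ≠ 0 := by
    have : 0 < s := Real.sqrt_pos.2 hpos
    exact_mod_cast this.ne'
  have hsc : (s : ℂ) ^ 2 * κ ^ 2 = κ ^ 2 + k ^ 2 := by
    have : s ^ 2 * κ ^ 2 = κ ^ 2 + k ^ 2 := by rw [hs]; field_simp
    exact_mod_cast this
  have hκc : (κ : ℂ) ≠ 0 := by exact_mod_cast hκ.ne'
  have hden : (k : ℂ) + Complex.I * κ ≠ 0 := by
    intro h
    have := congrArg Complex.im h
    simp at this
    exact hκ.ne' this
  have hsκ : (s : ℂ) ^ 2 * κ ^ 2 ≠ 0 := mul_ne_zero (pow_ne_zero 2 hs0) (pow_ne_zero 2 hκc)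
  have h2 : (((1 / s : ℝ) : ℂ) + ((k / κ / s : ℝ) : ℂ) * Complex.I) * (s * κ) =
      κ + k * Complex.I := by
    push_cast
    field_simp
  rw [eq_div_iff hden]
  refine mul_right_cancel₀ hsκ ?_
  calc _ = -((((1 / s : ℝ) : ℂ) + ((k / κ / s : ℝ) : ℂ) * Complex.I) * (s * κ)) ^ 2 *
        (k + Complex.I * κ) := by ring
    _ = _ := by
        rw [h2, hsc]
        linear_combination (-(k : ℂ) ^ 3 - 2 * κ ^ 2 * k - k ^ 2 * κ * Complex.I) * Complex.I_sq

theorem image_arctan (hκ : 0 < κ) :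
    (fun k : ℝ => 2 * Real.arctan (k / κ) + Real.pi) '' univ = Ioo 0 (2 * Real.pi) := by
  ext t
  simp only [image_univ, mem_range, mem_Ioo]
  constructor
  · rintro ⟨k, rfl⟩
    have h1 := Real.neg_pi_div_two_lt_arctan (k / κ)
    have h2 := Real.arctan_lt_pi_div_two (k / κ)
    constructor <;> linarith
  · rintro ⟨h1, h2⟩
    refine ⟨κ * Real.tan ((t - Real.pi) / 2), ?_⟩
    rw [mul_div_cancel_left₀ _ hκ.ne', Real.arctan_tan (by linarith) (by linarith)]
    ring

/-- Spectral representation of the Green's function in terms of the Prüfer angle. -/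
theorem greenNormSq_eq_integral (hV : IsPotential V) (hy : 0 < y) (hκ : 0 < κ) :
    greenNormSq V κ y =
      2 / Real.pi * ∫ k in Ioi 0, Real.sin (pruferAngle V k y) ^ 2 / (k ^ 2 + κ ^ 2) ^ 2 := by
  have hpi := Real.pi_pos
  have h := integral_circle_discGreen hV hy hκ
  rw [deriv_discGreen_zero hV hy hκ] at h
  have hd := diffContOnCl_discGreen hV hy hκ
  have hc : Continuous fun t => discGreen V y κ (circleMap 0 1 t) := by
    refine hd.continuousOn.comp_continuous (continuous_circleMap 0 1) fun t => ?_
    rw [closure_ball _ one_ne_zero]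
    exact circleMap_mem_closedBall 0 zero_le_one t
  have hci : Continuous fun t => (circleMap 0 1 t)⁻¹ :=
    (continuous_circleMap 0 1).inv₀ fun t => circleMap_ne_center one_ne_zero
  have hc1 : Continuous (circleMap 0 1) := continuous_circleMap 0 1
  set G : ℝ → ℂ := fun t => ((circleMap 0 1 t)⁻¹ - circleMap 0 1 t) *
      discGreen V y κ (circleMap 0 1 t)
  have hG : Continuous G := by fun_prop
  have hre : ∫ t in (0 : ℝ)..2 * Real.pi, (G t).re =
      2 * Real.pi * (-4 * κ ^ 2 * greenNormSq V κ y) := by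
    have := Complex.reCLM.intervalIntegral_comp_comm (hG.intervalIntegrable 0 (2 * Real.pi))
      (μ := volume)
    simp only [Complex.reCLM_apply] at this
    rw [this, h, ← Complex.ofReal_ofNat, ← Complex.ofReal_mul, ← Complex.ofReal_mul,
      Complex.ofReal_re]
  rw [intervalIntegral.integral_of_le (by positivity), integral_Ioc_eq_integral_Ioo,
    ← image_arctan hκ, integral_image_eq_integral_abs_deriv_smul MeasurableSet.univ
    (f' := fun k => 2 * κ / (k ^ 2 + κ ^ 2))] at hre
  -- On the boundary w⁻¹ - w = 4iκk/(k² + κ²); with dt/dk = 2κ/(k² + κ²) and Re(ikG) = -sin² θ this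
  -- produces -8κ² sin² θ / (k² + κ²)². The point k = 0, where no Prüfer angle is available, is a
  -- null set.
  · have hpt : ∀ᵐ k : ℝ, |2 * κ / (k ^ 2 + κ ^ 2)| • (G (2 * Real.arctan (k / κ) + Real.pi)).re =
        -8 * κ ^ 2 * (fun k => Real.sin (pruferAngle V k y) ^ 2 / (k ^ 2 + κ ^ 2) ^ 2) |k| := by
      have hne : ∀ᵐ k : ℝ, k ≠ 0 := by simp [ae_iff, measure_singleton]
      filter_upwards [hne] with k hk
      have hkκ : 0 < k ^ 2 + κ ^ 2 := by positivity
      have hden : (k : ℂ) + Complex.I * κ ≠ 0 := by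
        intro h
        have := congrArg Complex.im h
        simp at this
        exact hκ.ne' this
      have hden' : (k : ℂ) - Complex.I * κ ≠ 0 := by
        intro h
        have := congrArg Complex.im h
        simp at this
        exact hκ.ne' this
      have hkκc : (k : ℂ) ^ 2 + κ ^ 2 ≠ 0 := by exact_mod_cast hkκ.ne'
      have hw : ((k : ℂ) - Complex.I * κ) / (k + Complex.I * κ) ≠ 1 := by
        rw [ne_eq, div_eq_one_iff_eq hden]
        intro h
        have := congrArg Complex.im h
        simp at this
        linarith
      have hcay : cayley κ (((k : ℂ) - Complex.I * κ) / (k + Complex.I * κ)) = k := by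
        have h2 : (1 : ℂ) - (k - Complex.I * κ) / (k + Complex.I * κ) ≠ 0 := sub_ne_zero.2 hw.symm
        rw [cayley, div_eq_iff h2]
        field_simp
        ring
      have hGk : G (2 * Real.arctan (k / κ) + Real.pi) =
          ((4 * κ / (k ^ 2 + κ ^ 2) : ℝ) : ℂ) * (Complex.I * k * truncGreen V y k) := by
        simp only [G]
        rw [circleMap_arctan hκ, discGreen, if_neg hw, hcay, inv_div, ← mul_assoc]
        congr 1
        rw [div_sub_div _ _ hden' hden]
        have e : ((k : ℂ) - Complex.I * κ) * (k + Complex.I * κ) = k ^ 2 + κ ^ 2 := by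
          linear_combination -(κ : ℂ) ^ 2 * Complex.I_sq
        rw [e]
        push_cast
        field_simp
        ring
      rw [hGk, Complex.re_ofReal_mul, re_I_mul_truncGreen hV hy hk, abs_of_pos (by positivity),
        smul_eq_mul, sq_abs]
      field_simp
      ring
    rw [setIntegral_univ, integral_congr_ae hpt, integral_const_mul,
      integral_comp_abs (f := fun k => Real.sin (pruferAngle V k y) ^ 2 / (k ^ 2 + κ ^ 2) ^ 2)] at hre
    have hκ2 : κ ^ 2 ≠ 0 := by positivity
    field_simp
    have : κ ^ 2 * (greenNormSq V κ y * Real.pi) = κ ^ 2 * (2 *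
        ∫ k in Ioi 0, Real.sin (pruferAngle V k y) ^ 2 / (k ^ 2 + κ ^ 2) ^ 2) := by linarith
    exact mul_left_cancel₀ hκ2 this
  · intro k _
    have := (((hasDerivAt_id k).div_const κ).arctan.const_mul 2).add_const Real.pi
    refine (this.congr_deriv ?_).hasDerivWithinAt
    simp only [id]
    field_simp
    ring
  · intro a _ b _ hab
    have : Real.arctan (a / κ) = Real.arctan (b / κ) := by simpa using hab
    exact (div_left_inj' hκ.ne').1 (Real.arctan_injective this)

end CircleFormula

/-! ### Bounds for the truncated Green's function at negative energy -/

section Green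

variable {V : ℝ → ℝ} {κ : ℝ}

/-- The denominator `φ' + κ φ` for the regular solution at energy `-κ²`. -/
noncomputable def greenDenom (V : ℝ → ℝ) (κ y : ℝ) : ℝ :=
  regSol' V (-κ ^ 2) y + κ * regSol V (-κ ^ 2) y

/-- The Green's function `G(y, ·)` at energy `-κ²` for the potential truncated to `(0, y)`. -/
noncomputable def greenFn (V : ℝ → ℝ) (κ y s : ℝ) : ℝ :=
  regSol V (-κ ^ 2) (min s y) * Real.exp (-κ * (s - min s y)) / greenDenom V κ y

theorem continuous_greenDenom (hV : IsPotential V) : Continuous (greenDenom V κ) :=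
  (continuous_regSol' hV _).add (continuous_const.mul (continuous_regSol hV _))

theorem regSol_neg_sq_nonneg (hV : IsPotential V) {y : ℝ} (hy : 0 ≤ y) :
    0 ≤ regSol V (-κ ^ 2) y :=
  (one_le_regSol' hV (by nlinarith [sq_nonneg κ]) hy).1

theorem one_le_greenDenom (hV : IsPotential V) (hκ : 0 < κ) {y : ℝ} (hy : 0 ≤ y) :
    1 ≤ greenDenom V κ y := by
  have h := one_le_regSol' hV (lam := -κ ^ 2) (by nlinarith [sq_nonneg κ]) hy
  have := mul_nonneg hκ.le h.1
  rw [greenDenom]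
  linarith [h.2]

theorem isPrimitiveOn_greenDenom (hV : IsPotential V) {T : ℝ} (hT : 0 ≤ T) :
    IsPrimitiveOn (greenDenom V κ)
      (fun t => V t * regSol V (-κ ^ 2) t + κ * greenDenom V κ t) T := by
  refine ((isPrimitiveOn_regSol' hV (-κ ^ 2) hT).add ((IsPrimitiveOn.const κ).mul hT
    (isPrimitiveOn_regSol hV (-κ ^ 2) hT))).congr hT (fun _ _ => rfl)
    (Eventually.of_forall fun t _ => ?_)
  simp only [greenDenom, smul_eq_mul]
  ring

theorem isPrimitiveOn_exp (c : ℝ) {T : ℝ} (hT : 0 ≤ T) :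
    IsPrimitiveOn (fun t => Real.exp (c * t)) (fun t => c * Real.exp (c * t)) T :=
  IsPrimitiveOn.of_hasDerivAt hT (fun t _ => by
    have := ((hasDerivAt_id t).const_mul c).exp
    refine this.congr_deriv ?_
    simp [mul_comm]) (by fun_prop)

/-- D' = Vφ + κD ≥ κD, so D exp(-κt) is nondecreasing. -/
theorem greenDenom_mul_exp_le (hV : IsPotential V) {s y : ℝ} (hs : 0 ≤ s)
    (hsy : s ≤ y) : greenDenom V κ s ≤ greenDenom V κ y * Real.exp (-κ * (y - s)) := by
  have hy := hs.trans hsy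
  have h := ((isPrimitiveOn_greenDenom (κ := κ) hV hy).mul hy (isPrimitiveOn_exp (-κ) hy)).sub_eq
    ⟨hs, hsy⟩ ⟨hy, le_rfl⟩
  have h2 : 0 ≤ ∫ t in s..y, (greenDenom V κ t * (-κ * Real.exp (-κ * t)) +
      (V t * regSol V (-κ ^ 2) t + κ * greenDenom V κ t) * Real.exp (-κ * t)) := by
    refine intervalIntegral.integral_nonneg hsy fun t ht => ?_
    have := mul_nonneg (mul_nonneg (hV.nonneg t)
      (regSol_neg_sq_nonneg (κ := κ) hV (hs.trans ht.1))) (Real.exp_pos (-κ * t)).le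
    nlinarith
  rw [← h, sub_nonneg] at h2
  have e : Real.exp (-κ * (y - s)) = Real.exp (-κ * y) * (Real.exp (-κ * s))⁻¹ := by
    rw [← Real.exp_neg, ← Real.exp_add]; congr 1; ring
  rw [e, ← mul_assoc, ← div_eq_mul_inv, le_div_iff₀ (Real.exp_pos _)]
  exact h2

/-- The derivative of (φ' - κφ) exp(κt) is Vφ exp(κt) ≥ 0 and its initial value is 1; hence φ' ≥ κφ.
-/
theorem two_mul_regSol_le_greenDenom (hV : IsPotential V) {y : ℝ} (hy : 0 ≤ y) :
    2 * κ * regSol V (-κ ^ 2) y ≤ greenDenom V κ y := by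
  have hp : IsPrimitiveOn (fun t => regSol' V (-κ ^ 2) t - κ * regSol V (-κ ^ 2) t)
      (fun t => V t * regSol V (-κ ^ 2) t -
        κ * (regSol' V (-κ ^ 2) t - κ * regSol V (-κ ^ 2) t)) y := by
    refine ((isPrimitiveOn_regSol' hV (-κ ^ 2) hy).sub ((IsPrimitiveOn.const κ).mul hy
      (isPrimitiveOn_regSol hV (-κ ^ 2) hy))).congr hy (fun _ _ => rfl)
      (Eventually.of_forall fun t _ => ?_)
    simp only [smul_eq_mul]
    ring
  have h := (hp.mul hy (isPrimitiveOn_exp κ hy)).2 y ⟨hy, le_rfl⟩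
  have h2 : 0 ≤ ∫ t in (0 : ℝ)..y, ((regSol' V (-κ ^ 2) t - κ * regSol V (-κ ^ 2) t) *
      (κ * Real.exp (κ * t)) + (V t * regSol V (-κ ^ 2) t -
        κ * (regSol' V (-κ ^ 2) t - κ * regSol V (-κ ^ 2) t)) * Real.exp (κ * t)) := by
    refine intervalIntegral.integral_nonneg hy fun t ht => ?_
    have := mul_nonneg (mul_nonneg (hV.nonneg t)
      (regSol_neg_sq_nonneg (κ := κ) hV ht.1)) (Real.exp_pos (κ * t)).le
    nlinarith
  beta_reduce at h
  rw [regSol_zero hV, regSol'_zero hV, mul_zero, sub_zero, Real.exp_zero, one_mul] at h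
  have h3 : 0 ≤ regSol' V (-κ ^ 2) y - κ * regSol V (-κ ^ 2) y := by
    refine nonneg_of_mul_nonneg_left ?_ (Real.exp_pos (κ * y))
    rw [h]; linarith
  rw [greenDenom]
  linarith

theorem greenFn_nonneg (hV : IsPotential V) (hκ : 0 < κ) {y s : ℝ} (hy : 0 ≤ y) (hs : 0 ≤ s) :
    0 ≤ greenFn V κ y s := by
  have h1 := one_le_greenDenom hV hκ hy
  have h2 := regSol_neg_sq_nonneg (κ := κ) hV (le_min hs hy)
  unfold greenFn
  positivity

/-- The right side is the free Green's function on the whole line; φ ≤ D/(2κ) and the exponential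
growth of D give the comparison. -/
theorem greenFn_le (hV : IsPotential V) (hκ : 0 < κ) {y s : ℝ} (hy : 0 ≤ y) (hs : 0 ≤ s) :
    greenFn V κ y s ≤ 1 / (2 * κ) * Real.exp (-κ * |s - y|) := by
  have h1 := one_le_greenDenom hV hκ hy
  have hm : 0 ≤ min s y := le_min hs hy
  have h2 := two_mul_regSol_le_greenDenom (κ := κ) hV hm
  have h3 := greenDenom_mul_exp_le (κ := κ) hV hm (min_le_right s y)
  have e : Real.exp (-κ * |s - y|) =
      Real.exp (-κ * (y - min s y)) * Real.exp (-κ * (s - min s y)) := by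
    rw [← Real.exp_add]
    congr 1
    rcases le_total s y with h | h
    · rw [min_eq_left h, abs_of_nonpos (by linarith)]; ring
    · rw [min_eq_right h, abs_of_nonneg (by linarith)]; ring
  rw [greenFn, div_le_iff₀ (by linarith), e]
  have h4 := mul_le_mul_of_nonneg_right (h2.trans h3) (Real.exp_pos (-κ * (s - min s y))).le
  have e2 : 1 / (2 * κ) * (Real.exp (-κ * (y - min s y)) * Real.exp (-κ * (s - min s y))) *
      greenDenom V κ y = greenDenom V κ y * Real.exp (-κ * (y - min s y)) *
      Real.exp (-κ * (s - min s y)) / (2 * κ) := by ring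
  rw [e2, le_div_iff₀ (by positivity)]
  linarith

theorem continuousOn_greenFn (hV : IsPotential V) (hκ : 0 < κ) :
    ContinuousOn (fun p : ℝ × ℝ => greenFn V κ p.1 p.2) (Ici 0 ×ˢ univ) := by
  have h1 := continuous_regSol hV (-κ ^ 2)
  have h2 := continuous_greenDenom (κ := κ) hV
  unfold greenFn
  refine ContinuousOn.div (by fun_prop) (by fun_prop) fun p hp => ?_
  have := one_le_greenDenom hV hκ (y := p.1) hp.1
  linarith

theorem continuous_greenFn (hV : IsPotential V) (y : ℝ) :
    Continuous (greenFn V κ y) := by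
  have h1 := continuous_regSol hV (-κ ^ 2)
  unfold greenFn
  fun_prop

theorem greenFn_of_le {y s : ℝ} (h : s ≤ y) :
    greenFn V κ y s = regSol V (-κ ^ 2) s / greenDenom V κ y := by
  simp [greenFn, min_eq_left h]

theorem greenFn_of_ge {y s : ℝ} (h : y ≤ s) :
    greenFn V κ y s = regSol V (-κ ^ 2) y * Real.exp (-κ * (s - y)) / greenDenom V κ y := by
  simp [greenFn, min_eq_right h]

theorem integrable_exp_neg_mul_abs (hκ : 0 < κ) (y : ℝ) :
    Integrable fun s => Real.exp (-κ * |s - y|) := by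
  have h : Integrable fun s : ℝ => Real.exp (-κ * |s|) := by
    rw [← integrableOn_univ, ← Iic_union_Ioi (a := (0 : ℝ))]
    refine IntegrableOn.union ?_ ?_
    · refine (integrableOn_exp_mul_Iic hκ 0).congr_fun (fun s hs => ?_) measurableSet_Iic
      simp [abs_of_nonpos (show s ≤ 0 from hs)]
    · refine (exp_neg_integrableOn_Ioi 0 hκ).congr_fun (fun s hs => ?_) measurableSet_Ioi
      simp [abs_of_pos (show 0 < s from hs)]
  exact h.comp_sub_right y

theorem integral_exp_neg_mul_abs (hκ : 0 < κ) (y : ℝ) :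
    ∫ s, Real.exp (-κ * |s - y|) = 2 / κ := by
  rw [integral_sub_right_eq_self (fun s => Real.exp (-κ * |s|)) y,
    integral_comp_abs (f := fun s => Real.exp (-κ * s)), integral_exp_mul_Ioi (by linarith)]
  field_simp
  simp

/-- An integral kernel with exponential off-diagonal decay times an `L²` function. -/
theorem integrable_kernel_mul {μ : Measure ℝ} {p : ℝ → ℝ} {f : ℝ → ℂ}
    (hp : AEStronglyMeasurable p μ) (hp2 : Integrable (fun t => p t ^ 2) μ) (hf : MemLp f 2 μ) :
    Integrable (fun t => (p t : ℂ) * f t) μ ∧ ∫ t, ‖(p t : ℂ) * f t‖ ∂μ ≤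
      (∫ t, p t ^ 2 ∂μ) + ∫ t, ‖f t‖ ^ 2 ∂μ := by
  have hf2 : Integrable (fun t => ‖f t‖ ^ 2) μ := hf.integrable_norm_pow two_ne_zero
  have hb : ∀ t, ‖(p t : ℂ) * f t‖ ≤ p t ^ 2 + ‖f t‖ ^ 2 := fun t => by
    rw [norm_mul, Complex.norm_real, Real.norm_eq_abs]
    nlinarith [sq_nonneg (|p t| - ‖f t‖), sq_abs (p t), sq_nonneg (p t), sq_nonneg ‖f t‖]
  have hI : Integrable (fun t => (p t : ℂ) * f t) μ :=
    (hp2.add hf2).mono' ((Complex.continuous_ofReal.comp_aestronglyMeasurable hp).mul hf.1)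
      (Eventually.of_forall hb)
  refine ⟨hI, ?_⟩
  rw [← integral_add hp2 hf2]
  exact integral_mono hI.norm (hp2.add hf2) hb

end Green

/-! ### Averages against the truncated Green's function -/

section Resolvent

variable {V : ℝ → ℝ} {κ : ℝ} {f : ℝ → ℂ}

/-- The integral of the truncated Green's function `G(s, ·)` against `f`. -/
noncomputable def greenAvg (V : ℝ → ℝ) (κ : ℝ) (f : ℝ → ℂ) (s : ℝ) : ℂ :=
  ∫ t in Ioi 0, (greenFn V κ s t : ℂ) * f t

/-- The correction to the free resolvent at energy `-κ²`. -/
noncomputable def greenCorr (V : ℝ → ℝ) (κ : ℝ) (f : ℝ → ℂ) (s : ℝ) : ℂ :=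
  ∫ y in Ioi 0, ((V y * greenFn V κ y s : ℝ) : ℂ) * greenAvg V κ f y

/-- The solution `∫ₛ^∞ exp (-κ (t - s)) f(t) dt` of `J' = κ J - f`. -/
noncomputable def tailExp (κ : ℝ) (f : ℝ → ℂ) (s : ℝ) : ℂ :=
  ((Real.exp (κ * s) : ℝ) : ℂ) * ((∫ t in Ioi 0, ((Real.exp (-κ * t) : ℝ) : ℂ) * f t) -
    ∫ t in (0 : ℝ)..s, ((Real.exp (-κ * t) : ℝ) : ℂ) * f t)

theorem MeasureTheory.MemLp.intervalIntegrable_of_Ioi (hf : MemLp f 2 (volume.restrict (Ioi 0)))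
    {T : ℝ} (hT : 0 ≤ T) : IntervalIntegrable f volume 0 T := by
  rw [intervalIntegrable_iff_integrableOn_Ioc_of_le hT]
  exact (hf.mono_measure (Measure.restrict_mono Ioc_subset_Ioi_self le_rfl)).integrable
    (by norm_num)

theorem IntervalIntegrable.ofReal_mul {p : ℝ → ℝ} {a b : ℝ}
    (hf : IntervalIntegrable f volume a b) (hp : ContinuousOn p (uIcc a b)) :
    IntervalIntegrable (fun t => (p t : ℂ) * f t) volume a b :=
  hf.continuousOn_mul (Complex.continuous_ofReal.comp_continuousOn hp)

theorem integrable_greenFn_sq (hV : IsPotential V) (hκ : 0 < κ) {y : ℝ} (hy : 0 ≤ y) :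
    Integrable (fun t => greenFn V κ y t ^ 2) (volume.restrict (Ioi 0)) := by
  refine ((integrable_exp_neg_mul_abs hκ y).const_mul (1 / (2 * κ) * (1 / (2 * κ)))).restrict.mono'
    ((continuous_greenFn hV y).pow 2).aestronglyMeasurable ?_
  filter_upwards [ae_restrict_mem measurableSet_Ioi] with t ht
  have h0 := greenFn_nonneg hV hκ hy (le_of_lt ht)
  have h1 := greenFn_le hV hκ hy (le_of_lt ht)
  have h2 : Real.exp (-κ * |t - y|) ≤ 1 := Real.exp_le_one_iff.2 (by
    nlinarith [abs_nonneg (t - y)])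
  have h3 : greenFn V κ y t ≤ 1 / (2 * κ) :=
    h1.trans (mul_le_of_le_one_right (by positivity) h2)
  rw [Real.norm_of_nonneg (by positivity), sq, mul_assoc]
  exact mul_le_mul h3 h1 h0 (by positivity)

theorem integral_greenFn_sq_le (hV : IsPotential V) (hκ : 0 < κ) {y : ℝ} (hy : 0 ≤ y) :
    ∫ t in Ioi 0, greenFn V κ y t ^ 2 ≤ 1 / (2 * κ ^ 3) := by
  have hI := (integrable_exp_neg_mul_abs hκ y).const_mul (1 / (2 * κ) * (1 / (2 * κ)))
  have h : ∫ t in Ioi 0, greenFn V κ y t ^ 2 ≤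
      ∫ t in Ioi 0, 1 / (2 * κ) * (1 / (2 * κ)) * Real.exp (-κ * |t - y|) := by
    refine setIntegral_mono_on (integrable_greenFn_sq hV hκ hy) hI.restrict measurableSet_Ioi
      fun t ht => ?_
    have h0 := greenFn_nonneg hV hκ hy (le_of_lt ht)
    have h1 := greenFn_le hV hκ hy (le_of_lt ht)
    have h2 : Real.exp (-κ * |t - y|) ≤ 1 := Real.exp_le_one_iff.2 (by
      nlinarith [abs_nonneg (t - y)])
    have h3 : greenFn V κ y t ≤ 1 / (2 * κ) :=
      h1.trans (mul_le_of_le_one_right (by positivity) h2)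
    rw [sq, mul_assoc]
    exact mul_le_mul h3 h1 h0 (by positivity)
  refine h.trans ((setIntegral_le_integral hI (Eventually.of_forall fun t => ?_)).trans ?_)
  · dsimp only [Pi.zero_apply]; positivity
  · rw [integral_const_mul, integral_exp_neg_mul_abs hκ]
    refine le_of_eq ?_
    field_simp

theorem integrable_greenFn_mul (hV : IsPotential V) (hκ : 0 < κ) {y : ℝ} (hy : 0 ≤ y)
    (hf : MemLp f 2 (volume.restrict (Ioi 0))) :
    IntegrableOn (fun t => (greenFn V κ y t : ℂ) * f t) (Ioi 0) :=
  (integrable_kernel_mul (continuous_greenFn hV y).aestronglyMeasurable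
    (integrable_greenFn_sq hV hκ hy) hf).1

theorem norm_greenAvg_le (hV : IsPotential V) (hκ : 0 < κ) {y : ℝ} (hy : 0 ≤ y)
    (hf : MemLp f 2 (volume.restrict (Ioi 0))) :
    ‖greenAvg V κ f y‖ ≤ 1 / (2 * κ ^ 3) + ∫ t in Ioi 0, ‖f t‖ ^ 2 :=
  (norm_integral_le_integral_norm _).trans ((integrable_kernel_mul
    (continuous_greenFn hV y).aestronglyMeasurable (integrable_greenFn_sq hV hκ hy) hf).2.trans
      (add_le_add_left (integral_greenFn_sq_le hV hκ hy) _))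

theorem integrable_exp_mul (hκ : 0 < κ) (hf : MemLp f 2 (volume.restrict (Ioi 0))) :
    IntegrableOn (fun t => ((Real.exp (-κ * t) : ℝ) : ℂ) * f t) (Ioi 0) := by
  refine (integrable_kernel_mul (p := fun t => Real.exp (-κ * t))
    (by fun_prop : Continuous fun t => Real.exp (-κ * t)).aestronglyMeasurable ?_ hf).1
  refine (exp_neg_integrableOn_Ioi 0 (b := 2 * κ) (by positivity)).congr_fun
    (fun t _ => ?_) measurableSet_Ioi
  beta_reduce
  rw [sq, ← Real.exp_add]; congr 1; ring

theorem setIntegral_Ioi_eq_sub {g : ℝ → ℂ} (hg : IntegrableOn g (Ioi 0)) {s : ℝ} (hs : 0 ≤ s) :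
    ∫ t in Ioi s, g t = (∫ t in Ioi 0, g t) - ∫ t in (0 : ℝ)..s, g t := by
  rw [intervalIntegral.integral_of_le hs, ← Ioc_union_Ioi_eq_Ioi hs,
    setIntegral_union (Ioc_disjoint_Ioi le_rfl) measurableSet_Ioi
      (hg.mono_set Ioc_subset_Ioi_self) (hg.mono_set (Ioi_subset_Ioi hs))]
  ring

theorem greenAvg_eq (hV : IsPotential V) (hκ : 0 < κ) {s : ℝ} (hs : 0 ≤ s)
    (hf : MemLp f 2 (volume.restrict (Ioi 0))) :
    greenAvg V κ f s = ((greenDenom V κ s)⁻¹ : ℝ) *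
      ((∫ t in (0 : ℝ)..s, ((regSol V (-κ ^ 2) t : ℝ) : ℂ) * f t) +
        ((regSol V (-κ ^ 2) s : ℝ) : ℂ) * tailExp κ f s) := by
  have hg := integrable_greenFn_mul hV hκ hs hf
  have h1 := setIntegral_Ioi_eq_sub hg hs
  rw [eq_sub_iff_add_eq] at h1
  rw [greenAvg, ← h1, tailExp, ← setIntegral_Ioi_eq_sub (integrable_exp_mul hκ hf) hs, add_comm,
    mul_add, ← intervalIntegral.integral_const_mul, ← mul_assoc, ← mul_assoc,
    ← integral_const_mul]
  congr 1
  · refine intervalIntegral.integral_congr fun t ht => ?_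
    rw [uIcc_of_le hs] at ht
    rw [greenFn_of_le ht.2]
    push_cast; ring
  · refine setIntegral_congr_fun measurableSet_Ioi fun t ht => ?_
    rw [greenFn_of_ge (le_of_lt ht), show -κ * (t - s) = κ * s + -κ * t by ring, Real.exp_add]
    push_cast; ring

theorem isPrimitiveOn_tailExp (hf : MemLp f 2 (volume.restrict (Ioi 0))) {T : ℝ} (hT : 0 ≤ T) :
    IsPrimitiveOn (tailExp κ f) (fun t => κ * tailExp κ f t - f t) T := by
  have hI : IntervalIntegrable (fun t => ((Real.exp (-κ * t) : ℝ) : ℂ) * f t) volume 0 T :=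
    (hf.intervalIntegrable_of_Ioi hT).ofReal_mul (p := fun t => Real.exp (-κ * t)) (by fun_prop)
  refine ((isPrimitiveOn_exp κ hT).ofReal.mul hT ((IsPrimitiveOn.const _).sub
    (IsPrimitiveOn.integral hI))).congr hT (fun _ _ => rfl) (Eventually.of_forall fun t _ => ?_)
  have e : ((Real.exp (κ * t) : ℝ) : ℂ) * ((Real.exp (-κ * t) : ℝ) : ℂ) = 1 := by
    rw [← Complex.ofReal_mul, ← Real.exp_add]; simp
  simp only [tailExp]
  rw [Complex.ofReal_mul κ]
  linear_combination (f t) * e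

theorem isPrimitiveOn_inv_greenDenom (hV : IsPotential V) (hκ : 0 < κ) {T : ℝ} (hT : 0 ≤ T) :
    IsPrimitiveOn (fun t => (greenDenom V κ t)⁻¹)
      (fun t => -(V t * regSol V (-κ ^ 2) t + κ * greenDenom V κ t) / greenDenom V κ t ^ 2) T := by
  refine ((isPrimitiveOn_greenDenom (κ := κ) hV hT).comp hT (s := Ici 1) (F := fun x => x⁻¹)
    (F' := fun x => -(x ^ 2)⁻¹) (fun x hx => one_le_greenDenom hV hκ hx.1) (fun x hx => ?_)
    ?_).congr hT (fun _ _ => rfl) (Eventually.of_forall fun t _ => ?_)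
  · exact hasDerivAt_inv (by have := mem_Ici.1 hx; linarith)
  · refine ContinuousOn.neg (ContinuousOn.inv₀ (by fun_prop) fun x hx => ?_)
    have := mem_Ici.1 hx
    positivity
  · rw [div_eq_mul_inv]; ring

/-- With a = (∫₀ˢ φf + φJ)/D, where J is `tailExp`, the terms φf cancel, φ' + κφ = D turns the J
terms into J alone, and D' = Vφ + κD supplies the coefficient of a. -/
theorem isPrimitiveOn_greenAvg (hV : IsPotential V) (hκ : 0 < κ)
    (hf : MemLp f 2 (volume.restrict (Ioi 0))) {T : ℝ} (hT : 0 ≤ T) :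
    IsPrimitiveOn (greenAvg V κ f) (fun t => tailExp κ f t -
      (κ + V t * regSol V (-κ ^ 2) t * (greenDenom V κ t)⁻¹ : ℝ) * greenAvg V κ f t) T := by
  have hc := continuous_regSol hV (-κ ^ 2)
  have hI : IntervalIntegrable (fun t => ((regSol V (-κ ^ 2) t : ℝ) : ℂ) * f t) volume 0 T :=
    (hf.intervalIntegrable_of_Ioi hT).ofReal_mul hc.continuousOn
  refine ((isPrimitiveOn_inv_greenDenom hV hκ hT).ofReal.mul hT ((IsPrimitiveOn.integral hI).add
    ((isPrimitiveOn_regSol hV (-κ ^ 2) hT).ofReal.mul hT (isPrimitiveOn_tailExp (κ := κ) hf hT)))).congr hT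
    (fun x hx => greenAvg_eq hV hκ hx.1 hf) (Eventually.of_forall fun t ht => ?_)
  rw [greenAvg_eq hV hκ ht.1.le hf]
  have hD := one_le_greenDenom hV hκ ht.1.le
  have hD0 : (greenDenom V κ t : ℂ) ≠ 0 := by
    exact_mod_cast (by linarith : greenDenom V κ t ≠ 0)
  have e : (greenDenom V κ t : ℂ) = ((regSol' V (-κ ^ 2) t : ℝ) : ℂ) +
      κ * ((regSol V (-κ ^ 2) t : ℝ) : ℂ) := by
    rw [greenDenom]; push_cast; ring
  have e2 : ((regSol' V (-κ ^ 2) t : ℝ) : ℂ) = greenDenom V κ t -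
      κ * ((regSol V (-κ ^ 2) t : ℝ) : ℂ) := by
    rw [e]; ring
  push_cast
  rw [e2]
  field_simp
  ring

theorem continuousOn_greenAvg (hV : IsPotential V) (hκ : 0 < κ)
    (hf : MemLp f 2 (volume.restrict (Ioi 0))) : ContinuousOn (greenAvg V κ f) (Ici 0) := by
  intro x hx
  have h := (isPrimitiveOn_greenAvg hV hκ hf (T := x + 1)
    (by have := mem_Ici.1 hx; linarith)).continuousOn x ⟨hx, by linarith⟩
  refine h.mono_of_mem_nhdsWithin ?_
  rw [mem_nhdsWithin]
  exact ⟨Iio (x + 1), isOpen_Iio, by simp, fun y hy => ⟨hy.2, le_of_lt hy.1⟩⟩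

theorem greenAvg_zero (hV : IsPotential V) :
    greenAvg V κ f 0 = 0 := by
  rw [greenAvg]
  refine (setIntegral_congr_fun measurableSet_Ioi fun t ht => ?_).trans (integral_zero _ _)
  rw [greenFn_of_ge (le_of_lt ht), regSol_zero hV]
  simp

end Resolvent

/-! ### Solving the resolvent equation on the half-line -/

section Resolvent

variable {V : ℝ → ℝ} {κ : ℝ} {f : ℝ → ℂ}

/-- The tail integral of `V a / D`, where `a` is the integral of the truncated Green's function
against `f`. -/
noncomputable def greenTail (V : ℝ → ℝ) (κ : ℝ) (f : ℝ → ℂ) (s : ℝ) : ℂ :=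
  (∫ y in Ioi 0, ((V y * (greenDenom V κ y)⁻¹ : ℝ) : ℂ) * greenAvg V κ f y) -
    ∫ y in (0 : ℝ)..s, ((V y * (greenDenom V κ y)⁻¹ : ℝ) : ℂ) * greenAvg V κ f y

theorem integrable_potential_mul_greenAvg (hV : IsPotential V) (hκ : 0 < κ)
    (hf : MemLp f 2 (volume.restrict (Ioi 0))) {p : ℝ → ℝ} (hp : ContinuousOn p (Ioi 0)) {C : ℝ}
    (hpC : ∀ y, 0 < y → |p y| ≤ C) :
    IntegrableOn (fun y => ((V y * p y : ℝ) : ℂ) * greenAvg V κ f y) (Ioi 0) := by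
  set B := 1 / (2 * κ ^ 3) + ∫ t in Ioi 0, ‖f t‖ ^ 2
  refine (hV.integrable.mul_const (C * B)).restrict.mono' ?_ ?_
  · refine AEStronglyMeasurable.mul ?_ (((continuousOn_greenAvg hV hκ hf).mono
      Ioi_subset_Ici_self).aestronglyMeasurable measurableSet_Ioi)
    exact Complex.continuous_ofReal.comp_aestronglyMeasurable
      (hV.measurable.aestronglyMeasurable.mul (hp.aestronglyMeasurable measurableSet_Ioi))
  · filter_upwards [ae_restrict_mem measurableSet_Ioi] with y hy
    have h1 := norm_greenAvg_le hV hκ (le_of_lt hy) hf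
    have h2 := hpC y hy
    rw [norm_mul, Complex.norm_real, norm_mul, Real.norm_of_nonneg (hV.nonneg y), mul_assoc,
      Real.norm_eq_abs]
    exact mul_le_mul_of_nonneg_left (mul_le_mul h2 h1 (norm_nonneg _)
      ((abs_nonneg _).trans h2)) (hV.nonneg y)

theorem integrable_greenTail (hV : IsPotential V) (hκ : 0 < κ)
    (hf : MemLp f 2 (volume.restrict (Ioi 0))) :
    IntegrableOn (fun y => ((V y * (greenDenom V κ y)⁻¹ : ℝ) : ℂ) * greenAvg V κ f y) (Ioi 0) := by
  refine integrable_potential_mul_greenAvg hV hκ hf (C := 1) ?_ fun y hy => ?_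
  · refine (continuous_greenDenom hV).continuousOn.inv₀ fun y hy => ?_
    have := one_le_greenDenom hV hκ (le_of_lt hy)
    positivity
  · have := one_le_greenDenom hV hκ (le_of_lt hy)
    rw [abs_of_nonneg (by positivity)]
    exact inv_le_one_of_one_le₀ this

theorem continuousOn_greenFn_left (hV : IsPotential V) (hκ : 0 < κ) (s : ℝ) :
    ContinuousOn (fun y => greenFn V κ y s) (Ioi 0) :=
  (continuousOn_greenFn hV hκ).comp (f := fun y : ℝ => (y, s)) (by fun_prop)
    fun _ hy => ⟨mem_Ici.2 (le_of_lt (mem_Ioi.1 hy)), mem_univ _⟩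

theorem abs_greenFn_le (hV : IsPotential V) (hκ : 0 < κ) {y s : ℝ} (hy : 0 ≤ y) (hs : 0 ≤ s) :
    |greenFn V κ y s| ≤ 1 / (2 * κ) := by
  rw [abs_of_nonneg (greenFn_nonneg hV hκ hy hs)]
  refine (greenFn_le hV hκ hy hs).trans (mul_le_of_le_one_right (by positivity) ?_)
  exact Real.exp_le_one_iff.2 (by nlinarith [abs_nonneg (s - y)])

theorem integrable_greenCorr (hV : IsPotential V) (hκ : 0 < κ)
    (hf : MemLp f 2 (volume.restrict (Ioi 0))) {s : ℝ} (hs : 0 ≤ s) :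
    IntegrableOn (fun y => ((V y * greenFn V κ y s : ℝ) : ℂ) * greenAvg V κ f y) (Ioi 0) :=
  integrable_potential_mul_greenAvg hV hκ hf (continuousOn_greenFn_left hV hκ s)
    fun _ hy => abs_greenFn_le hV hκ (le_of_lt hy) hs

theorem intervalIntegrable_of_integrableOn_Ioi {g : ℝ → ℂ} (hg : IntegrableOn g (Ioi 0)) {T : ℝ}
    (hT : 0 ≤ T) : IntervalIntegrable g volume 0 T :=
  (intervalIntegrable_iff_integrableOn_Ioc_of_le hT).2 (hg.mono_set Ioc_subset_Ioi_self)

/-- The Green's function has a different product form for y ≤ s and for y ≥ s; splitting there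
separates the dependence on s from the integrals over y. -/
theorem greenCorr_eq (hV : IsPotential V) (hκ : 0 < κ)
    (hf : MemLp f 2 (volume.restrict (Ioi 0))) {s : ℝ} (hs : 0 ≤ s) :
    greenCorr V κ f s = ((Real.exp (-κ * s) : ℝ) : ℂ) * (∫ y in (0 : ℝ)..s,
        ((Real.exp (κ * y) * (V y * regSol V (-κ ^ 2) y * (greenDenom V κ y)⁻¹) : ℝ) : ℂ) *
          greenAvg V κ f y) +
      ((regSol V (-κ ^ 2) s : ℝ) : ℂ) * greenTail V κ f s := by
  have h1 := setIntegral_Ioi_eq_sub (integrable_greenCorr hV hκ hf hs) hs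
  rw [eq_sub_iff_add_eq] at h1
  rw [greenCorr, ← h1, greenTail, ← setIntegral_Ioi_eq_sub (integrable_greenTail hV hκ hf) hs,
    add_comm, ← intervalIntegral.integral_const_mul, ← integral_const_mul]
  congr 1
  · refine intervalIntegral.integral_congr fun t ht => ?_
    rw [uIcc_of_le hs] at ht
    rw [greenFn_of_ge ht.2, show -κ * (s - t) = -κ * s + κ * t by ring, Real.exp_add]
    push_cast; ring
  · refine setIntegral_congr_fun measurableSet_Ioi fun t ht => ?_
    rw [greenFn_of_le (le_of_lt ht)]
    push_cast; ring

/-- The difference b of the averages for 0 and for V solves b' = -κb + (Vφ/D) a with b(0) = 0, where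
a is the average for V. The resulting integral is exactly the y < s part of `greenCorr`. -/
theorem greenAvg_free_eq (hV : IsPotential V) (hκ : 0 < κ)
    (hf : MemLp f 2 (volume.restrict (Ioi 0))) {s : ℝ} (hs : 0 ≤ s) :
    greenAvg 0 κ f s = greenAvg V κ f s + ((Real.exp (-κ * s) : ℝ) : ℂ) * (∫ y in (0 : ℝ)..s,
        ((Real.exp (κ * y) * (V y * regSol V (-κ ^ 2) y * (greenDenom V κ y)⁻¹) : ℝ) : ℂ) *
          greenAvg V κ f y) := by
  have h := ((isPrimitiveOn_exp κ hs).ofReal.mul hs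
    ((isPrimitiveOn_greenAvg IsPotential.zero hκ hf hs).sub
      (isPrimitiveOn_greenAvg hV hκ hf hs))).2 s ⟨hs, le_rfl⟩
  beta_reduce at h
  rw [greenAvg_zero hV, greenAvg_zero IsPotential.zero, sub_zero, mul_zero, zero_add] at h
  have e : ((Real.exp (-κ * s) : ℝ) : ℂ) * ((Real.exp (κ * s) : ℝ) : ℂ) = 1 := by
    rw [← Complex.ofReal_mul, ← Real.exp_add]; simp
  have e2 : ∀ x : ℂ, x = ((Real.exp (-κ * s) : ℝ) : ℂ) * (((Real.exp (κ * s) : ℝ) : ℂ) * x) :=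
    fun x => by rw [← mul_assoc, e, one_mul]
  rw [← sub_eq_iff_eq_add', e2 (_ - _), h]
  congr 1
  refine intervalIntegral.integral_congr fun t _ => ?_
  simp only [Pi.zero_apply]
  push_cast
  ring

/-- The solution `u` of `-u'' + V u + κ² u = f` on the half-line with `u(0) = 0`. -/
noncomputable def resolventFn (V : ℝ → ℝ) (κ : ℝ) (f : ℝ → ℂ) (s : ℝ) : ℂ :=
  greenAvg 0 κ f s - greenCorr V κ f s

/-- The y < s part of the correction cancels, leaving a - φK with K the tail integral of Va/D. This
form is easy to differentiate. -/
theorem resolventFn_eq (hV : IsPotential V) (hκ : 0 < κ)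
    (hf : MemLp f 2 (volume.restrict (Ioi 0))) {s : ℝ} (hs : 0 ≤ s) :
    resolventFn V κ f s =
      greenAvg V κ f s - ((regSol V (-κ ^ 2) s : ℝ) : ℂ) * greenTail V κ f s := by
  rw [resolventFn, greenAvg_free_eq hV hκ hf hs, greenCorr_eq hV hκ hf hs]
  ring

theorem isDirichletSolution_of_isPrimitiveOn {W : ℝ → ℝ} {u v g : ℝ → ℂ} (h0 : u 0 = 0)
    (h : ∀ T, 0 ≤ T → IsPrimitiveOn u v T ∧
      IsPrimitiveOn v (fun t => (W t : ℂ) * u t - g t) T) :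
    IsDirichletSolution W (Ioi 0) u v g := by
  refine ⟨fun x hx => ?_, fun x hx => ?_, fun x hx => ?_, fun x hx => ?_, fun x hx => ?_⟩
  · rw [frontier_Ioi, mem_singleton_iff] at hx
    rw [hx, h0]
  all_goals rw [closure_Ioi, mem_Ici] at hx
  · exact (h x hx).1.1
  · rw [(h x hx).1.2 x ⟨hx, le_rfl⟩, h0, zero_add]
  · exact (h x hx).2.1
  · exact (h x hx).2.2 x ⟨hx, le_rfl⟩

/-- With u = a - φK, K' = -Va/D, the potential terms cancel in u' = J - κa - φ'K. Differentiating
once more and using φ' + κφ = D gives u'' = (V + κ²) u - f. -/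
theorem isDirichletSolution_resolventFn (hV : IsPotential V) (hκ : 0 < κ)
    (hf : MemLp f 2 (volume.restrict (Ioi 0))) :
    IsDirichletSolution V (Ioi 0) (resolventFn V κ f)
      (fun s => tailExp κ f s - κ * greenAvg V κ f s -
        ((regSol' V (-κ ^ 2) s : ℝ) : ℂ) * greenTail V κ f s)
      (fun s => f s - ((κ ^ 2 : ℝ) : ℂ) * resolventFn V κ f s) := by
  have hne : ∀ t, 0 ≤ t → (greenDenom V κ t : ℂ) ≠ 0 := fun t ht => by
    have := one_le_greenDenom hV hκ ht
    exact_mod_cast (by linarith : greenDenom V κ t ≠ 0)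
  have hD : ∀ t, (greenDenom V κ t : ℂ) =
      ((regSol' V (-κ ^ 2) t : ℝ) : ℂ) + κ * ((regSol V (-κ ^ 2) t : ℝ) : ℂ) := fun t => by
    rw [greenDenom]; push_cast; ring
  have hK : ∀ T, 0 ≤ T → IsPrimitiveOn (greenTail V κ f)
      (fun y => 0 - ((V y * (greenDenom V κ y)⁻¹ : ℝ) : ℂ) * greenAvg V κ f y) T := fun T hT =>
    (IsPrimitiveOn.const _).sub (IsPrimitiveOn.integral
      (intervalIntegrable_of_integrableOn_Ioi (integrable_greenTail hV hκ hf) hT))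
  refine isDirichletSolution_of_isPrimitiveOn ?_ fun T hT => ⟨?_, ?_⟩
  · rw [resolventFn_eq hV hκ hf le_rfl, greenAvg_zero hV, regSol_zero hV]
    simp
  · refine ((isPrimitiveOn_greenAvg hV hκ hf hT).sub ((isPrimitiveOn_regSol hV
      (-κ ^ 2) hT).ofReal.mul hT (hK T hT))).congr hT
      (fun x hx => resolventFn_eq hV hκ hf hx.1) (Eventually.of_forall fun t ht => ?_)
    push_cast
    ring
  · refine (((isPrimitiveOn_tailExp (κ := κ) hf hT).sub ((IsPrimitiveOn.const (κ : ℂ)).mul hT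
      (isPrimitiveOn_greenAvg hV hκ hf hT))).sub ((isPrimitiveOn_regSol' hV
      (-κ ^ 2) hT).ofReal.mul hT (hK T hT))).congr hT
      (fun x hx => rfl) (Eventually.of_forall fun t ht => ?_)
    rw [resolventFn_eq hV hκ hf ht.1.le]
    have h1 := hne t ht.1.le
    have e : ((regSol' V (-κ ^ 2) t : ℝ) : ℂ) = (greenDenom V κ t : ℂ) -
        κ * ((regSol V (-κ ^ 2) t : ℝ) : ℂ) := by rw [hD]; ring
    simp only [smul_eq_mul]
    push_cast
    rw [e]
    field_simp
    ring

end Resolvent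

/-! ### Boundedness of the integral operators -/

section Operators

theorem norm_sq_eq_integral {I : Set ℝ} (f : L2 I) :
    ‖f‖ ^ 2 = ∫ t in I, ‖f t‖ ^ 2 := by
  have h := @inner_self_eq_norm_sq_to_K ℂ (L2 I) _ _ _ f
  rw [MeasureTheory.L2.inner_def] at h
  have h2 : ∀ t, inner ℂ (f t) (f t) = ((‖f t‖ ^ 2 : ℝ) : ℂ) := fun t => by
    rw [inner_self_eq_norm_sq_to_K]; norm_cast
  simp_rw [h2] at h
  rw [integral_complex_ofReal] at h
  have h3 : ((∫ t in I, ‖f t‖ ^ 2 : ℝ) : ℂ) = ((‖f‖ ^ 2 : ℝ) : ℂ) := by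
    rw [h]; norm_cast
  exact (Complex.ofReal_injective h3).symm

/-- A linear integral transform that is bounded on the unit ball defines a bounded operator. -/
theorem exists_clm_of_bound {I : Set ℝ} (Φ : L2 I → ℝ → ℂ)
    (hmem : ∀ f, MemLp (Φ f) 2 (volume.restrict I))
    (hadd : ∀ f g, Φ (f + g) =ᵐ[volume.restrict I] Φ f + Φ g)
    (hsmul : ∀ (c : ℂ) f, Φ (c • f) =ᵐ[volume.restrict I] c • Φ f) {C : ℝ}
    (hC : ∀ f, ‖f‖ ≤ 1 → ∫ t in I, ‖Φ f t‖ ^ 2 ≤ C) :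
    ∃ R : L2 I →L[ℂ] L2 I, ∀ f, R f =ᵐ[volume.restrict I] Φ f := by
  have hcoe : ∀ f, ((hmem f).toLp (Φ f)) =ᵐ[volume.restrict I] Φ f := fun f => (hmem f).coeFn_toLp
  let R : L2 I →ₗ[ℂ] L2 I :=
    { toFun := fun f => (hmem f).toLp (Φ f)
      map_add' := fun f g => by
        refine Lp.ext ?_
        filter_upwards [hcoe (f + g), hcoe f, hcoe g, hadd f g,
          Lp.coeFn_add ((hmem f).toLp (Φ f)) ((hmem g).toLp (Φ g))] with t h1 h2 h3 h4 h5
        rw [h1, h5, h4, Pi.add_apply, Pi.add_apply, h2, h3]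
      map_smul' := fun c f => by
        refine Lp.ext ?_
        filter_upwards [hcoe (c • f), hcoe f, hsmul c f,
          Lp.coeFn_smul c ((hmem f).toLp (Φ f))] with t h1 h2 h3 h4
        rw [h1, RingHom.id_apply, h4, h3, Pi.smul_apply, Pi.smul_apply, h2] }
  have hball : ∀ f, ‖f‖ ≤ 1 → ‖R f‖ ≤ √C := fun f hf => by
    refine Real.le_sqrt_of_sq_le ?_
    rw [norm_sq_eq_integral]
    refine (le_of_eq (integral_congr_ae ?_)).trans (hC f hf)
    filter_upwards [hcoe f] with t ht
    change ‖(hmem f).toLp (Φ f) t‖ ^ 2 = _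
    rw [ht]
  refine ⟨R.mkContinuous (√C) fun f => ?_, fun f => hcoe f⟩
  rcases eq_or_ne f 0 with rfl | hf
  · simp
  · have hn : 0 < ‖f‖ := norm_pos_iff.2 hf
    -- Normalizing f makes a bound on the unit ball enough; the kernel estimates need not be
    -- homogeneous in f.
    have h := hball (((‖f‖⁻¹ : ℝ) : ℂ) • f) (by
      rw [norm_smul, Complex.norm_real, norm_inv, norm_norm, inv_mul_cancel₀ hn.ne'])
    rw [map_smul, norm_smul, Complex.norm_real, norm_inv, norm_norm, inv_mul_le_iff₀ hn] at h
    linarith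

variable {V : ℝ → ℝ} {κ : ℝ}

theorem integrable_mul_exp_neg_abs_sub (hκ : 0 < κ) {h : ℝ → ℝ}
    (hh : Integrable h (volume.restrict (Ioi 0))) :
    Integrable (fun p : ℝ × ℝ => h p.2 * Real.exp (-κ * |p.1 - p.2|))
      (volume.prod (volume.restrict (Ioi 0))) := by
  have := Integrable.convolution_integrand (μ := volume) (ContinuousLinearMap.mul ℝ ℝ) hh
    (by simpa using integrable_exp_neg_mul_abs hκ 0 :
      Integrable fun s : ℝ => Real.exp (-κ * |s|))
  simpa using this

theorem integral_integral_mul_exp_neg_abs_sub (hκ : 0 < κ) {h : ℝ → ℝ}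
    (hh : Integrable h (volume.restrict (Ioi 0))) :
    ∫ s, ∫ t in Ioi 0, h t * Real.exp (-κ * |s - t|) = 2 / κ * ∫ t in Ioi 0, h t := by
  have h1 := integrable_mul_exp_neg_abs_sub hκ hh
  rw [← integral_prod _ h1, integral_prod_symm _ h1, ← integral_const_mul]
  refine integral_congr_ae (Eventually.of_forall fun t => ?_)
  dsimp only
  rw [integral_const_mul, integral_exp_neg_mul_abs hκ, mul_comm]

/-- Expand ∫ p (F - m)² ≥ 0 at m = (∫ pF)/P. -/
theorem sq_integral_mul_le {μ : Measure ℝ} {p F : ℝ → ℝ} {P : ℝ} (hP : 0 < P)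
    (hp0 : 0 ≤ᵐ[μ] p) (hp : Integrable p μ) (hpF : Integrable (fun t => p t * F t) μ)
    (hpF2 : Integrable (fun t => p t * F t ^ 2) μ) (hpP : ∫ t, p t ∂μ ≤ P) :
    (∫ t, p t * F t ∂μ) ^ 2 ≤ P * ∫ t, p t * F t ^ 2 ∂μ := by
  set x := ∫ t, p t * F t ∂μ
  set m := x / P
  have h : 0 ≤ ∫ t, p t * (F t - m) ^ 2 ∂μ := integral_nonneg_of_ae (by
    filter_upwards [hp0] with t ht
    exact mul_nonneg ht (sq_nonneg _))
  have e : ∫ t, p t * (F t - m) ^ 2 ∂μ =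
      (∫ t, p t * F t ^ 2 ∂μ) - 2 * m * x + m ^ 2 * ∫ t, p t ∂μ := by
    have hd : Integrable (fun t => p t * F t ^ 2 - 2 * m * (p t * F t)) μ :=
      hpF2.sub (hpF.const_mul _)
    rw [← integral_const_mul, ← integral_const_mul, ← integral_sub hpF2 (hpF.const_mul _),
      ← integral_add hd (hp.const_mul _)]
    exact integral_congr_ae (Eventually.of_forall fun t => by ring)
  rw [e] at h
  have h2 : m * P = x := div_mul_cancel₀ x hP.ne'
  have h3 : m ^ 2 * ∫ t, p t ∂μ ≤ m ^ 2 * P := mul_le_mul_of_nonneg_left hpP (sq_nonneg m)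
  have h4 : m * x ≤ ∫ t, p t * F t ^ 2 ∂μ := by
    have : m ^ 2 * P = m * x := by rw [← h2]; ring
    linarith
  calc x ^ 2 = P * (m * x) := by rw [← h2]; ring
    _ ≤ _ := mul_le_mul_of_nonneg_left h4 hP.le

/-- Weighted Cauchy–Schwarz with the kernel (1/2κ) exp(-κ|t - s|), of mass at most 1/κ². Integrated
over s, this is Schur's test. -/
theorem norm_greenAvg_sq_le (hV : IsPotential V) (hκ : 0 < κ) {f : ℝ → ℂ}
    (hf : MemLp f 2 (volume.restrict (Ioi 0))) {s : ℝ} (hs : 0 ≤ s) :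
    ‖greenAvg V κ f s‖ ^ 2 ≤
      1 / (2 * κ ^ 3) * ∫ t in Ioi 0, ‖f t‖ ^ 2 * Real.exp (-κ * |s - t|) := by
  have hF2 : Integrable (fun t => ‖f t‖ ^ 2) (volume.restrict (Ioi 0)) :=
    hf.integrable_norm_pow two_ne_zero
  have hk := integrable_exp_neg_mul_abs hκ s
  have hp : Integrable (fun t => 1 / (2 * κ) * Real.exp (-κ * |t - s|))
    (volume.restrict (Ioi 0)) := (hk.const_mul _).restrict
  have hp0 : ∀ t, 0 ≤ 1 / (2 * κ) * Real.exp (-κ * |t - s|) := fun t => by positivity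
  have hb : ∀ t, 1 / (2 * κ) * Real.exp (-κ * |t - s|) ≤ 1 / (2 * κ) := fun t =>
    mul_le_of_le_one_right (by positivity) (Real.exp_le_one_iff.2 (by nlinarith [abs_nonneg (t - s)]))
  have hc : Continuous fun t => 1 / (2 * κ) * Real.exp (-κ * |t - s|) := by fun_prop
  have hpF2 : Integrable (fun t => 1 / (2 * κ) * Real.exp (-κ * |t - s|) * ‖f t‖ ^ 2)
      (volume.restrict (Ioi 0)) := by
    refine (hF2.const_mul (1 / (2 * κ))).mono' (hc.aestronglyMeasurable.mul hF2.1)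
      (Eventually.of_forall fun t => ?_)
    rw [Real.norm_of_nonneg (mul_nonneg (hp0 t) (sq_nonneg _))]
    exact mul_le_mul_of_nonneg_right (hb t) (sq_nonneg _)
  have hpF : Integrable (fun t => 1 / (2 * κ) * Real.exp (-κ * |t - s|) * ‖f t‖)
      (volume.restrict (Ioi 0)) := by
    refine (hp.add hpF2).mono' (hc.aestronglyMeasurable.mul hf.1.norm)
      (Eventually.of_forall fun t => ?_)
    rw [Real.norm_of_nonneg (mul_nonneg (hp0 t) (norm_nonneg _)), Pi.add_apply]
    nlinarith [hp0 t, sq_nonneg (‖f t‖ - 1), norm_nonneg (f t)]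
  have hP : ∫ t in Ioi 0, 1 / (2 * κ) * Real.exp (-κ * |t - s|) ≤ 1 / κ ^ 2 := by
    refine (setIntegral_le_integral (hk.const_mul _) (Eventually.of_forall hp0)).trans ?_
    rw [integral_const_mul, integral_exp_neg_mul_abs hκ]
    refine le_of_eq ?_
    field_simp
  have h1 : ‖greenAvg V κ f s‖ ≤ ∫ t in Ioi 0, 1 / (2 * κ) * Real.exp (-κ * |t - s|) * ‖f t‖ := by
    refine norm_integral_le_of_norm_le hpF ?_
    filter_upwards [ae_restrict_mem measurableSet_Ioi] with t ht
    rw [norm_mul, Complex.norm_real, Real.norm_of_nonneg (greenFn_nonneg hV hκ hs (le_of_lt ht))]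
    exact mul_le_mul_of_nonneg_right (greenFn_le hV hκ hs (le_of_lt ht)) (norm_nonneg _)
  refine (pow_le_pow_left₀ (norm_nonneg _) h1 2).trans ((sq_integral_mul_le (by positivity)
    (Eventually.of_forall hp0) hp hpF hpF2 hP).trans (le_of_eq ?_))
  rw [← integral_const_mul, ← integral_const_mul]
  refine integral_congr_ae (Eventually.of_forall fun t => ?_)
  beta_reduce
  rw [abs_sub_comm]
  field_simp

theorem greenAvg_congr {f g : ℝ → ℂ} (h : f =ᵐ[volume.restrict (Ioi 0)] g) (s : ℝ) :
    greenAvg V κ f s = greenAvg V κ g s :=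
  integral_congr_ae (by filter_upwards [h] with t ht; rw [ht])

theorem greenAvg_add (hV : IsPotential V) (hκ : 0 < κ) (f g : L2 (Ioi 0)) {s : ℝ} (hs : 0 ≤ s) :
    greenAvg V κ (f + g : L2 (Ioi 0)) s = greenAvg V κ f s + greenAvg V κ g s := by
  rw [greenAvg_congr (Lp.coeFn_add f g), greenAvg, greenAvg, greenAvg,
    ← integral_add (integrable_greenFn_mul hV hκ hs (Lp.memLp f))
    (integrable_greenFn_mul hV hκ hs (Lp.memLp g))]
  exact integral_congr_ae (Eventually.of_forall fun t => by
    simp only [Pi.add_apply]; ring)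

theorem greenAvg_smul (c : ℂ) (f : L2 (Ioi 0)) (s : ℝ) :
    greenAvg V κ (c • f : L2 (Ioi 0)) s = c * greenAvg V κ f s := by
  rw [greenAvg_congr (Lp.coeFn_smul c f), greenAvg, greenAvg, ← integral_const_mul]
  exact integral_congr_ae (Eventually.of_forall fun t => by
    simp only [Pi.smul_apply, smul_eq_mul]; ring)

theorem greenCorr_add (hV : IsPotential V) (hκ : 0 < κ) (f g : L2 (Ioi 0)) {s : ℝ}
    (hs : 0 ≤ s) :
    greenCorr V κ (f + g : L2 (Ioi 0)) s = greenCorr V κ f s + greenCorr V κ g s := by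
  rw [greenCorr, greenCorr, greenCorr, ← integral_add (integrable_greenCorr hV hκ (Lp.memLp f) hs)
    (integrable_greenCorr hV hκ (Lp.memLp g) hs)]
  refine setIntegral_congr_fun measurableSet_Ioi fun y hy => ?_
  rw [greenAvg_add hV hκ f g (le_of_lt hy), mul_add]

theorem greenCorr_smul (c : ℂ) (f : L2 (Ioi 0)) (s : ℝ) :
    greenCorr V κ (c • f : L2 (Ioi 0)) s = c * greenCorr V κ f s := by
  rw [greenCorr, greenCorr, ← integral_const_mul]
  refine integral_congr_ae (Eventually.of_forall fun y => ?_)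
  beta_reduce
  rw [greenAvg_smul]
  ring

theorem integral_norm_sq_le_one {f : L2 (Ioi 0)} (hf : ‖f‖ ≤ 1) :
    ∫ t in Ioi 0, ‖f t‖ ^ 2 ≤ 1 := by
  rw [← norm_sq_eq_integral]
  exact pow_le_one₀ (norm_nonneg _) hf

/-- For the zero potential this operator is the free resolvent. -/
theorem exists_greenAvg_clm (hV : IsPotential V) (hκ : 0 < κ) :
    ∃ R : L2 (Ioi 0) →L[ℂ] L2 (Ioi 0), ∀ f : L2 (Ioi 0),
      R f =ᵐ[volume.restrict (Ioi 0)] greenAvg V κ f := by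
  have hF2 : ∀ f : L2 (Ioi 0), Integrable (fun t => ‖f t‖ ^ 2) (volume.restrict (Ioi 0)) :=
    fun f => (Lp.memLp f).integrable_norm_pow two_ne_zero
  have hm : ∀ f : L2 (Ioi 0),
      AEStronglyMeasurable (greenAvg V κ f) (volume.restrict (Ioi 0)) := fun f =>
    ((continuousOn_greenAvg hV hκ (Lp.memLp f)).mono Ioi_subset_Ici_self).aestronglyMeasurable
      measurableSet_Ioi
  have hH : ∀ f : L2 (Ioi 0), Integrable fun s =>
      1 / (2 * κ ^ 3) * ∫ t in Ioi 0, ‖f t‖ ^ 2 * Real.exp (-κ * |s - t|) := fun f =>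
    (integrable_mul_exp_neg_abs_sub hκ (hF2 f)).integral_prod_left.const_mul _
  have hI : ∀ f : L2 (Ioi 0),
      Integrable (fun s => ‖greenAvg V κ f s‖ ^ 2) (volume.restrict (Ioi 0)) := fun f => by
    refine (hH f).restrict.mono' ((hm f).norm.pow 2) ?_
    filter_upwards [ae_restrict_mem measurableSet_Ioi] with s hs
    rw [Real.norm_of_nonneg (by positivity)]
    exact norm_greenAvg_sq_le hV hκ (Lp.memLp f) (le_of_lt hs)
  refine exists_clm_of_bound (fun f => greenAvg V κ f) (C := 1 / (2 * κ ^ 3) * (2 / κ))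
    (fun f => (memLp_two_iff_integrable_sq_norm (hm f)).2 (hI f)) (fun f g => ?_) (fun c f => ?_)
    fun f hf => ?_
  · filter_upwards [ae_restrict_mem measurableSet_Ioi] with s hs
    exact greenAvg_add hV hκ f g (le_of_lt hs)
  · exact Eventually.of_forall fun s => greenAvg_smul c f s
  · have h1 : ∫ s in Ioi 0, ‖greenAvg V κ f s‖ ^ 2 ≤ ∫ s in Ioi 0,
        1 / (2 * κ ^ 3) * ∫ t in Ioi 0, ‖f t‖ ^ 2 * Real.exp (-κ * |s - t|) :=
      setIntegral_mono_on (hI f) (hH f).restrict measurableSet_Ioi fun s hs =>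
        norm_greenAvg_sq_le hV hκ (Lp.memLp f) (le_of_lt hs)
    refine h1.trans ((setIntegral_le_integral (hH f) (Eventually.of_forall fun s => ?_)).trans ?_)
    · exact mul_nonneg (by positivity) (integral_nonneg fun t => by positivity)
    · rw [integral_const_mul, integral_integral_mul_exp_neg_abs_sub hκ (hF2 f)]
      have := integral_norm_sq_le_one hf
      refine mul_le_mul_of_nonneg_left ?_ (by positivity)
      exact mul_le_of_le_one_right (by positivity) this

theorem norm_greenCorr_le (hV : IsPotential V) (hκ : 0 < κ) {f : ℝ → ℂ}
    (hf : MemLp f 2 (volume.restrict (Ioi 0))) {s : ℝ} (hs : 0 ≤ s) :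
    ‖greenCorr V κ f s‖ ≤ (1 / (2 * κ ^ 3) + ∫ t in Ioi 0, ‖f t‖ ^ 2) / (2 * κ) *
      ∫ y in Ioi 0, V y * Real.exp (-κ * |s - y|) := by
  rw [← integral_const_mul]
  refine norm_integral_le_of_norm_le ?_ ?_
  · refine Integrable.const_mul ?_ _
    refine hV.integrable.restrict.mono' (hV.measurable.aestronglyMeasurable.mul
      (by fun_prop : Continuous fun y => Real.exp (-κ * |s - y|)).aestronglyMeasurable)
      (Eventually.of_forall fun y => ?_)
    rw [Real.norm_of_nonneg (mul_nonneg (hV.nonneg y) (Real.exp_pos _).le)]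
    exact mul_le_of_le_one_right (hV.nonneg y) (Real.exp_le_one_iff.2 (by
      nlinarith [abs_nonneg (s - y)]))
  · filter_upwards [ae_restrict_mem measurableSet_Ioi] with y hy
    have h0 := greenFn_nonneg hV hκ (le_of_lt hy) hs
    have h1 := greenFn_le hV hκ (le_of_lt hy) hs
    have h2 := norm_greenAvg_le hV hκ (le_of_lt hy) hf
    rw [norm_mul, Complex.norm_real, Real.norm_of_nonneg (mul_nonneg (hV.nonneg y) h0)]
    calc V y * greenFn V κ y s * ‖greenAvg V κ f y‖
        ≤ V y * (1 / (2 * κ) * Real.exp (-κ * |s - y|)) *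
          (1 / (2 * κ ^ 3) + ∫ t in Ioi 0, ‖f t‖ ^ 2) := by
          refine mul_le_mul (mul_le_mul_of_nonneg_left h1 (hV.nonneg y)) h2 (norm_nonneg _) ?_
          exact mul_nonneg (hV.nonneg y) (by positivity)
      _ = _ := by ring

end Operators

/-! ### Identification of the resolvents -/

section Resolvent

variable {V : ℝ → ℝ} {κ : ℝ}

theorem IsDirichletSolution.isPrimitiveOn {W : ℝ → ℝ} {u v g : ℝ → ℂ}
    (h : IsDirichletSolution W (Ioi 0) u v g) : u 0 = 0 ∧ ∀ T, 0 ≤ T → IsPrimitiveOn u v T ∧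
      IsPrimitiveOn v (fun t => (W t : ℂ) * u t - g t) T := by
  have hc : ∀ x : ℝ, 0 ≤ x → x ∈ closure (Ioi (0 : ℝ)) := fun x hx => by
    rwa [closure_Ioi]
  have h0 : u 0 = 0 := h.boundary 0 (by simp)
  refine ⟨h0, fun T hT => ⟨⟨h.integrable_deriv T (hc T hT), fun x hx => ?_⟩,
    ⟨h.integrable_second T (hc T hT), fun x hx => h.deriv_eq_integral x (hc x hx.1)⟩⟩⟩
  rw [h.eq_integral x (hc x hx.1), h0, zero_add]

theorem continuousOn_Ici_of_continuousOn_Icc {E : Type*} [TopologicalSpace E] {u : ℝ → E}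
    (h : ∀ T, 0 ≤ T → ContinuousOn u (Icc 0 T)) : ContinuousOn u (Ici 0) := by
  intro x hx
  have hx' := mem_Ici.1 hx
  refine (h (x + 1) (by linarith) x ⟨hx, by linarith⟩).mono_of_mem_nhdsWithin ?_
  rw [mem_nhdsWithin]
  exact ⟨Iio (x + 1), isOpen_Iio, by simp, fun y hy => ⟨hy.2, le_of_lt hy.1⟩⟩

theorem continuousOn_greenCorr (hV : IsPotential V) (hκ : 0 < κ) {f : ℝ → ℂ}
    (hf : MemLp f 2 (volume.restrict (Ioi 0))) : ContinuousOn (greenCorr V κ f) (Ici 0) := by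
  have h1 : ContinuousOn (resolventFn V κ f) (Ici 0) := continuousOn_Ici_of_continuousOn_Icc
    fun T hT => ((isDirichletSolution_resolventFn hV hκ hf).isPrimitiveOn.2 T hT).1.continuousOn
  refine ((continuousOn_greenAvg IsPotential.zero hκ hf).sub h1).congr fun s _ => ?_
  change greenCorr V κ f s = greenAvg 0 κ f s - resolventFn V κ f s
  rw [resolventFn]
  ring

/-- The correction is pointwise at most a constant times the average w of V against an exponential
kernel; w is integrable and bounded, hence square integrable. -/
theorem exists_greenCorr_clm (hV : IsPotential V) (hκ : 0 < κ) :
    ∃ S : L2 (Ioi 0) →L[ℂ] L2 (Ioi 0), ∀ f : L2 (Ioi 0),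
      S f =ᵐ[volume.restrict (Ioi 0)] greenCorr V κ f := by
  set w : ℝ → ℝ := fun s => ∫ y in Ioi 0, V y * Real.exp (-κ * |s - y|)
  have hw : Integrable w :=
    (integrable_mul_exp_neg_abs_sub hκ hV.integrable.restrict).integral_prod_left
  have hw0 : ∀ s, 0 ≤ w s := fun s =>
    integral_nonneg fun y => mul_nonneg (hV.nonneg y) (Real.exp_pos _).le
  have hwb : ∀ s, w s ≤ ∫ y in Ioi 0, V y := fun s => by
    refine integral_mono_of_nonneg (Eventually.of_forall fun y =>
      mul_nonneg (hV.nonneg y) (Real.exp_pos _).le) hV.integrable.restrict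
      (Eventually.of_forall fun y => ?_)
    exact mul_le_of_le_one_right (hV.nonneg y) (Real.exp_le_one_iff.2 (by
      nlinarith [abs_nonneg (s - y)]))
  have hw2 : Integrable fun s => w s ^ 2 := by
    refine (hw.const_mul (∫ y in Ioi 0, V y)).mono' (hw.1.pow 2) (Eventually.of_forall fun s => ?_)
    rw [Real.norm_of_nonneg (sq_nonneg _), sq]
    exact mul_le_mul_of_nonneg_right (hwb s) (hw0 s)
  have hm : ∀ f : L2 (Ioi 0),
      AEStronglyMeasurable (greenCorr V κ f) (volume.restrict (Ioi 0)) := fun f =>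
    ((continuousOn_greenCorr hV hκ (Lp.memLp f)).mono Ioi_subset_Ici_self).aestronglyMeasurable
      measurableSet_Ioi
  have hb : ∀ (f : L2 (Ioi 0)) (s : ℝ), 0 < s → ‖greenCorr V κ f s‖ ^ 2 ≤
      ((1 / (2 * κ ^ 3) + ∫ t in Ioi 0, ‖f t‖ ^ 2) / (2 * κ)) ^ 2 * w s ^ 2 := fun f s hs => by
    rw [← mul_pow]
    exact pow_le_pow_left₀ (norm_nonneg _) (norm_greenCorr_le hV hκ (Lp.memLp f) hs.le) 2
  have hI : ∀ f : L2 (Ioi 0),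
      Integrable (fun s => ‖greenCorr V κ f s‖ ^ 2) (volume.restrict (Ioi 0)) := fun f => by
    refine (hw2.const_mul (((1 / (2 * κ ^ 3) + ∫ t in Ioi 0, ‖f t‖ ^ 2) /
      (2 * κ)) ^ 2)).restrict.mono' ((hm f).norm.pow 2) ?_
    filter_upwards [ae_restrict_mem measurableSet_Ioi] with s hs
    rw [Real.norm_of_nonneg (by positivity)]
    exact hb f s hs
  refine exists_clm_of_bound (fun f => greenCorr V κ f)
    (C := ((1 / (2 * κ ^ 3) + 1) / (2 * κ)) ^ 2 * ∫ s in Ioi 0, w s ^ 2)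
    (fun f => (memLp_two_iff_integrable_sq_norm (hm f)).2 (hI f)) (fun f g => ?_) (fun c f => ?_)
    fun f hf => ?_
  · filter_upwards [ae_restrict_mem measurableSet_Ioi] with s hs
    exact greenCorr_add hV hκ f g (le_of_lt hs)
  · exact Eventually.of_forall fun s => greenCorr_smul c f s
  · rw [← integral_const_mul]
    refine setIntegral_mono_on (hI f) (hw2.const_mul _).restrict measurableSet_Ioi fun s hs =>
      (hb f s hs).trans ?_
    have h1 := integral_norm_sq_le_one hf
    have h2 : 0 ≤ ∫ t in Ioi 0, ‖f t‖ ^ 2 := integral_nonneg fun t => sq_nonneg _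
    refine mul_le_mul_of_nonneg_right (pow_le_pow_left₀ (by positivity) ?_ 2) (sq_nonneg _)
    gcongr

/-- The equation `-u'' + V u = -κ² u` has no nonzero square integrable Dirichlet solution. -/
theorem eq_zero_of_mem_dirichletOperator (hV : IsPotential V) {w : L2 (Ioi 0)}
    (h : (w, -((κ ^ 2 : ℝ) : ℂ) • w) ∈ dirichletOperator V (Ioi 0)) : w = 0 := by
  obtain ⟨u, v, g, hu, hg, hs⟩ := h
  obtain ⟨h0, hp⟩ := hs.isPrimitiveOn
  dsimp only at hu hg
  have hgu : ∀ᵐ t, t ∈ Ioi (0 : ℝ) → g t = -((κ ^ 2 : ℝ) : ℂ) * u t := by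
    rw [← ae_restrict_iff' measurableSet_Ioi]
    filter_upwards [hu, hg, Lp.coeFn_smul (-((κ ^ 2 : ℝ) : ℂ)) w] with t h1 h2 h3
    rw [← h2, h3, Pi.smul_apply, h1, smul_eq_mul]
  have hsol : ∀ x, 0 ≤ x → u x = v 0 * ((regSol V (-κ ^ 2) x : ℝ) : ℂ) := by
    intro x hx
    rw [← (regSol_ofReal hV (-κ ^ 2) hx).1]
    refine (eq_mul_regSol hV hx h0 (hp x hx).1 ((hp x hx).2.congr hx (fun _ _ => rfl) ?_) x
      ⟨hx, le_rfl⟩).1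
    filter_upwards [hgu] with t ht htx
    rw [ht htx.1, Complex.real_smul]
    push_cast
    ring
  have hmem : MemLp u 2 (volume.restrict (Ioi 0)) := (memLp_congr_ae hu).1 (Lp.memLp w)
  have hint := hmem.integrable_norm_pow two_ne_zero
  have hv : v 0 = 0 := by
    by_contra hne
    have hpos : 0 < ‖v 0‖ := norm_pos_iff.2 hne
    have hfin := hint.measure_norm_ge_lt_top (ε := ‖v 0‖ ^ 2) (by positivity)
    -- The regular solution satisfies φ(x) ≥ x, so a nonzero multiple stays away from 0 on the
    -- infinite half-line x > 1 and cannot be square integrable.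
    have hle : (volume.restrict (Ioi (0 : ℝ))) (Ioi 1) ≤ (volume.restrict (Ioi (0 : ℝ)))
        {x | ‖v 0‖ ^ 2 ≤ ‖‖u x‖ ^ 2‖} := measure_mono fun x hx => by
      have hx1 : 1 < x := hx
      have h3 := le_regSol hV (lam := -κ ^ 2) (by nlinarith [sq_nonneg κ]) (x := x) (by linarith)
      have h4 : 1 ≤ ‖((regSol V (-κ ^ 2) x : ℝ) : ℂ)‖ := by
        rw [Complex.norm_real, Real.norm_of_nonneg (by linarith)]
        linarith
      change ‖v 0‖ ^ 2 ≤ ‖‖u x‖ ^ 2‖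
      rw [hsol x (by linarith), norm_mul, Real.norm_of_nonneg (by positivity), mul_pow]
      exact le_mul_of_one_le_right (by positivity) (one_le_pow₀ h4)
    rw [Measure.restrict_apply measurableSet_Ioi, inter_eq_self_of_subset_left
      (Ioi_subset_Ioi zero_le_one), Real.volume_Ioi] at hle
    exact absurd (lt_of_le_of_lt hle hfin) (lt_irrefl _)
  refine Lp.ext ?_
  filter_upwards [hu, Lp.coeFn_zero ℂ 2 (volume.restrict (Ioi (0 : ℝ))),
    ae_restrict_mem measurableSet_Ioi] with t h1 h2 h3
  rw [h1, h2, hsol t (le_of_lt h3), hv, zero_mul, Pi.zero_apply]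

/-- The resolvent of the half-line Dirichlet operator at `-κ²`. -/
theorem isResolventAt_of_ae_eq (hV : IsPotential V) (hκ : 0 < κ)
    {R : L2 (Ioi 0) →L[ℂ] L2 (Ioi 0)}
    (hR : ∀ f : L2 (Ioi 0), R f =ᵐ[volume.restrict (Ioi 0)] resolventFn V κ f) :
    IsResolventAt (dirichletOperator V (Ioi 0)) (κ ^ 2) R := by
  have key : ∀ f : L2 (Ioi 0),
      (R f, f - ((κ ^ 2 : ℝ) : ℂ) • R f) ∈ dirichletOperator V (Ioi 0) := fun f => by
    refine ⟨_, _, _, hR f, ?_, isDirichletSolution_resolventFn hV hκ (Lp.memLp f)⟩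
    filter_upwards [hR f, Lp.coeFn_sub f (((κ ^ 2 : ℝ) : ℂ) • R f),
      Lp.coeFn_smul ((κ ^ 2 : ℝ) : ℂ) (R f)] with t h1 h2 h3
    rw [h2, Pi.sub_apply, h3, Pi.smul_apply, h1, smul_eq_mul]
  intro f u
  constructor
  · rintro rfl
    exact key f
  · intro h
    -- Two preimages of f differ by an element of the kernel of the operator plus κ², which is
    -- trivial.
    have h2 := (dirichletOperator V (Ioi 0)).sub_mem (key f) h
    rw [Prod.mk_sub_mk, sub_sub_sub_cancel_left, ← smul_sub,
      show ((κ ^ 2 : ℝ) : ℂ) • (u - R f) = -((κ ^ 2 : ℝ) : ℂ) • (R f - u) by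
        rw [neg_smul, ← smul_neg, neg_sub]] at h2
    exact sub_eq_zero.1 (eq_zero_of_mem_dirichletOperator hV h2)

end Resolvent

/-! ### The trace of the resolvent difference -/

section Trace

variable {V : ℝ → ℝ} {κ : ℝ}

/-- Distinct members are at distance √2, so the balls of radius 1/2 around them are disjoint.
Countability is needed to interchange the trace sum with an integral. -/
theorem Orthonormal.countable {ι E : Type*} [NormedAddCommGroup E] [InnerProductSpace ℂ E]
    [TopologicalSpace.SeparableSpace E] {e : ι → E} (he : Orthonormal ℂ e) : Countable ι := by
  refine Pairwise.countable_of_isOpen_disjoint (s := fun i => Metric.ball (e i) (1 / 2))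
    (fun i j hij => ?_) (fun i => Metric.isOpen_ball) (fun i => ⟨e i, by simp⟩)
  refine Metric.ball_disjoint_ball ?_
  have h : ‖e i - e j‖ ^ 2 = 2 := by
    rw [@norm_sub_sq ℂ, he.inner_eq_zero hij, he.norm_eq_one, he.norm_eq_one]
    norm_num
  rw [dist_eq_norm]
  nlinarith [norm_nonneg (e i - e j)]

theorem integral_greenFn_sq (hV : IsPotential V) (hκ : 0 < κ) {y : ℝ} (hy : 0 ≤ y) :
    ∫ t in Ioi 0, greenFn V κ y t ^ 2 = greenNormSq V κ y := by
  have hI := integrable_greenFn_sq hV hκ hy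
  rw [← Ioc_union_Ioi_eq_Ioi hy, setIntegral_union (Ioc_disjoint_Ioi le_rfl) measurableSet_Ioi
    (IntegrableOn.mono_set hI Ioc_subset_Ioi_self) (IntegrableOn.mono_set hI (Ioi_subset_Ioi hy)),
    ← intervalIntegral.integral_of_le hy]
  have h1 : ∫ t in (0 : ℝ)..y, greenFn V κ y t ^ 2 =
      (∫ t in (0 : ℝ)..y, regSol V (-κ ^ 2) t ^ 2) / greenDenom V κ y ^ 2 := by
    rw [← intervalIntegral.integral_div]
    refine intervalIntegral.integral_congr fun t ht => ?_
    rw [uIcc_of_le hy] at ht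
    rw [greenFn_of_le ht.2, div_pow]
  have h2 : ∫ t in Ioi y, greenFn V κ y t ^ 2 =
      regSol V (-κ ^ 2) y ^ 2 / greenDenom V κ y ^ 2 * Real.exp (2 * κ * y) *
        ∫ t in Ioi y, Real.exp (-2 * κ * t) := by
    rw [← integral_const_mul]
    refine setIntegral_congr_fun measurableSet_Ioi fun t ht => ?_
    rw [greenFn_of_ge (le_of_lt ht), mul_assoc, ← Real.exp_add, div_pow, mul_pow, ← Real.exp_nat_mul]
    rw [show (2 : ℕ) * (-κ * (t - y)) = 2 * κ * y + -2 * κ * t by push_cast; ring]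
    ring
  rw [h1, h2, integral_exp_mul_Ioi (by linarith), greenNormSq, ← greenDenom]
  have e : Real.exp (-2 * κ * y) = (Real.exp (2 * κ * y))⁻¹ := by
    rw [← Real.exp_neg]; congr 1; ring
  have hD := one_le_greenDenom hV hκ hy
  rw [e]
  field_simp

theorem inner_greenFn (hV : IsPotential V) (hκ : 0 < κ) {y : ℝ} (hy : 0 ≤ y) :
    ∃ G : L2 (Ioi 0), ‖G‖ ^ 2 = greenNormSq V κ y ∧
      ∀ f : L2 (Ioi 0), inner ℂ G f = greenAvg V κ f y := by
  have hc : Continuous fun t => ((greenFn V κ y t : ℝ) : ℂ) :=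
    Complex.continuous_ofReal.comp (continuous_greenFn hV y)
  have hm : MemLp (fun t => ((greenFn V κ y t : ℝ) : ℂ)) 2 (volume.restrict (Ioi 0)) := by
    rw [memLp_two_iff_integrable_sq_norm hc.aestronglyMeasurable]
    simpa using integrable_greenFn_sq hV hκ hy
  refine ⟨hm.toLp _, ?_, fun f => ?_⟩
  · rw [norm_sq_eq_integral, ← integral_greenFn_sq hV hκ hy]
    refine integral_congr_ae ?_
    filter_upwards [hm.coeFn_toLp] with t ht
    rw [ht, Complex.norm_real, Real.norm_eq_abs, sq_abs]
  · rw [MeasureTheory.L2.inner_def, greenAvg]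
    refine integral_congr_ae ?_
    filter_upwards [hm.coeFn_toLp] with t ht
    rw [ht, RCLike.inner_apply, Complex.conj_ofReal, mul_comm]

/-- Fubini exhibits the correction as a positive superposition of rank-one forms, ∫ V(y) |⟨G_y, f⟩|²
dy. The exponential decay of the kernel provides the integrable majorant. -/
theorem inner_eq_integral_of_ae_eq_greenCorr (hV : IsPotential V) (hκ : 0 < κ)
    {S : L2 (Ioi 0) →L[ℂ] L2 (Ioi 0)}
    (hS : ∀ f : L2 (Ioi 0), S f =ᵐ[volume.restrict (Ioi 0)] greenCorr V κ f) (f : L2 (Ioi 0)) :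
    inner ℂ f (S f) = ((∫ y in Ioi 0, V y * ‖greenAvg V κ f y‖ ^ 2 : ℝ) : ℂ) := by
  set μ := volume.restrict (Ioi (0 : ℝ)) with hμ
  set a := greenAvg V κ f
  set B := 1 / (2 * κ ^ 3) + ∫ t in Ioi 0, ‖f t‖ ^ 2
  set F : ℝ → ℝ → ℂ := fun s y =>
    (starRingEnd ℂ) (f s) * (((V y * greenFn V κ y s : ℝ) : ℂ) * a y) with hF
  have hf := Lp.memLp f
  have hf2 : Integrable (fun t => ‖f t‖ ^ 2) μ := hf.integrable_norm_pow two_ne_zero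
  have hprod : μ.prod μ = (volume.prod volume).restrict (Ioi (0 : ℝ) ×ˢ Ioi (0 : ℝ)) :=
    Measure.prod_restrict _ _
  have hmeas : AEStronglyMeasurable (Function.uncurry F) (μ.prod μ) := by
    refine AEStronglyMeasurable.mul (Complex.continuous_conj.comp_aestronglyMeasurable
      (Lp.aestronglyMeasurable f).comp_fst) (AEStronglyMeasurable.mul
        (Complex.continuous_ofReal.comp_aestronglyMeasurable (AEStronglyMeasurable.mul
          (hV.measurable.aestronglyMeasurable (μ := μ)).comp_snd ?_))
      (AEStronglyMeasurable.comp_snd (((continuousOn_greenAvg hV hκ hf).mono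
        Ioi_subset_Ici_self).aestronglyMeasurable measurableSet_Ioi)))
    rw [hprod]
    refine ContinuousOn.aestronglyMeasurable ?_ (measurableSet_Ioi.prod measurableSet_Ioi)
    exact (continuousOn_greenFn hV hκ).comp (f := fun p : ℝ × ℝ => (p.2, p.1)) (by fun_prop)
      fun p hp => ⟨mem_Ici.2 (le_of_lt hp.2), mem_univ _⟩
  have hbound : Integrable (fun p : ℝ × ℝ => 1 / (2 * κ) * B *
      (V p.2 * Real.exp (-κ * |p.1 - p.2|) + ‖f p.1‖ ^ 2 * V p.2)) (μ.prod μ) := by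
    refine ((Integrable.mono_measure (integrable_mul_exp_neg_abs_sub hκ hV.integrable.restrict)
      (Measure.prod_mono Measure.restrict_le_self le_rfl)).add
        (hf2.mul_prod hV.integrable.restrict)).const_mul _
  have hint : Integrable (Function.uncurry F) (μ.prod μ) := by
    refine hbound.mono' hmeas ?_
    rw [hprod]
    filter_upwards [ae_restrict_mem (measurableSet_Ioi.prod measurableSet_Ioi)] with p hp
    have hp1 : 0 ≤ p.1 := le_of_lt hp.1
    have hp2 : 0 ≤ p.2 := le_of_lt hp.2
    have h0 := greenFn_nonneg hV hκ hp2 hp1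
    have h1 := greenFn_le hV hκ hp2 hp1
    have h2 := norm_greenAvg_le hV hκ hp2 hf
    have hB : 0 ≤ B := (norm_nonneg _).trans h2
    have hVp := hV.nonneg p.2
    set x := Real.exp (-κ * |p.1 - p.2|)
    have hx0 : 0 ≤ x := (Real.exp_pos _).le
    have hx1 : x ≤ 1 := Real.exp_le_one_iff.2 (by nlinarith [abs_nonneg (p.1 - p.2)])
    simp only [Function.uncurry, hF]
    rw [norm_mul, norm_mul, Complex.norm_real, Real.norm_of_nonneg (mul_nonneg hVp h0),
      RCLike.norm_conj]
    have h3 : ‖f p.1‖ * x ≤ x + ‖f p.1‖ ^ 2 := by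
      have h4 : ‖f p.1‖ ≤ 1 + ‖f p.1‖ ^ 2 := by nlinarith [sq_nonneg (‖f p.1‖ - 1)]
      nlinarith [mul_le_mul_of_nonneg_right h4 hx0, mul_le_of_le_one_right (sq_nonneg ‖f p.1‖) hx1]
    calc ‖f p.1‖ * (V p.2 * greenFn V κ p.2 p.1 * ‖a p.2‖)
        ≤ ‖f p.1‖ * (V p.2 * (1 / (2 * κ) * x) * B) := by gcongr
      _ = 1 / (2 * κ) * B * V p.2 * (‖f p.1‖ * x) := by ring
      _ ≤ 1 / (2 * κ) * B * V p.2 * (x + ‖f p.1‖ ^ 2) := by gcongr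
      _ = _ := by ring
  calc inner ℂ f (S f) = ∫ s, ∫ y, F s y ∂μ ∂μ := by
        rw [MeasureTheory.L2.inner_def]
        refine integral_congr_ae ?_
        filter_upwards [hS f] with s hs
        rw [hs, RCLike.inner_apply, greenCorr, mul_comm, ← integral_const_mul]
    _ = ∫ y, ∫ s, F s y ∂μ ∂μ := integral_integral_swap hint
    _ = ∫ y, ((V y * ‖a y‖ ^ 2 : ℝ) : ℂ) ∂μ := by
        refine integral_congr_ae (Eventually.of_forall fun y => ?_)
        simp only [hF]
        have e : ∀ s, (starRingEnd ℂ) (f s) * (((V y * greenFn V κ y s : ℝ) : ℂ) * a y) =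
            ((V y : ℂ) * a y) * (starRingEnd ℂ) ((greenFn V κ y s : ℂ) * f s) := fun s => by
          rw [map_mul, Complex.conj_ofReal]; push_cast; ring
        simp_rw [e]
        rw [integral_const_mul, integral_conj]
        change (V y : ℂ) * a y * (starRingEnd ℂ) (a y) = _
        rw [mul_assoc, Complex.mul_conj, Complex.normSq_eq_norm_sq]
        push_cast; ring
    _ = _ := integral_complex_ofReal

theorem continuousOn_greenNormSq (hV : IsPotential V) (hκ : 0 < κ) :
    ContinuousOn (greenNormSq V κ) (Ici 0) := by
  have h1 := continuous_regSol hV (-κ ^ 2)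
  have h2 : Continuous fun y => ∫ t in (0 : ℝ)..y, regSol V (-κ ^ 2) t ^ 2 :=
    intervalIntegral.continuous_primitive (fun a b => (h1.pow 2).intervalIntegrable a b) 0
  refine ContinuousOn.div (by fun_prop) ((continuous_greenDenom (κ := κ) hV).pow 2).continuousOn
    fun y hy => ?_
  have := one_le_greenDenom hV hκ (mem_Ici.1 hy)
  exact pow_ne_zero 2 (by linarith : greenDenom V κ y ≠ 0)

theorem integrable_potential_mul_greenNormSq (hV : IsPotential V) (hκ : 0 < κ) :
    Integrable (fun y => V y * greenNormSq V κ y) (volume.restrict (Ioi 0)) := by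
  refine (hV.integrable.mul_const (1 / (2 * κ ^ 3))).restrict.mono'
    (hV.measurable.aestronglyMeasurable.mul (((continuousOn_greenNormSq hV hκ).mono
      Ioi_subset_Ici_self).aestronglyMeasurable measurableSet_Ioi)) ?_
  filter_upwards [ae_restrict_mem measurableSet_Ioi] with y hy
  have h1 := integral_greenFn_sq_le hV hκ (le_of_lt hy)
  rw [integral_greenFn_sq hV hκ (le_of_lt hy)] at h1
  have h0 : 0 ≤ greenNormSq V κ y := by
    rw [← integral_greenFn_sq hV hκ (le_of_lt hy)]
    exact integral_nonneg fun t => sq_nonneg _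
  rw [Real.norm_of_nonneg (mul_nonneg (hV.nonneg y) h0)]
  exact mul_le_mul_of_nonneg_left h1 (hV.nonneg y)

/-- Parseval sums |⟨G_y, e_i⟩|² to ‖G_y‖² at each y. All terms are non-negative, so their integrable
sum itself dominates and sum and integral may be exchanged. -/
theorem hasTrace_of_ae_eq_greenCorr (hV : IsPotential V) (hκ : 0 < κ)
    {S : L2 (Ioi 0) →L[ℂ] L2 (Ioi 0)}
    (hS : ∀ f : L2 (Ioi 0), S f =ᵐ[volume.restrict (Ioi 0)] greenCorr V κ f) :
    HasTrace S ((∫ y in Ioi 0, V y * greenNormSq V κ y : ℝ) : ℂ) := by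
  intro ι e
  have : Fact ((2 : ENNReal) ≠ ⊤) := ⟨by norm_num⟩
  have : Countable ι := e.orthonormal.countable
  simp_rw [inner_eq_integral_of_ae_eq_greenCorr hV hκ hS]
  rw [Complex.hasSum_ofReal]
  have hs : ∀ y, 0 < y → HasSum (fun i => V y * ‖greenAvg V κ (e i) y‖ ^ 2)
      (V y * greenNormSq V κ y) := fun y hy => by
    obtain ⟨G, hG, hGf⟩ := inner_greenFn hV hκ hy.le
    rw [← hG]
    refine HasSum.mul_left _ ?_
    have h := e.hasSum_inner_mul_inner G G
    have h2 : ∀ i, inner ℂ G (e i) * inner ℂ (e i) G =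
        ((‖greenAvg V κ (e i) y‖ ^ 2 : ℝ) : ℂ) := fun i => by
      rw [← inner_conj_symm (e i) G, hGf, Complex.mul_conj, Complex.normSq_eq_norm_sq]
    simp_rw [h2] at h
    rw [inner_self_eq_norm_sq_to_K] at h
    exact Complex.hasSum_ofReal.1 (by simpa using h)
  have hs' : ∀ᵐ y ∂(volume.restrict (Ioi (0 : ℝ))),
      HasSum (fun i => V y * ‖greenAvg V κ (e i) y‖ ^ 2) (V y * greenNormSq V κ y) := by
    filter_upwards [ae_restrict_mem measurableSet_Ioi] with y hy
    exact hs y hy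
  refine hasSum_integral_of_dominated_convergence
    (fun i y => V y * ‖greenAvg V κ (e i) y‖ ^ 2) (fun i => ?_) (fun i => ?_) ?_ ?_ hs'
  · exact hV.measurable.aestronglyMeasurable.mul ((((continuousOn_greenAvg hV hκ
      (Lp.memLp (e i))).mono Ioi_subset_Ici_self).aestronglyMeasurable measurableSet_Ioi).norm.pow 2)
  · refine Eventually.of_forall fun y => le_of_eq (Real.norm_of_nonneg ?_)
    exact mul_nonneg (hV.nonneg y) (sq_nonneg _)
  · filter_upwards [hs'] with y hy
    exact hy.summable
  · refine (integrable_potential_mul_greenNormSq hV hκ).congr ?_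
    filter_upwards [hs'] with y hy
    exact hy.tsum_eq.symm

/-- The trace of the difference of the perturbed and the free resolvent at `-κ²`. -/
theorem exists_resolvents (hV : IsPotential V) (hκ : 0 < κ) :
    ∃ R R' : L2 (Ioi 0) →L[ℂ] L2 (Ioi 0),
      IsResolventAt (dirichletOperator 0 (Ioi 0)) (κ ^ 2) R ∧
      IsResolventAt (dirichletOperator V (Ioi 0)) (κ ^ 2) R' ∧
      HasTrace (R' - R) ((-∫ y in Ioi 0, V y * greenNormSq V κ y : ℝ) : ℂ) := by
  obtain ⟨R, hR⟩ := exists_greenAvg_clm IsPotential.zero hκ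
  obtain ⟨S, hS⟩ := exists_greenCorr_clm hV hκ
  refine ⟨R, R - S, isResolventAt_of_ae_eq IsPotential.zero hκ fun f => ?_,
    isResolventAt_of_ae_eq hV hκ fun f => ?_, ?_⟩
  · filter_upwards [hR f] with s hs
    rw [hs, resolventFn, greenCorr]
    simp
  · filter_upwards [hR f, hS f, Lp.coeFn_sub (R f) (S f)] with s h1 h2 h3
    rw [sub_apply, h3, Pi.sub_apply, h1, h2, resolventFn]
  · intro ι e
    rw [sub_sub_cancel_left]
    simpa using (hasTrace_of_ae_eq_greenCorr hV hκ hS ι e).neg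

end Trace

/-! ### Krein's trace formula for the scattering phase -/

section ShiftFunction

variable {V : ℝ → ℝ} {κ : ℝ}

/-- The spectral shift function in terms of the scattering phase. -/
noncomputable def shiftFn (V : ℝ → ℝ) (x : ℝ) : ℝ :=
  if 0 < x then -phaseShift V (√x) / Real.pi else 0

theorem shiftFn_of_pos {x : ℝ} (hx : 0 < x) : shiftFn V x = -phaseShift V (√x) / Real.pi :=
  if_pos hx

theorem continuousOn_phaseShift (hV : IsPotential V) : ContinuousOn (phaseShift V) (Ioi 0) := by
  have h : LipschitzOnWith (phaseLipschitz V).toNNReal (phaseShift V) (Ioi 0) := by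
    refine LipschitzOnWith.of_dist_le_mul fun k₁ h1 k₂ h2 => ?_
    rw [Real.dist_eq, Real.dist_eq, Real.coe_toNNReal _ (phaseLipschitz_nonneg hV)]
    exact abs_phaseShift_sub_le hV h2 h1
  exact h.continuousOn

theorem continuousOn_shiftFn (hV : IsPotential V) : ContinuousOn (shiftFn V) (Ioi 0) := by
  refine ContinuousOn.congr ?_ fun x hx => shiftFn_of_pos hx
  exact (((continuousOn_phaseShift hV).comp Real.continuous_sqrt.continuousOn
    fun x hx => Real.sqrt_pos.2 hx).neg).div_const _

theorem shiftFn_nonneg (hV : IsPotential V) (x : ℝ) : 0 ≤ shiftFn V x := by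
  rw [shiftFn]
  split_ifs with h
  · have := phaseShift_nonpos hV (Real.sqrt_pos.2 h)
    exact div_nonneg (by linarith) Real.pi_pos.le
  · exact le_rfl

theorem shiftFn_le (hV : IsPotential V) (x : ℝ) : shiftFn V x ≤ (∫ t, V t * t) / Real.pi := by
  rw [shiftFn]
  split_ifs with h
  · have := (neg_phaseShift_le hV (Real.sqrt_pos.2 h)).1
    exact div_le_div_of_nonneg_right this Real.pi_pos.le
  · exact div_nonneg (hV.integral_nonneg (f := fun t => t) (fun t ht => ht)) Real.pi_pos.le


theorem measurable_shiftFn (hV : IsPotential V) : Measurable (shiftFn V) := by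
  refine measurable_of_isOpen fun U hU => ?_
  have h1 : shiftFn V ⁻¹' U = (Ioi 0 ∩ shiftFn V ⁻¹' U) ∪ (Iic 0 ∩ {_x | (0 : ℝ) ∈ U}) := by
    ext x
    rcases lt_or_ge 0 x with h | h
    · simp [h]
    · simp [shiftFn, h, not_lt.2 h]
  rw [h1]
  exact ((continuousOn_shiftFn hV).isOpen_inter_preimage isOpen_Ioi hU).measurableSet.union
    (measurableSet_Iic.inter (MeasurableSet.const _))

theorem integrable_shiftFn_div (hV : IsPotential V) :
    Integrable fun x => shiftFn V x / (1 + x ^ 2) := by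
  refine (integrable_inv_one_add_sq.const_mul ((∫ t, V t * t) / Real.pi)).mono'
    ((measurable_shiftFn hV).div (by fun_prop)).aestronglyMeasurable
    (Eventually.of_forall fun x => ?_)
  rw [Real.norm_of_nonneg (div_nonneg (shiftFn_nonneg hV x) (by positivity)), div_eq_mul_inv]
  exact mul_le_mul_of_nonneg_right (shiftFn_le hV x) (by positivity)

theorem integrable_inv_sq_add_sq (hκ : 0 < κ) :
    Integrable fun k : ℝ => 1 / (k ^ 2 + κ ^ 2) ^ 2 := by
  have h : Integrable fun k : ℝ => (1 / κ ^ 4) * (1 + (k / κ) ^ 2)⁻¹ :=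
    ((integrable_inv_one_add_sq.comp_div hκ.ne')).const_mul _
  refine h.mono' (continuous_const.div (by fun_prop) fun k => by positivity).aestronglyMeasurable
    (Eventually.of_forall fun k => ?_)
  rw [Real.norm_of_nonneg (by positivity)]
  have e : (1 / κ ^ 4) * (1 + (k / κ) ^ 2)⁻¹ = 1 / (κ ^ 2 * (k ^ 2 + κ ^ 2)) := by
    field_simp
    ring
  rw [e]
  refine one_div_le_one_div_of_le (by positivity) ?_
  nlinarith [sq_nonneg k, mul_nonneg (sq_nonneg k) (sq_nonneg k), mul_nonneg (sq_nonneg k) (sq_nonneg κ)]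

/-- Insert the spectral representation of ‖G_y‖² and integrate over y first: ∫ V(y) sin² θ_k(y) dy =
-kδ(k). -/
theorem integral_potential_mul_greenNormSq (hV : IsPotential V) (hκ : 0 < κ) :
    ∫ y in Ioi 0, V y * greenNormSq V κ y =
      ∫ k in Ioi 0, 2 * k * (-phaseShift V k / Real.pi) / (k ^ 2 + κ ^ 2) ^ 2 := by
  set μ := volume.restrict (Ioi (0 : ℝ)) with hμ
  set F : ℝ → ℝ → ℝ := fun k y =>
    V y * (1 / (k ^ 2 + κ ^ 2) ^ 2 * Real.sin (pruferAngle V k y) ^ 2) with hF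
  have hprod : μ.prod μ = (volume.prod volume).restrict (Ioi (0 : ℝ) ×ˢ Ioi (0 : ℝ)) :=
    Measure.prod_restrict _ _
  have hmeas : AEStronglyMeasurable (Function.uncurry F) (μ.prod μ) := by
    refine AEStronglyMeasurable.mul (hV.measurable.aestronglyMeasurable (μ := μ)).comp_snd ?_
    rw [hprod]
    refine ContinuousOn.aestronglyMeasurable ?_ (measurableSet_Ioi.prod measurableSet_Ioi)
    refine ContinuousOn.mul (Continuous.continuousOn ?_) ((Real.continuous_sin.comp_continuousOn
      ((continuousOn_pruferAngle_uncurry hV).mono (prod_mono le_rfl Ioi_subset_Ici_self))).pow 2)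
    exact continuous_const.div (by fun_prop) fun p => by positivity
  have hint : Integrable (Function.uncurry F) (μ.prod μ) := by
    refine ((integrable_inv_sq_add_sq hκ).restrict.mul_prod hV.integrable.restrict).mono' hmeas
      (Eventually.of_forall fun p => ?_)
    have h1 := Real.sin_sq_le_one (pruferAngle V p.1 p.2)
    have h2 := hV.nonneg p.2
    simp only [Function.uncurry, hF]
    rw [Real.norm_of_nonneg (by positivity), mul_comm]
    refine mul_le_mul_of_nonneg_right (mul_le_of_le_one_right (by positivity) h1) h2
  have h1 : ∫ y in Ioi 0, V y * greenNormSq V κ y = 2 / Real.pi * ∫ y, ∫ k, F k y ∂μ ∂μ := by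
    rw [← integral_const_mul]
    refine setIntegral_congr_fun measurableSet_Ioi fun y hy => ?_
    rw [greenNormSq_eq_integral hV hy hκ]
    simp only [hF]
    rw [integral_const_mul, mul_left_comm]
    congr 2
    exact integral_congr_ae (Eventually.of_forall fun k => by ring)
  have h2 : ∫ k in Ioi 0, 2 * k * (-phaseShift V k / Real.pi) / (k ^ 2 + κ ^ 2) ^ 2 =
      2 / Real.pi * ∫ k, ∫ y, F k y ∂μ ∂μ := by
    rw [← integral_const_mul]
    refine setIntegral_congr_fun measurableSet_Ioi fun k hk => ?_
    have hk' : 0 < k := hk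
    rw [phaseShift_eq hV hk, neg_neg]
    have e : ∀ t, V t * (1 / (k ^ 2 + κ ^ 2) ^ 2 * Real.sin (pruferAngle V k t) ^ 2) =
        k / (k ^ 2 + κ ^ 2) ^ 2 * (V t * (Real.sin (pruferAngle V k t) ^ 2 / k)) := fun t => by
      field_simp
    simp only [hF, e]
    rw [integral_const_mul]
    ring
  rw [h1, h2, integral_integral_swap hint]

theorem integral_Ioi_comp_sq (g : ℝ → ℝ) :
    ∫ k in Ioi 0, 2 * k * g (k ^ 2) = ∫ x in Ioi 0, g x := by
  rw [← integral_comp_rpow_Ioi_of_pos (g := g) (p := 2) zero_lt_two]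
  refine setIntegral_congr_fun measurableSet_Ioi fun k _ => ?_
  norm_num

theorem integral_shiftFn_div (hV : IsPotential V) (hκ : 0 < κ) :
    ∫ x, shiftFn V x / (x + κ ^ 2) ^ 2 = ∫ y in Ioi 0, V y * greenNormSq V κ y := by
  rw [integral_potential_mul_greenNormSq hV hκ,
    ← setIntegral_eq_integral_of_forall_compl_eq_zero (s := Ioi 0) (fun x hx => ?_),
    ← integral_Ioi_comp_sq]
  · refine setIntegral_congr_fun measurableSet_Ioi fun k hk => ?_
    have hk' : 0 < k := hk
    rw [shiftFn_of_pos (by positivity), Real.sqrt_sq hk'.le]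
    ring
  · rw [shiftFn, if_neg (show ¬0 < x from hx), zero_div]

theorem isSpectralShiftFunction_shiftFn (hV : IsPotential V) :
    IsSpectralShiftFunction (dirichletOperator 0 (Ioi 0)) (dirichletOperator V (Ioi 0))
      (shiftFn V) := by
  refine ⟨integrable_shiftFn_div hV, Eventually.of_forall fun x hx => if_neg hx.not_gt,
    fun c hc => ?_⟩
  obtain ⟨R, R', h1, h2, h3⟩ := exists_resolvents hV (Real.sqrt_pos.2 hc)
  rw [← integral_shiftFn_div hV (Real.sqrt_pos.2 hc)] at h3
  rw [Real.sq_sqrt hc.le] at h1 h2 h3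
  exact ⟨R, R', h1, h2, h3⟩

end ShiftFunction

/-! ### Uniqueness of the spectral shift function -/

section Stieltjes

variable {η : ℝ → ℝ}

/-- A majorant uniform in c ≥ b; it allows differentiation under the integral in the parameter c. -/
theorem inv_add_pow_le {b c x : ℝ} (hb : 0 < b) (hbc : b ≤ c) (hx : 0 ≤ x) (n : ℕ) :
    ((x + c) ^ (n + 2))⁻¹ ≤ (b ^ n)⁻¹ * (1 + (b ^ 2)⁻¹) * (1 + x ^ 2)⁻¹ := by
  have h1 : b ^ n * (x ^ 2 + b ^ 2) ≤ (x + c) ^ (n + 2) := by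
    rw [pow_add]
    refine mul_le_mul (pow_le_pow_left₀ hb.le (by linarith) n) ?_ (by positivity)
      (pow_nonneg (by linarith) n)
    nlinarith [mul_nonneg hx (hb.le.trans hbc)]
  have h2 : (x ^ 2 + b ^ 2)⁻¹ ≤ (1 + (b ^ 2)⁻¹) * (1 + x ^ 2)⁻¹ := by
    rw [← div_eq_mul_inv, le_div_iff₀ (by positivity), inv_mul_le_iff₀ (by positivity)]
    have : (x ^ 2 + b ^ 2) * (1 + (b ^ 2)⁻¹) = 1 + x ^ 2 + (b ^ 2 + x ^ 2 * (b ^ 2)⁻¹) := by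
      field_simp
      ring
    rw [this]
    have : 0 ≤ b ^ 2 + x ^ 2 * (b ^ 2)⁻¹ := by positivity
    linarith
  calc ((x + c) ^ (n + 2))⁻¹ ≤ (b ^ n * (x ^ 2 + b ^ 2))⁻¹ := inv_anti₀ (by positivity) h1
    _ = (b ^ n)⁻¹ * (x ^ 2 + b ^ 2)⁻¹ := mul_inv _ _
    _ ≤ _ := by rw [mul_assoc]; gcongr

theorem integrable_mul_inv_add_pow (hη : Integrable fun x => η x / (1 + x ^ 2)) {c : ℝ}
    (hc : 0 < c) (n : ℕ) :
    Integrable (fun x => η x * ((x + c) ^ (n + 2))⁻¹) (volume.restrict (Ioi 0)) := by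
  have hm : AEStronglyMeasurable η volume := by
    refine (hη.1.mul (by fun_prop : Continuous fun x : ℝ => 1 + x ^ 2).aestronglyMeasurable).congr
      (Eventually.of_forall fun x => ?_)
    have : (1 + x ^ 2) ≠ 0 := by positivity
    simp [div_mul_cancel₀ _ this]
  refine (hη.norm.const_mul ((c ^ n)⁻¹ * (1 + (c ^ 2)⁻¹))).restrict.mono'
    (hm.restrict.mul (by fun_prop : Measurable fun x : ℝ =>
      ((x + c) ^ (n + 2))⁻¹).aestronglyMeasurable) ?_
  filter_upwards [ae_restrict_mem measurableSet_Ioi] with x hx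
  have hx' : 0 < x := hx
  have h := inv_add_pow_le hc le_rfl hx'.le n
  rw [norm_mul, Real.norm_of_nonneg (show 0 ≤ ((x + c) ^ (n + 2))⁻¹ by positivity), norm_div,
    Real.norm_of_nonneg (show (0 : ℝ) ≤ 1 + x ^ 2 by positivity), div_eq_mul_inv]
  calc ‖η x‖ * ((x + c) ^ (n + 2))⁻¹ ≤ ‖η x‖ * _ := mul_le_mul_of_nonneg_left h (norm_nonneg _)
    _ = _ := by ring

/-- Differentiating the identity in c raises the exponent by one and brings out a nonzero factor. -/
theorem integral_mul_inv_add_pow_eq_zero (hη : Integrable fun x => η x / (1 + x ^ 2))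
    (h : ∀ c, 0 < c → ∫ x in Ioi 0, η x * ((x + c) ^ 2)⁻¹ = 0) (n : ℕ) :
    ∀ c, 0 < c → ∫ x in Ioi 0, η x * ((x + c) ^ (n + 2))⁻¹ = 0 := by
  induction n with
  | zero => simpa using h
  | succ n ih =>
    intro c hc
    have hb : 0 < c / 2 := by positivity
    have hderiv := (hasDerivAt_integral_of_dominated_loc_of_deriv_le
      (μ := volume.restrict (Ioi (0 : ℝ)))
      (F := fun c x => η x * ((x + c) ^ (n + 2))⁻¹)
      (F' := fun c x => -(n + 2) * (η x * ((x + c) ^ (n + 1 + 2))⁻¹)) (x₀ := c) (s := Ioi (c / 2))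
      (bound := fun x => (n + 2) * (((c / 2) ^ (n + 1))⁻¹ * (1 + ((c / 2) ^ 2)⁻¹)) *
        ‖η x / (1 + x ^ 2)‖)
      (Ioi_mem_nhds (by linarith)) ?_ (integrable_mul_inv_add_pow hη hc n)
      (((integrable_mul_inv_add_pow hη hc (n + 1)).const_mul _).1) ?_
      (hη.norm.const_mul _).restrict ?_).2
    · have hz : (fun c => ∫ x in Ioi 0, η x * ((x + c) ^ (n + 2))⁻¹) =ᶠ[𝓝 c] fun _ => 0 := by
        filter_upwards [Ioi_mem_nhds hc] with d hd
        exact ih d hd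
      have h0 := (hderiv.congr_of_eventuallyEq hz.symm).unique (hasDerivAt_const c (0 : ℝ))
      rw [integral_const_mul, mul_eq_zero] at h0
      refine h0.resolve_left ?_
      have : (0 : ℝ) < n + 2 := by positivity
      linarith
    · filter_upwards [Ioi_mem_nhds hc] with d hd
      exact (integrable_mul_inv_add_pow hη hd n).1
    · filter_upwards [ae_restrict_mem measurableSet_Ioi] with x hx d hd
      have hx' : 0 < x := hx
      have hd' : c / 2 < d := hd
      have hd0 : 0 < d := hb.trans hd'
      have h := inv_add_pow_le hb hd'.le hx'.le (n + 1)
      rw [norm_mul, norm_neg, Real.norm_of_nonneg (show (0 : ℝ) ≤ n + 2 by positivity), norm_mul,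
        Real.norm_of_nonneg (show 0 ≤ ((x + d) ^ (n + 1 + 2))⁻¹ by positivity), norm_div,
        Real.norm_of_nonneg (show (0 : ℝ) ≤ 1 + x ^ 2 by positivity), div_eq_mul_inv, mul_assoc]
      refine mul_le_mul_of_nonneg_left ?_ (by positivity)
      calc ‖η x‖ * ((x + d) ^ (n + 1 + 2))⁻¹ ≤ ‖η x‖ * _ :=
            mul_le_mul_of_nonneg_left h (norm_nonneg _)
        _ = _ := by ring
    · filter_upwards [ae_restrict_mem measurableSet_Ioi] with x hx d hd
      have hx' : 0 < x := hx
      have hd' : c / 2 < d := hd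
      have hpos : 0 < x + d := by linarith
      have h1 := (((hasDerivAt_id d).const_add x).pow (n + 2)).inv (pow_pos hpos _).ne'
      refine (h1.const_mul (η x)).congr_deriv ?_
      simp only [id, Pi.pow_apply]
      field_simp
      push_cast
      ring

/-- At c = 1 all moments of η(x)(x + 1)⁻² dx against powers of t = 1/(x + 1) vanish. By Weierstrass,
so does its integral against every continuous function of t in [0, 1], and smooth test functions on
(0, ∞) are of this form. -/
theorem ae_eq_zero_of_integral_div_sq (hη : Integrable fun x => η x / (1 + x ^ 2))
    (h : ∀ c, 0 < c → ∫ x in Ioi 0, η x * ((x + c) ^ 2)⁻¹ = 0) :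
    ∀ᵐ x, x ∈ Ioi (0 : ℝ) → η x = 0 := by
  have hm : ∀ n : ℕ, ∫ x in Ioi 0, η x * ((x + 1) ^ 2)⁻¹ * ((x + 1)⁻¹) ^ n = 0 := fun n => by
    refine Eq.trans ?_ (integral_mul_inv_add_pow_eq_zero hη h n 1 one_pos)
    refine setIntegral_congr_fun measurableSet_Ioi fun x _ => ?_
    rw [pow_add, mul_inv, inv_pow]; ring
  have hI := integrable_mul_inv_add_pow hη one_pos 0
  simp only [zero_add] at hI
  have hIn : ∀ n : ℕ, Integrable (fun x => η x * ((x + 1) ^ 2)⁻¹ * ((x + 1)⁻¹) ^ n)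
      (volume.restrict (Ioi 0)) := fun n => by
    refine (integrable_mul_inv_add_pow hη one_pos n).congr (Eventually.of_forall fun x => ?_)
    beta_reduce
    rw [pow_add, mul_inv, inv_pow]; ring
  have hpoly : ∀ p : Polynomial ℝ,
      Integrable (fun x => η x * ((x + 1) ^ 2)⁻¹ * p.eval ((x + 1)⁻¹)) (volume.restrict (Ioi 0)) ∧
      ∫ x in Ioi 0, η x * ((x + 1) ^ 2)⁻¹ * p.eval ((x + 1)⁻¹) = 0 := fun p => by
    have e : ∀ x, η x * ((x + 1) ^ 2)⁻¹ * p.eval ((x + 1)⁻¹) = ∑ i ∈ Finset.range (p.natDegree + 1),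
        p.coeff i * (η x * ((x + 1) ^ 2)⁻¹ * ((x + 1)⁻¹) ^ i) := fun x => by
      rw [Polynomial.eval_eq_sum_range, Finset.mul_sum]
      exact Finset.sum_congr rfl fun i _ => by ring
    simp_rw [e]
    refine ⟨integrable_finsetSum _ fun i _ => (hIn i).const_mul _, ?_⟩
    rw [integral_finsetSum _ fun i _ => (hIn i).const_mul _]
    refine Finset.sum_eq_zero fun i _ => ?_
    rw [integral_const_mul, hm, mul_zero]
  refine IsOpen.ae_eq_zero_of_integral_contDiff_smul_eq_zero (f := η) (U := Ioi 0) isOpen_Ioi ?_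
    fun g hg hgc hgs => ?_
  · have hl : LocallyIntegrable fun x => (1 + x ^ 2) * (η x / (1 + x ^ 2)) :=
      LocallyIntegrable.continuous_mul (by fun_prop) hη.locallyIntegrable
    have e : (fun x => (1 + x ^ 2) * (η x / (1 + x ^ 2))) = η := by
      funext x
      field_simp
    rw [e] at hl
    exact hl.locallyIntegrableOn _
  set φ : ℝ → ℝ := fun t => g (t⁻¹ - 1) * (t⁻¹) ^ 2
  have hg0 : ∀ x ≤ 0, g x = 0 := fun x hx => by
    by_contra hne
    exact absurd (hgs (subset_tsupport g hne)) (not_lt.2 hx)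
  obtain ⟨B, hB⟩ := hgc.isCompact.bddAbove
  have hgB : ∀ x, B < x → g x = 0 := fun x hx => by
    by_contra hne
    exact absurd (hB (subset_tsupport g hne)) (not_le.2 hx)
  have hφ : ContinuousOn φ (Icc 0 1) := by
    intro t ht
    rcases eq_or_lt_of_le ht.1 with rfl | h0
    · have hz : ∀ᶠ t in 𝓝[Icc 0 1] (0 : ℝ), φ t = φ 0 := by
        have : Iio (1 / (|B| + 2)) ∈ 𝓝 (0 : ℝ) := Iio_mem_nhds (by positivity)
        filter_upwards [mem_nhdsWithin_of_mem_nhds this, self_mem_nhdsWithin] with t ht ht2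
        rcases eq_or_lt_of_le ht2.1 with rfl | h0
        · rfl
        · have h1 : |B| + 2 < t⁻¹ := by
            rw [lt_inv_comm₀ (by positivity) h0]
            simpa using ht
          have h2 : g (t⁻¹ - 1) = 0 := hgB _ (by linarith [le_abs_self B])
          simp [φ, h2]
      exact continuousWithinAt_const.congr_of_eventuallyEq hz rfl
    · have hgc : Continuous g := hg.continuous
      have hinv : ContinuousAt (fun t : ℝ => t⁻¹) t := continuousAt_inv₀ h0.ne'
      have : ContinuousAt φ t := by
        refine ContinuousAt.mul ?_ (hinv.pow 2)
        exact hgc.continuousAt.comp (hinv.sub continuousAt_const)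
      exact this.continuousWithinAt
  have hval : ∀ x : ℝ, 0 < x →
      g x • η x = η x * ((x + 1) ^ 2)⁻¹ * φ ((x + 1)⁻¹) := fun x hx => by
    have : x + 1 ≠ 0 := by positivity
    simp only [φ, inv_inv, add_sub_cancel_right, smul_eq_mul]
    field_simp
  have hbd : ∀ ε, 0 < ε → |∫ x, g x • η x| ≤ ε * ∫ x in Ioi 0, ‖η x * ((x + 1) ^ 2)⁻¹‖ := by
    intro ε hε
    obtain ⟨p, hp⟩ := exists_polynomial_near_of_continuousOn 0 1 φ hφ ε hε
    have e1 : ∫ x, g x • η x = ∫ x in Ioi 0, g x • η x := by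
      rw [setIntegral_eq_integral_of_forall_compl_eq_zero]
      intro x hx
      rw [hg0 x (not_lt.1 hx), zero_smul]
    have hle : ∀ x, 0 < x → ‖η x * ((x + 1) ^ 2)⁻¹ * (φ ((x + 1)⁻¹) - p.eval ((x + 1)⁻¹))‖ ≤
        ε * ‖η x * ((x + 1) ^ 2)⁻¹‖ := fun x hx => by
      have h1 := hp (x + 1)⁻¹ ⟨by positivity, inv_le_one_of_one_le₀ (by linarith)⟩
      rw [norm_mul, mul_comm, Real.norm_eq_abs (φ _ - _), abs_sub_comm]
      exact mul_le_mul_of_nonneg_right h1.le (norm_nonneg _)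
    -- If the product were not integrable, its integral would be 0 by convention and the bound
    -- trivial; no proof of integrability is required.
    by_cases hint : Integrable (fun x => η x * ((x + 1) ^ 2)⁻¹ * φ ((x + 1)⁻¹))
      (volume.restrict (Ioi 0))
    · have e2 : ∫ x in Ioi 0, g x • η x = ∫ x in Ioi 0,
          η x * ((x + 1) ^ 2)⁻¹ * (φ ((x + 1)⁻¹) - p.eval ((x + 1)⁻¹)) := by
        have hs := integral_sub hint (hpoly p).1
        rw [(hpoly p).2, sub_zero] at hs
        rw [setIntegral_congr_fun measurableSet_Ioi fun x hx => hval x hx, ← hs]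
        exact integral_congr_ae (Eventually.of_forall fun x => by ring)
      rw [e1, e2, ← integral_const_mul, ← Real.norm_eq_abs]
      refine norm_integral_le_of_norm_le (hI.norm.const_mul ε) ?_
      filter_upwards [ae_restrict_mem measurableSet_Ioi] with x hx
      exact hle x hx
    · rw [e1, setIntegral_congr_fun measurableSet_Ioi fun x hx => hval x hx, integral_undef hint,
        abs_zero]
      exact mul_nonneg hε.le (integral_nonneg fun x => norm_nonneg _)
  have hlim : Tendsto (fun ε : ℝ => ε * ∫ x in Ioi 0, ‖η x * ((x + 1) ^ 2)⁻¹‖) (𝓝[>] 0) (𝓝 0) := by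
    refine Tendsto.mono_left ?_ nhdsWithin_le_nhds
    have : Continuous fun ε : ℝ => ε * ∫ x in Ioi 0, ‖η x * ((x + 1) ^ 2)⁻¹‖ := by fun_prop
    simpa using this.tendsto 0
  have := ge_of_tendsto hlim (eventually_nhdsWithin_of_forall fun ε hε => hbd ε hε)
  exact abs_eq_zero.1 (le_antisymm this (abs_nonneg _))

theorem HasTrace.unique {H : Type} [NormedAddCommGroup H] [InnerProductSpace ℂ H]
    [CompleteSpace H] {A : H →L[ℂ] H} {s t : ℂ} (hs : HasTrace A s) (ht : HasTrace A t) : s = t := by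
  obtain ⟨w, b, -⟩ := exists_hilbertBasis ℂ H
  exact (hs w b).unique (ht w b)

theorem IsResolventAt.unique {H : Type} [NormedAddCommGroup H] [InnerProductSpace ℂ H]
    {T : Submodule ℂ (H × H)} {c : ℝ} {R S : H →L[ℂ] H} (hR : IsResolventAt T c R)
    (hS : IsResolventAt T c S) : R = S :=
  ContinuousLinearMap.ext fun f => ((hS f (R f)).2 ((hR f (R f)).1 rfl)).symm

/-- Resolvents and traces are unique, so the two trace formulas have equal right-hand sides and the
Stieltjes argument applies to ξ₁ - ξ₂. Continuity upgrades almost everywhere equality to equality on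
(0, ∞). -/
theorem IsSpectralShiftFunction.eqOn {H : Type} [NormedAddCommGroup H] [InnerProductSpace ℂ H]
    [CompleteSpace H] {T T' : Submodule ℂ (H × H)} {ξ₁ ξ₂ : ℝ → ℝ}
    (h1 : IsSpectralShiftFunction T T' ξ₁) (h2 : IsSpectralShiftFunction T T' ξ₂)
    (hc1 : ContinuousOn ξ₁ (Ioi 0)) (hc2 : ContinuousOn ξ₂ (Ioi 0)) : EqOn ξ₁ ξ₂ (Ioi 0) := by
  have hIoi : ∀ ξ : ℝ → ℝ, IsSpectralShiftFunction T T' ξ → ∀ c : ℝ,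
      ∫ x, ξ x / (x + c) ^ 2 = ∫ x in Ioi 0, ξ x * ((x + c) ^ 2)⁻¹ := fun ξ hξ c => by
    simp_rw [div_eq_mul_inv]
    rw [setIntegral_eq_integral_of_ae_compl_eq_zero]
    have h0 : ∀ᵐ x : ℝ, x ≠ 0 := by simp [ae_iff]
    filter_upwards [hξ.eq_zero, h0] with x hx hx0 hx1
    rw [hx (lt_of_le_of_ne (not_lt.1 hx1) hx0), zero_mul]
  have hη : Integrable fun x => (ξ₁ x - ξ₂ x) / (1 + x ^ 2) := by
    simp_rw [sub_div]
    exact h1.integrable.sub h2.integrable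
  have hz := ae_eq_zero_of_integral_div_sq hη fun c hc => by
    obtain ⟨R, R', a1, a2, a3⟩ := h1.trace_formula c hc
    obtain ⟨S, S', b1, b2, b3⟩ := h2.trace_formula c hc
    rw [b1.unique a1, b2.unique a2] at b3
    have e := Complex.ofReal_injective (a3.unique b3)
    rw [neg_inj, hIoi ξ₁ h1, hIoi ξ₂ h2] at e
    have i1 := integrable_mul_inv_add_pow h1.integrable hc 0
    have i2 := integrable_mul_inv_add_pow h2.integrable hc 0
    simp only [zero_add] at i1 i2
    simp_rw [sub_mul]
    rw [integral_sub i1 i2, e, sub_self]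
  refine Measure.eqOn_open_of_ae_eq (μ := volume) ?_ isOpen_Ioi hc1 hc2
  rw [EventuallyEq, ae_restrict_iff' measurableSet_Ioi]
  filter_upwards [hz] with x hx hx0
  exact sub_eq_zero.1 (hx hx0)

end Stieltjes

/-! ### The trapezoidal rule for a Lipschitz integrand -/

section Trapezoid

variable {D D' : ℝ → ℝ} {T : ℝ}

theorem IsPrimitiveOn.of_lipschitzOnWith {K : NNReal} (hT : 0 ≤ T)
    (h : LipschitzOnWith K D (Icc 0 T)) : IsPrimitiveOn D (deriv D) T := by
  have hac : AbsolutelyContinuousOnInterval D 0 T :=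
    LipschitzOnWith.absolutelyContinuousOnInterval (by rwa [uIcc_of_le hT])
  refine IsPrimitiveOn.of_absolutelyContinuousOnInterval hT hac hac.intervalIntegrable_deriv ?_
  filter_upwards [hac.ae_differentiableAt] with x hx hmem
  exact (hx (by rw [uIcc_of_le hT]; exact Ioo_subset_Icc_self hmem)).hasDerivAt

/-- Integrate by parts with the antiderivative k² - (p² + q²)/2 of 2k; its end values ±(q² - p²)/2
reproduce the trapezoidal term. -/
theorem integral_sub_trapezoid_eq (h : IsPrimitiveOn D D' T) {p q : ℝ} (hp : p ∈ Icc 0 T)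
    (hq : q ∈ Icc 0 T) :
    (∫ k in p..q, 2 * k * D k) - (D q + D p) / 2 * (q ^ 2 - p ^ 2) =
      ∫ k in p..q, ((p ^ 2 + q ^ 2) / 2 - k ^ 2) * D' k := by
  have hT : 0 ≤ T := hp.1.trans hp.2
  have hsub : uIcc p q ⊆ Icc 0 T := uIcc_subset_Icc hp hq
  have hI := h.intervalIntegrable hp hq
  have hI2 : IntervalIntegrable (fun k => k ^ 2 * D' k) volume p q :=
    hI.continuousOn_mul (by fun_prop)
  have hI3 : IntervalIntegrable (fun k => 2 * k * D k) volume p q :=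
    (ContinuousOn.mul (by fun_prop) (h.continuousOn.mono hsub)).intervalIntegrable
  have hsq : IsPrimitiveOn (fun k : ℝ => k ^ 2) (fun k => 2 * k) T :=
    IsPrimitiveOn.of_hasDerivAt hT (fun k _ => by simpa using hasDerivAt_pow 2 k) (by fun_prop)
  have h1 := (hsq.mul hT h).sub_eq hp hq
  have h2 := h.sub_eq hp hq
  rw [intervalIntegral.integral_add hI2 hI3] at h1
  have h3 : ∫ k in p..q, ((p ^ 2 + q ^ 2) / 2 - k ^ 2) * D' k =
      (p ^ 2 + q ^ 2) / 2 * (∫ k in p..q, D' k) - ∫ k in p..q, k ^ 2 * D' k := by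
    rw [← intervalIntegral.integral_const_mul,
      ← intervalIntegral.integral_sub (hI.const_mul _) hI2]
    exact intervalIntegral.integral_congr fun k _ => by ring
  rw [h3, ← h2]
  linear_combination -h1

/-- D' is split into its distance to a continuous c, the oscillation of c on the cell, and the
constant c(q). The weight is of first order in the mesh, but its integral is of third order, so only
the first two parts matter and both can be made small. -/
theorem abs_integral_sub_trapezoid_le (h : IsPrimitiveOn D D' T) {c : ℝ → ℝ} (hc : Continuous c)
    {p q m ω B : ℝ} (hp : p ∈ Icc 0 T) (hq : q ∈ Icc 0 T) (hpq : p ≤ q) (hm : q - p ≤ m)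
    (hω : ∀ k ∈ Icc p q, |c k - c q| ≤ ω) (hB : |c q| ≤ B) :
    |(∫ k in p..q, 2 * k * D k) - (D q + D p) / 2 * (q ^ 2 - p ^ 2)| ≤
      T * m * (∫ k in p..q, |D' k - c k|) + T * m * ω * (q - p) + B * m ^ 2 * (q - p) := by
  have hT : 0 ≤ T := hp.1.trans hp.2
  have hm0 : 0 ≤ m := (sub_nonneg.2 hpq).trans hm
  have hB0 : 0 ≤ B := (abs_nonneg _).trans hB
  rw [integral_sub_trapezoid_eq h hp hq]
  set w : ℝ → ℝ := fun k => (p ^ 2 + q ^ 2) / 2 - k ^ 2 with hw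
  have hwc : Continuous w := by fun_prop
  have hwb : ∀ k ∈ Icc p q, |w k| ≤ T * m := fun k hk => by
    have h1 : (q ^ 2 - p ^ 2) / 2 ≤ T * m := by
      have : (q ^ 2 - p ^ 2) / 2 = (q + p) / 2 * (q - p) := by ring
      rw [this]
      exact mul_le_mul (by linarith [hp.2, hq.2]) hm (sub_nonneg.2 hpq) hT
    have h2 : p ^ 2 ≤ k ^ 2 := pow_le_pow_left₀ hp.1 hk.1 2
    have h3 : k ^ 2 ≤ q ^ 2 := pow_le_pow_left₀ (hp.1.trans hk.1) hk.2 2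
    rw [abs_le]
    constructor <;> simp only [hw] <;> linarith
  have hI := h.intervalIntegrable hp hq
  have hIc : IntervalIntegrable c volume p q := hc.intervalIntegrable _ _
  have i1 : IntervalIntegrable (fun k => w k * (D' k - c k)) volume p q :=
    (hI.sub hIc).continuousOn_mul hwc.continuousOn
  have i2 : IntervalIntegrable (fun k => w k * (c k - c q)) volume p q :=
    (by fun_prop : Continuous fun k => w k * (c k - c q)).intervalIntegrable _ _
  have i3 : IntervalIntegrable (fun k => c q * w k) volume p q :=
    (by fun_prop : Continuous fun k => c q * w k).intervalIntegrable _ _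
  have e : ∫ k in p..q, w k * D' k = (∫ k in p..q, w k * (D' k - c k)) +
      (∫ k in p..q, w k * (c k - c q)) + ∫ k in p..q, c q * w k := by
    rw [← intervalIntegral.integral_add i1 i2, ← intervalIntegral.integral_add (i1.add i2) i3]
    exact intervalIntegral.integral_congr fun k _ => by ring
  have b1 : |∫ k in p..q, w k * (D' k - c k)| ≤ T * m * ∫ k in p..q, |D' k - c k| := by
    rw [← intervalIntegral.integral_const_mul]
    refine (intervalIntegral.abs_integral_le_integral_abs hpq).trans
      (intervalIntegral.integral_mono_on hpq i1.abs ((hI.sub hIc).abs.const_mul _) fun k hk => ?_)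
    rw [abs_mul]
    exact mul_le_mul_of_nonneg_right (hwb k hk) (abs_nonneg _)
  have b2 : |∫ k in p..q, w k * (c k - c q)| ≤ T * m * ω * (q - p) := by
    have := intervalIntegral.norm_integral_le_of_norm_le_const (a := p) (b := q)
      (f := fun k => w k * (c k - c q)) (C := T * m * ω) fun k hk => by
        rw [uIoc_of_le hpq] at hk
        have hk' : k ∈ Icc p q := ⟨hk.1.le, hk.2⟩
        rw [Real.norm_eq_abs, abs_mul]
        exact mul_le_mul (hwb k hk') (hω k hk') (abs_nonneg _) (by positivity)
    rwa [Real.norm_eq_abs, abs_of_nonneg (sub_nonneg.2 hpq)] at this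
  have b3 : |∫ k in p..q, c q * w k| ≤ B * m ^ 2 * (q - p) := by
    -- The near cancellation: the weight integrates to (q - p)³/6.
    have hval : ∫ k in p..q, w k = (q - p) ^ 3 / 6 := by
      simp only [hw]
      rw [intervalIntegral.integral_sub (by simp) (by simp), integral_pow,
        intervalIntegral.integral_const]
      simp only [smul_eq_mul]
      norm_num
      ring
    rw [intervalIntegral.integral_const_mul, hval, abs_mul, mul_assoc]
    have hd := sub_nonneg.2 hpq
    refine mul_le_mul hB ?_ (abs_nonneg _) hB0
    rw [abs_of_nonneg (by positivity)]
    have h1 : (q - p) ^ 2 ≤ m ^ 2 := pow_le_pow_left₀ hd hm 2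
    have h2 : (q - p) ^ 3 = (q - p) ^ 2 * (q - p) := by ring
    rw [h2]
    nlinarith [mul_le_mul_of_nonneg_right h1 hd, mul_nonneg (sq_nonneg (q - p)) hd]
  rw [e]
  exact (abs_add_three _ _ _).trans (by linarith)

/-- The trapezoidal rule for `∫ D(k) d(k²)` has an error of smaller order than the mesh. -/
theorem exists_trapezoid_bound (h : IsPrimitiveOn D D' T) (hT : 0 < T) {ε : ℝ} (hε : 0 < ε) :
    ∃ r > 0, ∀ (N : ℕ) (k : ℕ → ℝ) (m : ℝ), k 0 = 0 → k N ≤ T →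
      (∀ n < N, k n ≤ k (n + 1) ∧ k (n + 1) - k n ≤ m) → 0 ≤ m → m ≤ r →
      |(∫ s in (0 : ℝ)..k N, 2 * s * D s) - ∑ n ∈ Finset.range N,
        (D (k (n + 1)) + D (k n)) / 2 * (k (n + 1) ^ 2 - k n ^ 2)| ≤ ε * m := by
  set F := (Icc 0 T).indicator D' with hF
  have hD'I : IntegrableOn D' (Icc 0 T) := (intervalIntegrable_iff_integrableOn_Icc_of_le hT.le).1 h.1
  have hFI : Integrable F := hD'I.integrable_indicator measurableSet_Icc
  have hη : 0 < ε / (3 * T) := by positivity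
  -- L¹ approximation of D' by a continuous compactly supported c; its distance, its oscillation at
  -- scale r, and the second order term governed by its bound B each cost at most a third of ε.
  obtain ⟨c, hcs, hcε, hc, hcI⟩ := hFI.exists_hasCompactSupport_integral_sub_le hη
  obtain ⟨B, hB⟩ := hc.bounded_above_of_compact_support hcs
  have hB0 : 0 ≤ B := (norm_nonneg _).trans (hB 0)
  obtain ⟨r, hr, hru⟩ := Metric.uniformContinuous_iff.1
    (hcs.uniformContinuous_of_continuous hc) (ε / (3 * T ^ 2)) (by positivity)
  refine ⟨min (r / 2) (ε / (3 * T * (B + 1))), by positivity, fun N k m h0 hN hk hm0 hm => ?_⟩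
  have hmr : m ≤ r / 2 := hm.trans (min_le_left _ _)
  have hmB : m ≤ ε / (3 * T * (B + 1)) := hm.trans (min_le_right _ _)
  have hmono : ∀ i ≤ N, ∀ j ≤ i, k j ≤ k i := by
    intro i
    induction i with
    | zero => intro _ j hj; rw [Nat.le_zero.1 hj]
    | succ i ih =>
      intro hi j hj
      rcases Nat.lt_or_eq_of_le hj with hj | rfl
      · exact (ih (by omega) j (by omega)).trans (hk i (by omega)).1
      · exact le_rfl
  have hmem : ∀ i ≤ N, k i ∈ Icc 0 T := fun i hi =>
    ⟨h0 ▸ hmono i hi 0 (Nat.zero_le _), (hmono N le_rfl i hi).trans hN⟩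
  have hIcell : ∀ n < N, IntervalIntegrable (fun s => 2 * s * D s) volume (k n) (k (n + 1)) :=
    fun n hn => (ContinuousOn.mul (by fun_prop) (h.continuousOn.mono (uIcc_subset_Icc
      (hmem n hn.le) (hmem (n + 1) hn)))).intervalIntegrable
  have hIabs : ∀ n < N, IntervalIntegrable (fun s => |D' s - c s|) volume (k n) (k (n + 1)) :=
    fun n hn => ((h.intervalIntegrable (hmem n hn.le) (hmem (n + 1) hn)).sub
      (hc.intervalIntegrable _ _)).abs
  have hL1 : ∑ n ∈ Finset.range N, ∫ s in k n..k (n + 1), |D' s - c s| ≤ ε / (3 * T) := by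
    rw [intervalIntegral.sum_integral_adjacent_intervals hIabs, h0,
      intervalIntegral.integral_of_le (hmem N le_rfl).1]
    refine le_trans (le_trans (le_of_eq ?_) (setIntegral_le_integral (s := Ioc 0 (k N))
      (hFI.sub hcI).norm (Eventually.of_forall fun s => norm_nonneg _))) hcε
    refine setIntegral_congr_fun measurableSet_Ioc fun s hs => ?_
    have : s ∈ Icc 0 T := ⟨hs.1.le, hs.2.trans hN⟩
    simp only [Pi.sub_apply, hF, indicator_of_mem this, Real.norm_eq_abs]
  have htel : ∑ n ∈ Finset.range N, (k (n + 1) - k n) = k N := by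
    rw [Finset.sum_range_sub, h0, sub_zero]
  rw [← h0, ← intervalIntegral.sum_integral_adjacent_intervals hIcell, ← Finset.sum_sub_distrib]
  have hcell : ∀ n ∈ Finset.range N, |(∫ s in k n..k (n + 1), 2 * s * D s) -
      (D (k (n + 1)) + D (k n)) / 2 * (k (n + 1) ^ 2 - k n ^ 2)| ≤
      T * m * (∫ s in k n..k (n + 1), |D' s - c s|) +
        (T * m * (ε / (3 * T ^ 2)) + B * m ^ 2) * (k (n + 1) - k n) := fun n hn => by
    have hn' := Finset.mem_range.1 hn
    refine (abs_integral_sub_trapezoid_le h hc (hmem n hn'.le) (hmem (n + 1) hn') (hk n hn').1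
      (hk n hn').2 (ω := ε / (3 * T ^ 2)) (fun s hs => ?_) (hB _)).trans (le_of_eq (by ring))
    refine le_of_lt ?_
    rw [← Real.dist_eq]
    refine hru ?_
    rw [Real.dist_eq, abs_sub_comm, abs_of_nonneg (by linarith [hs.2])]
    linarith [hs.1, (hk n hn').2]
  refine (Finset.abs_sum_le_sum_abs _ _).trans ((Finset.sum_le_sum hcell).trans ?_)
  rw [Finset.sum_add_distrib, ← Finset.mul_sum, ← Finset.mul_sum, htel]
  have a1 : T * m * ∑ n ∈ Finset.range N, (∫ s in k n..k (n + 1), |D' s - c s|) ≤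
      T * m * (ε / (3 * T)) := mul_le_mul_of_nonneg_left hL1 (by positivity)
  have a2 : (T * m * (ε / (3 * T ^ 2)) + B * m ^ 2) * k N ≤
      (T * m * (ε / (3 * T ^ 2)) + B * m ^ 2) * T := mul_le_mul_of_nonneg_left hN (by positivity)
  have a3 : B * m * T ≤ ε / 3 := by
    rw [le_div_iff₀ (by positivity)] at hmB
    nlinarith [mul_nonneg hm0 hT.le]
  have e1 : T * m * (ε / (3 * T)) = ε / 3 * m := by field_simp
  have e2 : T * m * (ε / (3 * T ^ 2)) * T = ε / 3 * m := by field_simp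
  nlinarith [mul_le_mul_of_nonneg_right a3 hm0]

end Trapezoid

/-! ### Quantized momenta and summation by parts -/

section Momenta

variable {V : ℝ → ℝ}

/-- The `n`-th quantized momentum on `(0, L)`; it is zero for `n = 0`. -/
noncomputable def momentum (V : ℝ → ℝ) (L : ℝ) (n : ℕ) : ℝ :=
  open Classical in
  if h : ∃ k : ℝ, 0 < k ∧ pruferAngle V k L = n * Real.pi then h.choose else 0

/-- The momentum shift, multiplied by the length of the interval. -/
noncomputable def momentumShift (V : ℝ → ℝ) (L : ℝ) (n : ℕ) : ℝ :=
  momentum V L n * L - n * Real.pi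

/-- The negative scattering phase, extended by zero. -/
noncomputable def negPhase (V : ℝ → ℝ) (k : ℝ) : ℝ :=
  if 0 < k then -phaseShift V k else 0

theorem negPhase_of_pos {k : ℝ} (hk : 0 < k) : negPhase V k = -phaseShift V k := if_pos hk

theorem negPhase_zero : negPhase V 0 = 0 := if_neg (lt_irrefl _)

theorem integral_mul_sq_le_phaseLipschitz (hV : IsPotential V) :
    ∫ t, V t * t ^ 2 ≤ phaseLipschitz V := by
  have h1 := hV.integral_nonneg (f := fun t => t ^ 2) (fun t _ => sq_nonneg t)
  have h2 := hV.integral_nonneg (f := fun t => t) (fun t ht => ht)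
  have h3 : 1 ≤ Real.exp (3 * ∫ t, V t * t) := Real.one_le_exp (by positivity)
  unfold phaseLipschitz
  nlinarith [mul_le_mul_of_nonneg_left h3 h1]

theorem abs_negPhase_sub_le (hV : IsPotential V) {k₁ k₂ : ℝ} (hk₁ : 0 ≤ k₁) (hk₂ : 0 ≤ k₂) :
    |negPhase V k₂ - negPhase V k₁| ≤ phaseLipschitz V * |k₂ - k₁| := by
  have key : ∀ k : ℝ, 0 < k → |negPhase V k| ≤ phaseLipschitz V * k := fun k hk => by
    rw [negPhase_of_pos hk, abs_of_nonneg (neg_nonneg.2 (phaseShift_nonpos hV hk)), mul_comm]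
    exact (neg_phaseShift_le hV hk).2.trans
      (mul_le_mul_of_nonneg_left (integral_mul_sq_le_phaseLipschitz hV) hk.le)
  rcases eq_or_lt_of_le hk₁ with rfl | h1 <;> rcases eq_or_lt_of_le hk₂ with rfl | h2
  · simp
  · rw [negPhase_zero, sub_zero, sub_zero, abs_of_pos h2]
    exact key k₂ h2
  · rw [negPhase_zero, zero_sub, zero_sub, abs_neg, abs_neg, abs_of_pos h1]
    exact key k₁ h1
  · rw [negPhase_of_pos h1, negPhase_of_pos h2, neg_sub_neg, abs_sub_comm]
    exact abs_phaseShift_sub_le hV h1 h2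

theorem lipschitzOnWith_negPhase (hV : IsPotential V) :
    LipschitzOnWith (phaseLipschitz V).toNNReal (negPhase V) (Ici 0) := by
  refine LipschitzOnWith.of_dist_le_mul fun k₁ h1 k₂ h2 => ?_
  rw [Real.dist_eq, Real.dist_eq, Real.coe_toNNReal _ (phaseLipschitz_nonneg hV)]
  exact abs_negPhase_sub_le hV h2 h1

variable {L : ℝ}

theorem momentum_spec (hV : IsPotential V) (hL : 0 < L) {n : ℕ} (hn : 1 ≤ n) :
    0 < momentum V L n ∧ pruferAngle V (momentum V L n) L = n * Real.pi := by
  have h := exists_momentum hV hL hn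
  rw [momentum, dif_pos h]
  exact h.choose_spec

theorem momentum_zero (hV : IsPotential V) (hL : 0 < L) : momentum V L 0 = 0 := by
  refine dif_neg ?_
  rintro ⟨k, hk, h⟩
  have := pruferAngle_pos hV hk hL
  simp [h] at this

theorem momentum_nonneg (hV : IsPotential V) (hL : 0 < L) (n : ℕ) : 0 ≤ momentum V L n := by
  rcases Nat.eq_zero_or_pos n with rfl | hn
  · rw [momentum_zero hV hL]
  · exact (momentum_spec hV hL hn).1.le

theorem momentumShift_zero (hV : IsPotential V) (hL : 0 < L) : momentumShift V L 0 = 0 := by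
  simp [momentumShift, momentum_zero hV hL]

theorem momentumShift_eq (hV : IsPotential V) (hL : 0 < L) {n : ℕ} (hn : 1 ≤ n) :
    momentumShift V L n = -partialPhase V L (momentum V L n) := by
  rw [momentumShift, partialPhase, (momentum_spec hV hL hn).2]
  ring

theorem momentum_eq (hL : 0 < L) (n : ℕ) :
    momentum V L n = n * (Real.pi / L) + momentumShift V L n / L := by
  rw [momentumShift]
  field_simp
  ring

theorem momentumShift_nonneg (hV : IsPotential V) (hL : 0 < L) (n : ℕ) :
    0 ≤ momentumShift V L n := by
  rcases Nat.eq_zero_or_pos n with rfl | hn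
  · rw [momentumShift_zero hV hL]
  · rw [momentumShift_eq hV hL hn, neg_nonneg]
    exact partialPhase_nonpos hV (momentum_spec hV hL hn).1 hL.le

theorem momentumShift_le (hV : IsPotential V) (hL : 0 < L) (n : ℕ) :
    momentumShift V L n ≤ ∫ t, V t * t := by
  rcases Nat.eq_zero_or_pos n with rfl | hn
  · rw [momentumShift_zero hV hL]
    exact hV.integral_nonneg (f := fun t => t) (fun t ht => ht)
  · rw [momentumShift_eq hV hL hn]
    exact (neg_partialPhase_le hV (momentum_spec hV hL hn).1 hL.le).1

theorem momentum_lt_succ (hV : IsPotential V) (hL : 0 < L) (n : ℕ) :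
    momentum V L n < momentum V L (n + 1) := by
  obtain ⟨h1, h2⟩ := momentum_spec hV hL (Nat.succ_pos n)
  rcases Nat.eq_zero_or_pos n with rfl | hn
  · rwa [momentum_zero hV hL]
  · obtain ⟨h3, h4⟩ := momentum_spec hV hL hn
    by_contra hle
    push Not at hle
    rcases eq_or_lt_of_le hle with he | hlt
    · rw [Nat.succ_eq_add_one, he, h4] at h2
      push_cast at h2
      linarith [Real.pi_pos]
    · have := pruferAngle_strictMono hV h1 hlt hL
      rw [h2, h4] at this
      push_cast at this
      linarith [Real.pi_pos]

/-- The case n = 0 is separate since the Prüfer angle is used only at positive momentum; the bound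
by k times the second moment replaces the Lipschitz estimate. -/
theorem abs_momentumShift_sub_le (hV : IsPotential V) (hL : 0 < L) (n : ℕ) :
    |momentumShift V L (n + 1) - momentumShift V L n| ≤
      phaseLipschitz V * (momentum V L (n + 1) - momentum V L n) := by
  have h1 := (momentum_spec hV hL (Nat.succ_pos n)).1
  have hlt := momentum_lt_succ hV hL n
  rcases Nat.eq_zero_or_pos n with rfl | hn
  · rw [momentumShift_zero hV hL, momentum_zero hV hL, sub_zero, sub_zero,
      abs_of_nonneg (momentumShift_nonneg hV hL _), momentumShift_eq hV hL le_rfl, mul_comm]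
    exact (neg_partialPhase_le hV h1 hL.le).2.trans
      (mul_le_mul_of_nonneg_left (integral_mul_sq_le_phaseLipschitz hV) h1.le)
  · rw [momentumShift_eq hV hL hn, momentumShift_eq hV hL (Nat.succ_pos n), neg_sub_neg,
      abs_sub_comm]
    refine (abs_partialPhase_sub_le hV (momentum_spec hV hL hn).1 h1 hL.le).trans ?_
    rw [abs_of_pos (sub_pos.2 hlt)]

/-- The gap Δ satisfies LΔ - π = d_{n+1} - d_n, and for large L the right side is at most LΔ/2. -/
theorem momentum_sub_le (hV : IsPotential V) (hL : 0 < L) (hL2 : 2 * phaseLipschitz V ≤ L) (n : ℕ) :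
    momentum V L (n + 1) - momentum V L n ≤ 2 * (Real.pi / L) := by
  have h1 := (abs_le.1 (abs_momentumShift_sub_le hV hL n)).2
  have h2 := momentum_lt_succ hV hL n
  have h3 : momentumShift V L (n + 1) - momentumShift V L n =
      L * (momentum V L (n + 1) - momentum V L n) - Real.pi := by
    simp only [momentumShift]
    push_cast
    ring
  have h4 : phaseLipschitz V * (momentum V L (n + 1) - momentum V L n) ≤
      L / 2 * (momentum V L (n + 1) - momentum V L n) :=
    mul_le_mul_of_nonneg_right (by linarith) (sub_pos.2 h2).le
  rw [mul_div_assoc', le_div_iff₀ hL]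
  linarith

theorem momentum_mul_abs_momentumShift_sub_le (hV : IsPotential V) (hL : 0 < L) (n : ℕ) :
    momentum V L n * |momentumShift V L n - negPhase V (momentum V L n)| ≤
      (∫ t in Ioi L, V t * t ^ 2) / L ^ 2 := by
  rw [le_div_iff₀ (by positivity)]
  rcases Nat.eq_zero_or_pos n with rfl | hn
  · rw [momentum_zero hV hL, zero_mul, zero_mul]
    exact integral_nonneg fun t => mul_nonneg (hV.nonneg t) (sq_nonneg t)
  · have h := (momentum_spec hV hL hn).1
    rw [momentumShift_eq hV hL hn, negPhase_of_pos h, neg_sub_neg, abs_sub_comm]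
    exact abs_partialPhase_sub_phaseShift_le hV h hL.le

/-- Summation by parts for a sum of differences of squares. -/
theorem mul_sum_sq_sub_eq {k u : ℕ → ℝ} {h : ℝ} (hk : ∀ n : ℕ, k n = n * h + u n) (hu : u 0 = 0)
    (N : ℕ) :
    h * ∑ n ∈ Finset.range N, (k (n + 1) ^ 2 - ((n + 1 : ℕ) * h) ^ 2) =
      h * k N * u N - h * u N ^ 2 / 2 - k N * u N ^ 2 + u N ^ 3 / 3 +
      (∑ n ∈ Finset.range N, ((k (n + 1) - k n) ^ 3 - h ^ 3)) / 6 +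
      ∑ n ∈ Finset.range N, (u (n + 1) + u n) / 2 * (k (n + 1) ^ 2 - k n ^ 2) := by
  induction N with
  | zero => simp [hu]
  | succ N ih =>
    rw [Finset.sum_range_succ, Finset.sum_range_succ, Finset.sum_range_succ, mul_add, ih]
    simp only [hk]
    push_cast
    ring

/-- Gaps differ from π/L by O(L⁻²), so each difference of cubes is O(L⁻⁴) and N of order L of them
add up to O(L⁻³). -/
theorem abs_sum_cube_sub_le (hV : IsPotential V) (hL : 0 < L) (hL2 : 2 * phaseLipschitz V ≤ L)
    (N : ℕ) :
    |∑ n ∈ Finset.range N, ((momentum V L (n + 1) - momentum V L n) ^ 3 - (Real.pi / L) ^ 3)| ≤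
      N * (14 * phaseLipschitz V * (Real.pi / L) ^ 3 / L) := by
  refine (Finset.abs_sum_le_sum_abs _ _).trans ((Finset.sum_le_card_nsmul _ _
    (14 * phaseLipschitz V * (Real.pi / L) ^ 3 / L) fun n _ => ?_).trans
      (le_of_eq (by rw [Finset.card_range, nsmul_eq_mul])))
  have h1 := abs_momentumShift_sub_le hV hL n
  have h2 := momentum_lt_succ hV hL n
  have h3 := momentum_sub_le hV hL hL2 n
  have hΛ := phaseLipschitz_nonneg hV
  have hh : 0 < Real.pi / L := div_pos Real.pi_pos hL
  set Δ := momentum V L (n + 1) - momentum V L n with hΔ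
  set h := Real.pi / L
  have hΔ0 : 0 ≤ Δ := (sub_pos.2 h2).le
  have e : Δ - h = (momentumShift V L (n + 1) - momentumShift V L n) / L := by
    rw [hΔ, momentum_eq hL n, momentum_eq hL (n + 1)]
    push_cast
    ring
  have h4 : |Δ - h| ≤ phaseLipschitz V * (2 * h) / L := by
    rw [e, abs_div, abs_of_pos hL]
    exact div_le_div_of_nonneg_right (h1.trans (mul_le_mul_of_nonneg_left h3 hΛ)) hL.le
  -- From Δ ≤ 2h: 4 + 2 + 1 = 7.
  have h5 : Δ ^ 2 + Δ * h + h ^ 2 ≤ 7 * h ^ 2 := by nlinarith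
  have h6 : Δ ^ 3 - h ^ 3 = (Δ - h) * (Δ ^ 2 + Δ * h + h ^ 2) := by ring
  rw [h6, abs_mul, abs_of_nonneg (show 0 ≤ Δ ^ 2 + Δ * h + h ^ 2 by positivity)]
  calc |Δ - h| * (Δ ^ 2 + Δ * h + h ^ 2) ≤ phaseLipschitz V * (2 * h) / L * (7 * h ^ 2) := by
        gcongr
    _ = _ := by ring

/-- The phase error is controlled only after multiplication by k, since it may blow up as k → 0. The
difference of squares supplies this factor, being at most a constant times (π/L) k at either
endpoint. -/
theorem abs_sum_momentumShift_sub_le (hV : IsPotential V) (hL : 0 < L)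
    (hL2 : 2 * phaseLipschitz V ≤ L) (N : ℕ) :
    |(∑ n ∈ Finset.range N, (momentumShift V L (n + 1) + momentumShift V L n) / 2 *
        (momentum V L (n + 1) ^ 2 - momentum V L n ^ 2)) -
      ∑ n ∈ Finset.range N, (negPhase V (momentum V L (n + 1)) + negPhase V (momentum V L n)) / 2 *
        (momentum V L (n + 1) ^ 2 - momentum V L n ^ 2)| ≤
      N * (8 * (Real.pi / L) * ((∫ t in Ioi L, V t * t ^ 2) / L ^ 2)) := by
  rw [← Finset.sum_sub_distrib]
  refine (Finset.abs_sum_le_sum_abs _ _).trans ((Finset.sum_le_card_nsmul _ _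
    (8 * (Real.pi / L) * ((∫ t in Ioi L, V t * t ^ 2) / L ^ 2)) fun n _ => ?_).trans
      (le_of_eq (by rw [Finset.card_range, nsmul_eq_mul])))
  have h1 := momentum_mul_abs_momentumShift_sub_le hV hL n
  have h1' := momentum_mul_abs_momentumShift_sub_le hV hL (n + 1)
  have h2 := momentum_lt_succ hV hL n
  have h3 := momentum_sub_le hV hL hL2 n
  have h4 := momentum_nonneg hV hL n
  have hh : 0 < Real.pi / L := div_pos Real.pi_pos hL
  -- The lower endpoint needs k_n ≥ π/L to absorb the gap, hence the larger constant 12 and the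
  -- separate n = 0, where both phases vanish. The upper endpoint costs 4, and the average of 12 and
  -- 4 is 8.
  have h5 : |momentumShift V L n - negPhase V (momentum V L n)| * (momentum V L (n + 1) ^ 2 -
      momentum V L n ^ 2) ≤ 12 * (Real.pi / L) * ((∫ t in Ioi L, V t * t ^ 2) / L ^ 2) := by
    rcases Nat.eq_zero_or_pos n with rfl | hn
    · rw [momentum_zero hV hL, momentumShift_zero hV hL, negPhase_zero, sub_zero, abs_zero, zero_mul]
      have : 0 ≤ ∫ t in Ioi L, V t * t ^ 2 :=
        integral_nonneg fun t => mul_nonneg (hV.nonneg t) (sq_nonneg t)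
      positivity
    · have h6 : Real.pi / L ≤ momentum V L n := by
        rw [momentum_eq hL n]
        have h7 : (1 : ℝ) ≤ n := by exact_mod_cast hn
        have h8 := div_nonneg (momentumShift_nonneg hV hL n) hL.le
        nlinarith
      have h9 : momentum V L (n + 1) ^ 2 - momentum V L n ^ 2 ≤
          12 * (Real.pi / L) * momentum V L n := by nlinarith
      calc _ ≤ |momentumShift V L n - negPhase V (momentum V L n)| *
            (12 * (Real.pi / L) * momentum V L n) :=
            mul_le_mul_of_nonneg_left h9 (abs_nonneg _)
        _ = 12 * (Real.pi / L) * (momentum V L n *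
            |momentumShift V L n - negPhase V (momentum V L n)|) := by ring
        _ ≤ _ := mul_le_mul_of_nonneg_left h1 (by positivity)
  have h6 : |momentumShift V L (n + 1) - negPhase V (momentum V L (n + 1))| *
      (momentum V L (n + 1) ^ 2 - momentum V L n ^ 2) ≤
        4 * (Real.pi / L) * ((∫ t in Ioi L, V t * t ^ 2) / L ^ 2) := by
    have h9 : momentum V L (n + 1) ^ 2 - momentum V L n ^ 2 ≤
        4 * (Real.pi / L) * momentum V L (n + 1) := by nlinarith
    calc _ ≤ |momentumShift V L (n + 1) - negPhase V (momentum V L (n + 1))| *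
          (4 * (Real.pi / L) * momentum V L (n + 1)) :=
          mul_le_mul_of_nonneg_left h9 (abs_nonneg _)
      _ = 4 * (Real.pi / L) * (momentum V L (n + 1) *
          |momentumShift V L (n + 1) - negPhase V (momentum V L (n + 1))|) := by ring
      _ ≤ _ := mul_le_mul_of_nonneg_left h1' (by positivity)
  have h7 : 0 ≤ momentum V L (n + 1) ^ 2 - momentum V L n ^ 2 := by nlinarith
  rw [← sub_mul, abs_mul, abs_of_nonneg h7]
  set x := momentumShift V L (n + 1) - negPhase V (momentum V L (n + 1)) with hx
  set y := momentumShift V L n - negPhase V (momentum V L n) with hy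
  have h8 : |(momentumShift V L (n + 1) + momentumShift V L n) / 2 -
      (negPhase V (momentum V L (n + 1)) + negPhase V (momentum V L n)) / 2| ≤ (|x| + |y|) / 2 := by
    have : (momentumShift V L (n + 1) + momentumShift V L n) / 2 -
      (negPhase V (momentum V L (n + 1)) + negPhase V (momentum V L n)) / 2 = (x + y) / 2 := by
      rw [hx, hy]; ring
    rw [this, abs_div, abs_two]
    exact div_le_div_of_nonneg_right (abs_add_le _ _) zero_le_two
  calc _ ≤ (|x| + |y|) / 2 * (momentum V L (n + 1) ^ 2 - momentum V L n ^ 2) :=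
        mul_le_mul_of_nonneg_right h8 h7
    _ ≤ _ := by linarith

end Momenta

/-! ### The energy shift to order 1/L -/

section Asymptotics

variable {V : ℝ → ℝ} {q a : ℝ} {L : ℕ → ℝ}

theorem continuous_negPhase (hV : IsPotential V) : Continuous (negPhase V) := by
  have h : negPhase V = fun k => negPhase V (max k 0) := by
    funext k
    rcases le_total k 0 with hk | hk
    · rw [max_eq_right hk, negPhase_zero, negPhase, if_neg (not_lt.2 hk)]
    · rw [max_eq_left hk]
  rw [h]
  exact (lipschitzOnWith_negPhase hV).continuousOn.comp_continuous (by fun_prop)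
    fun k => le_max_right k 0

theorem tendsto_length (hq : 0 < q) (hL : ∀ N : ℕ, L N * q = (N + a) * Real.pi) :
    Tendsto L atTop atTop := by
  have h : L = fun N : ℕ => ((N : ℝ) + a) * (Real.pi / q) := by
    funext N
    rw [mul_div_assoc', ← hL, mul_div_cancel_right₀ _ hq.ne']
  rw [h]
  exact (tendsto_atTop_add_const_right _ a tendsto_natCast_atTop_atTop).atTop_mul_const
    (div_pos Real.pi_pos hq)

theorem length_mul_momentum_sub (hL : ∀ N : ℕ, L N * q = (N + a) * Real.pi) (N : ℕ) :
    L N * (momentum V (L N) N - q) = momentumShift V (L N) N - a * Real.pi := by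
  rw [mul_sub, hL, momentumShift]
  ring

theorem tendsto_momentum (hV : IsPotential V) (hq : 0 < q)
    (hL : ∀ N : ℕ, L N * q = (N + a) * Real.pi) :
    Tendsto (fun N => momentum V (L N) N) atTop (𝓝 q) := by
  have hLt := tendsto_length hq hL
  rw [tendsto_iff_norm_sub_tendsto_zero]
  refine squeeze_zero' (Eventually.of_forall fun N => norm_nonneg _) ?_
    (Tendsto.const_div_atTop hLt ((∫ t, V t * t) + |a| * Real.pi))
  filter_upwards [hLt.eventually_gt_atTop 0] with N hN
  have h := length_mul_momentum_sub (V := V) hL N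
  have h1 := momentumShift_nonneg hV hN N
  have h2 := momentumShift_le hV hN N
  rw [le_div_iff₀ hN, Real.norm_eq_abs]
  calc |momentum V (L N) N - q| * L N = |L N * (momentum V (L N) N - q)| := by
        rw [abs_mul, abs_of_pos hN, mul_comm]
    _ = |momentumShift V (L N) N - a * Real.pi| := by rw [h]
    _ ≤ |momentumShift V (L N) N| + |a * Real.pi| := abs_sub _ _
    _ ≤ _ := by
        rw [abs_of_nonneg h1, abs_mul, abs_of_pos Real.pi_pos]
        linarith

/-- The tail estimate controls k_N |d_N - D(k_N)|, and k_N → q > 0 lets the factor k_N be divided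
out; continuity of D does the rest. -/
theorem tendsto_momentumShift (hV : IsPotential V) (hq : 0 < q)
    (hL : ∀ N : ℕ, L N * q = (N + a) * Real.pi) :
    Tendsto (fun N => momentumShift V (L N) N) atTop (𝓝 (negPhase V q)) := by
  have hLt := tendsto_length hq hL
  have hK := tendsto_momentum hV hq hL
  have hD := ((continuous_negPhase hV).tendsto q).comp hK
  have hτ : Tendsto (fun N => (∫ t in Ioi (L N), V t * t ^ 2) / L N ^ 2) atTop (𝓝 0) := by
    simpa using ((tendsto_integral_Ioi_atTop hV.integrable_mul_sq).comp hLt).div_atTop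
      ((tendsto_pow_atTop two_ne_zero).comp hLt)
  have h1 : Tendsto (fun N => momentum V (L N) N *
      |momentumShift V (L N) N - negPhase V (momentum V (L N) N)|) atTop (𝓝 0) := by
    refine squeeze_zero' ?_ ?_ hτ
    · filter_upwards [hLt.eventually_gt_atTop 0] with N hN
      exact mul_nonneg (momentum_nonneg hV hN N) (abs_nonneg _)
    · filter_upwards [hLt.eventually_gt_atTop 0] with N hN
      exact momentum_mul_abs_momentumShift_sub_le hV hN N
  have h2 : Tendsto (fun N => momentumShift V (L N) N - negPhase V (momentum V (L N) N)) atTop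
      (𝓝 0) := by
    rw [tendsto_zero_iff_abs_tendsto_zero]
    have h3 := h1.div hK hq.ne'
    rw [zero_div] at h3
    refine h3.congr' ?_
    filter_upwards [hK.eventually_ne hq.ne'] with N hN
    simp only [Pi.div_apply, Function.comp_apply]
    rw [mul_div_cancel_left₀ _ hN]
  simpa using h2.add hD

theorem tendsto_div_length (hq : 0 < q) (hL : ∀ N : ℕ, L N * q = (N + a) * Real.pi) :
    Tendsto (fun N : ℕ => (N : ℝ) / L N) atTop (𝓝 (q / Real.pi)) := by
  have hLt := tendsto_length hq hL
  have h := (tendsto_const_nhds (x := q / Real.pi)).sub (Tendsto.const_div_atTop hLt a)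
  rw [sub_zero] at h
  refine h.congr' ?_
  filter_upwards [hLt.eventually_gt_atTop 0] with N hN
  have := hL N
  have hpi := Real.pi_pos
  field_simp
  linarith

theorem tendsto_sum_cube (hV : IsPotential V) (hq : 0 < q)
    (hL : ∀ N : ℕ, L N * q = (N + a) * Real.pi) :
    Tendsto (fun N => L N ^ 2 * ∑ n ∈ Finset.range N,
      ((momentum V (L N) (n + 1) - momentum V (L N) n) ^ 3 - (Real.pi / L N) ^ 3)) atTop (𝓝 0) := by
  have hLt := tendsto_length hq hL
  have hN := (tendsto_div_length hq hL).mul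
    (Tendsto.const_div_atTop hLt (14 * phaseLipschitz V * Real.pi ^ 3))
  rw [mul_zero] at hN
  rw [tendsto_zero_iff_abs_tendsto_zero]
  refine squeeze_zero' (Eventually.of_forall fun N => abs_nonneg _) ?_ hN
  filter_upwards [hLt.eventually_gt_atTop 0,
    hLt.eventually_ge_atTop (2 * phaseLipschitz V)] with N h0 h1
  have h := abs_sum_cube_sub_le hV h0 h1 N
  simp only [Function.comp_apply]
  rw [abs_mul, abs_of_pos (by positivity : 0 < L N ^ 2)]
  refine (mul_le_mul_of_nonneg_left h (by positivity)).trans (le_of_eq ?_)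
  field_simp

/-- The finite-volume phases are first replaced by D(k_n), then the trapezoidal sum by the integral.
Nodes have mesh at most 2π/L and lie in [0, q + 1] eventually, so an error o(mesh) survives
multiplication by L. -/
theorem tendsto_phase_sum (hV : IsPotential V) (hq : 0 < q)
    (hL : ∀ N : ℕ, L N * q = (N + a) * Real.pi) :
    Tendsto (fun N => L N * ((∑ n ∈ Finset.range N,
      (momentumShift V (L N) (n + 1) + momentumShift V (L N) n) / 2 *
        (momentum V (L N) (n + 1) ^ 2 - momentum V (L N) n ^ 2)) -
      ∫ s in (0 : ℝ)..momentum V (L N) N, 2 * s * negPhase V s)) atTop (𝓝 0) := by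
  have hLt := tendsto_length hq hL
  have hK := tendsto_momentum hV hq hL
  set Q : ℕ → ℝ := fun N => ∑ n ∈ Finset.range N,
      (momentumShift V (L N) (n + 1) + momentumShift V (L N) n) / 2 *
        (momentum V (L N) (n + 1) ^ 2 - momentum V (L N) n ^ 2)
  set R : ℕ → ℝ := fun N => ∑ n ∈ Finset.range N,
      (negPhase V (momentum V (L N) (n + 1)) + negPhase V (momentum V (L N) n)) / 2 *
        (momentum V (L N) (n + 1) ^ 2 - momentum V (L N) n ^ 2)
  have h1 : Tendsto (fun N => L N * (Q N - R N)) atTop (𝓝 0) := by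
    have hτ := (tendsto_integral_Ioi_atTop hV.integrable_mul_sq).comp hLt
    have hb := ((tendsto_div_length hq hL).mul (Tendsto.const_div_atTop hLt (8 * Real.pi))).mul hτ
    rw [mul_zero] at hb
    rw [tendsto_zero_iff_abs_tendsto_zero]
    refine squeeze_zero' (Eventually.of_forall fun N => abs_nonneg _) ?_ hb
    filter_upwards [hLt.eventually_gt_atTop 0,
      hLt.eventually_ge_atTop (2 * phaseLipschitz V)] with N h0 h2
    have h := abs_sum_momentumShift_sub_le hV h0 h2 N
    simp only [Function.comp_apply]
    rw [abs_mul, abs_of_pos h0]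
    refine (mul_le_mul_of_nonneg_left h h0.le).trans (le_of_eq ?_)
    field_simp
  have h2 : Tendsto (fun N => L N * (R N -
      ∫ s in (0 : ℝ)..momentum V (L N) N, 2 * s * negPhase V s)) atTop (𝓝 0) := by
    rw [Metric.tendsto_nhds]
    intro ε hε
    have hT : 0 < q + 1 := by linarith
    obtain ⟨r, hr, H⟩ := exists_trapezoid_bound (IsPrimitiveOn.of_lipschitzOnWith hT.le
      ((lipschitzOnWith_negPhase hV).mono Icc_subset_Ici_self)) hT
      (ε := ε / (4 * Real.pi)) (by have := Real.pi_pos; positivity)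
    have hm := Tendsto.const_div_atTop hLt (2 * Real.pi)
    filter_upwards [hLt.eventually_gt_atTop 0, hLt.eventually_ge_atTop (2 * phaseLipschitz V),
      hK.eventually (gt_mem_nhds (lt_add_one q)), hm.eventually (gt_mem_nhds hr)] with N h0 h2 h3 h4
    have hpi := Real.pi_pos
    have h := H N (momentum V (L N)) (2 * Real.pi / L N) (momentum_zero hV h0) h3.le
      (fun n _ => ⟨(momentum_lt_succ hV h0 n).le, by
        rw [mul_div_assoc]; exact momentum_sub_le hV h0 h2 n⟩) (by positivity) h4.le
    rw [dist_zero_right, Real.norm_eq_abs, abs_mul, abs_of_pos h0, abs_sub_comm]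
    refine lt_of_le_of_lt (mul_le_mul_of_nonneg_left h h0.le) ?_
    have e : L N * (ε / (4 * Real.pi) * (2 * Real.pi / L N)) = ε / 2 := by
      field_simp
      norm_num
    rw [e]
    linarith
  have h3 := h1.add h2
  rw [add_zero] at h3
  exact h3.congr fun N => by ring

/-- L(k_N - q) = d_N - aπ converges, and the integral has derivative 2qD(q) at q; this is where the
parameter a enters. The slope is extended to k_N = q by `dslope`. -/
theorem tendsto_integral_momentum (hV : IsPotential V) (hq : 0 < q)
    (hL : ∀ N : ℕ, L N * q = (N + a) * Real.pi) :
    Tendsto (fun N => L N * ((∫ s in (0 : ℝ)..momentum V (L N) N, 2 * s * negPhase V s) -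
      ∫ s in (0 : ℝ)..q, 2 * s * negPhase V s)) atTop
      (𝓝 ((negPhase V q - a * Real.pi) * (2 * q * negPhase V q))) := by
  have hc : Continuous fun s => 2 * s * negPhase V s :=
    (by fun_prop : Continuous fun s : ℝ => 2 * s).mul (continuous_negPhase hV)
  set P : ℝ → ℝ := fun x => ∫ s in (0 : ℝ)..x, 2 * s * negPhase V s
  have hP : HasDerivAt P (2 * q * negPhase V q) q :=
    intervalIntegral.integral_hasDerivAt_right (hc.intervalIntegrable _ _)
      (hc.stronglyMeasurableAtFilter _ _) hc.continuousAt
  have hds : Tendsto (fun N => dslope P q (momentum V (L N) N)) atTop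
      (𝓝 (2 * q * negPhase V q)) := by
    have := (continuousAt_dslope_same.2 hP.differentiableAt).tendsto.comp
      (tendsto_momentum hV hq hL)
    rwa [dslope_same, hP.deriv] at this
  refine (((tendsto_momentumShift hV hq hL).sub_const (a * Real.pi)).mul hds).congr fun N => ?_
  rw [← length_mul_momentum_sub hL, mul_assoc, ← smul_eq_mul (momentum V (L N) N - q),
    sub_smul_dslope]

/-- The energy shift of `N` quantized momenta up to order `1 / L`. -/
theorem tendsto_energy_shift (hV : IsPotential V) (hq : 0 < q)
    (hL : ∀ N : ℕ, L N * q = (N + a) * Real.pi) :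
    Tendsto (fun N => L N * ((∑ n ∈ Finset.range N, (momentum V (L N) (n + 1) ^ 2 -
      ((n + 1 : ℕ) * (Real.pi / L N)) ^ 2)) -
        1 / Real.pi * ∫ s in (0 : ℝ)..q, 2 * s * negPhase V s)) atTop
      (𝓝 ((1 - 2 * a) * (q * negPhase V q) + q * negPhase V q ^ 2 / Real.pi)) := by
  have hLt := tendsto_length hq hL
  have hpi := Real.pi_pos
  have hd := tendsto_momentumShift hV hq hL
  have hK := tendsto_momentum hV hq hL
  have hinv : Tendsto (fun N => (L N)⁻¹) atTop (𝓝 0) := tendsto_inv_atTop_zero.comp hLt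
  -- The seven contributions after scaling by L: four boundary terms, the cubed gaps, the
  -- trapezoidal error, and the shift of the endpoint from k_N to q. The first, the third and the
  -- last have nonzero limits in general.
  have h := ((((((hK.mul hd).sub (((hd.pow 2).mul hinv).div_const 2)).sub
    ((hK.mul (hd.pow 2)).div_const Real.pi)).add
    (((hd.pow 3).mul hinv).div_const (3 * Real.pi))).add
    ((tendsto_sum_cube hV hq hL).div_const (6 * Real.pi))).add
    ((tendsto_phase_sum hV hq hL).div_const Real.pi)).add
    ((tendsto_integral_momentum hV hq hL).div_const Real.pi)
  have e : q * negPhase V q - negPhase V q ^ 2 * 0 / 2 - q * negPhase V q ^ 2 / Real.pi +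
      negPhase V q ^ 3 * 0 / (3 * Real.pi) + 0 / (6 * Real.pi) + 0 / Real.pi +
      (negPhase V q - a * Real.pi) * (2 * q * negPhase V q) / Real.pi =
      (1 - 2 * a) * (q * negPhase V q) + q * negPhase V q ^ 2 / Real.pi := by
    field_simp
    ring
  rw [e] at h
  refine h.congr' ?_
  filter_upwards [hLt.eventually_gt_atTop 0] with N hN
  have key := mul_sum_sq_sub_eq (k := momentum V (L N)) (h := Real.pi / L N)
    (u := fun n => momentumShift V (L N) n / L N) (momentum_eq hN)
    (by simp [momentumShift_zero hV hN]) N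
  have e2 : ∑ n ∈ Finset.range N, (momentumShift V (L N) (n + 1) / L N +
        momentumShift V (L N) n / L N) / 2 *
        (momentum V (L N) (n + 1) ^ 2 - momentum V (L N) n ^ 2) =
      (∑ n ∈ Finset.range N, (momentumShift V (L N) (n + 1) + momentumShift V (L N) n) / 2 *
        (momentum V (L N) (n + 1) ^ 2 - momentum V (L N) n ^ 2)) / L N := by
    rw [Finset.sum_div]
    exact Finset.sum_congr rfl fun n _ => by ring
  rw [e2] at key
  generalize ∑ n ∈ Finset.range N, (momentum V (L N) (n + 1) ^ 2 -
      ((n + 1 : ℕ) * (Real.pi / L N)) ^ 2) = S at key ⊢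
  generalize ∑ n ∈ Finset.range N, ((momentum V (L N) (n + 1) - momentum V (L N) n) ^ 3 -
      (Real.pi / L N) ^ 3) = C at key ⊢
  generalize ∑ n ∈ Finset.range N, (momentumShift V (L N) (n + 1) + momentumShift V (L N) n) / 2 *
        (momentum V (L N) (n + 1) ^ 2 - momentum V (L N) n ^ 2) = Q at key ⊢
  -- The summation by parts evaluates (π/L) S, so S is rewritten to expose that product.
  have hS : S = L N / Real.pi * (Real.pi / L N * S) := by field_simp
  rw [hS, key]
  field_simp
  ring

end Asymptotics

/-! ### Only the values of the potential on the open half-line matter -/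

section Restriction

variable {V W : ℝ → ℝ}

theorem IsDirichletSolution.congr_potential {I : Set ℝ} {u v g : ℝ → ℂ}
    (h : IsDirichletSolution V I u v g) (hI : closure I ⊆ Ici 0) (hVW : ∀ x, 0 < x → V x = W x) :
    IsDirichletSolution W I u v g := by
  have key : ∀ x ∈ closure I, EqOn (fun t => (V t : ℂ) * u t - g t)
      (fun t => (W t : ℂ) * u t - g t) (uIoc 0 x) := fun x hx t ht => by
    rw [uIoc_of_le (hI hx)] at ht
    beta_reduce
    rw [hVW t ht.1]
  refine ⟨h.boundary, h.integrable_deriv, h.eq_integral, fun x hx => ?_, fun x hx => ?_⟩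
  · exact (h.integrable_second x hx).congr (key x hx)
  · rw [h.deriv_eq_integral x hx]
    congr 1
    exact intervalIntegral.integral_congr_ae (Eventually.of_forall fun t ht => key x hx ht)

theorem dirichletOperator_congr {I : Set ℝ} (hI : closure I ⊆ Ici 0)
    (hVW : ∀ x, 0 < x → V x = W x) : dirichletOperator V I = dirichletOperator W I := by
  ext p
  constructor
  · rintro ⟨u, v, g, hu, hg, h⟩
    exact ⟨u, v, g, hu, hg, h.congr_potential hI hVW⟩
  · rintro ⟨u, v, g, hu, hg, h⟩
    exact ⟨u, v, g, hu, hg, h.congr_potential hI fun x hx => (hVW x hx).symm⟩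

theorem closure_Ioo_subset_Ici (L : ℝ) : closure (Ioo 0 L) ⊆ Ici 0 :=
  closure_minimal (fun _ hx => hx.1.le) isClosed_Ici

theorem groundStateEnergy_congr (hVW : ∀ x, 0 < x → V x = W x) :
    groundStateEnergy V = groundStateEnergy W := by
  funext L N
  rw [groundStateEnergy, dirichletOperator_congr (closure_Ioo_subset_Ici L) hVW, groundStateEnergy]

theorem phaseShift_congr (hVW : ∀ x, 0 < x → V x = W x) : phaseShift V = phaseShift W := by
  have h : IsPruferAngle V = IsPruferAngle W := by
    funext k θ
    have key : ∀ x, 0 ≤ x → ∫ t in (0 : ℝ)..x, (k - V t * Real.sin (θ t) ^ 2 / k) =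
        ∫ t in (0 : ℝ)..x, (k - W t * Real.sin (θ t) ^ 2 / k) := fun x hx =>
      intervalIntegral.integral_congr_ae (Eventually.of_forall fun t ht => by
        rw [uIoc_of_le hx] at ht
        rw [hVW t ht.1])
    refine propext (and_congr_right fun _ => forall₂_congr fun x hx => ?_)
    rw [key x hx]
  funext k
  rw [phaseShift, phaseShift, pruferAngle, pruferAngle, h]

theorem isPotential_indicator (hV_meas : Measurable V) (hV_nonneg : ∀ x : ℝ, 0 < x → 0 ≤ V x)
    (hV_int : IntegrableOn (fun x => V x * (1 + x ^ 2)) (Ioi 0)) :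
    IsPotential ((Ioi 0).indicator V) := by
  refine ⟨hV_meas.indicator measurableSet_Ioi, fun x => indicator_nonneg (fun x hx => hV_nonneg x hx) x,
    fun x hx => indicator_of_notMem (not_lt.2 hx) V, ?_⟩
  rw [← integrable_indicator_iff measurableSet_Ioi] at hV_int
  refine hV_int.congr (Eventually.of_forall fun x => ?_)
  by_cases hx : x ∈ Ioi (0 : ℝ) <;> simp [hx, indicator]

end Restriction

/-! ### The finite-size energy -/

section FiniteSize

variable {V ξ : ℝ → ℝ} {E a : ℝ}

theorem groundStateEnergy_eq (hV : IsPotential V) {L : ℝ} (hL : 0 < L) (N : ℕ) :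
    groundStateEnergy V L N = ∑ n ∈ Finset.range N, momentum V L (n + 1) ^ 2 := by
  rw [groundStateEnergy, Finset.range_eq_Ico, Finset.sum_Ico_add' (fun n => momentum V L n ^ 2) 0 N 1]
  refine Finset.sum_congr (by ext n; simp) fun n hn => ?_
  exact nthEigenvalue_dirichletOperator hV hL (fun n hn => momentum_spec hV hL hn)
    (Finset.mem_Icc.1 hn).1

theorem pruferAngle_zero_potential {k x : ℝ} (hk : 0 < k) (hx : 0 ≤ x) :
    pruferAngle 0 k x = k * x := by
  have h := partialPhase_eq IsPotential.zero hk hx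
  simp only [Pi.zero_apply, zero_mul, intervalIntegral.integral_zero, neg_zero, partialPhase] at h
  linarith

theorem groundStateEnergy_zero {L : ℝ} (hL : 0 < L) (N : ℕ) :
    groundStateEnergy 0 L N = ∑ n ∈ Finset.range N, ((n + 1 : ℕ) * (Real.pi / L)) ^ 2 := by
  rw [groundStateEnergy, Finset.range_eq_Ico,
    Finset.sum_Ico_add' (fun n : ℕ => (n * (Real.pi / L)) ^ 2) 0 N 1]
  refine Finset.sum_congr (by ext n; simp) fun n hn => ?_
  refine nthEigenvalue_dirichletOperator IsPotential.zero hL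
    (k := fun n : ℕ => n * (Real.pi / L)) (fun n hn => ?_) (Finset.mem_Icc.1 hn).1
  have hn' : (0 : ℝ) < n := by exact_mod_cast hn
  have hpos : 0 < n * (Real.pi / L) := mul_pos hn' (div_pos Real.pi_pos hL)
  refine ⟨hpos, ?_⟩
  rw [pruferAngle_zero_potential hpos hL.le]
  field_simp

/-- The substitution s = k² on the positive part; below 0 the shift function vanishes. -/
theorem integral_Iic_shiftFn (hE : 0 < E) :
    ∫ s in Iic E, shiftFn V s = 1 / Real.pi * ∫ s in (0 : ℝ)..√E, 2 * s * negPhase V s := by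
  have hq := Real.sqrt_pos.2 hE
  rw [← integral_indicator measurableSet_Iic,
    ← setIntegral_eq_integral_of_forall_compl_eq_zero (s := Ioi 0) (fun x hx => ?_),
    ← integral_Ioi_comp_sq, ← intervalIntegral.integral_const_mul,
    intervalIntegral.integral_of_le hq.le, ← Ioi_inter_Iic, ← setIntegral_indicator measurableSet_Iic]
  · refine setIntegral_congr_fun measurableSet_Ioi fun k hk => ?_
    have hk' : 0 < k := hk
    by_cases h : k ≤ √E
    · have h2 : k ^ 2 ≤ E := (Real.le_sqrt hk'.le hE.le).1 h
      rw [indicator_of_mem (show k ∈ Iic (√E) from h), indicator_of_mem (show k ^ 2 ∈ Iic E from h2),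
        shiftFn_of_pos (by positivity), Real.sqrt_sq hk'.le, negPhase_of_pos hk']
      ring
    · have h2 : ¬ k ^ 2 ≤ E := fun h2 => h ((Real.le_sqrt hk'.le hE.le).2 h2)
      rw [indicator_of_notMem (show k ∉ Iic (√E) from h),
        indicator_of_notMem (show k ^ 2 ∉ Iic E from h2), mul_zero]
  · have : shiftFn V x = 0 := if_neg hx
    simp [indicator, this]

theorem systemLength_mul_sqrt (hE : 0 < E) (N : ℕ) :
    systemLength E a N * √E = (N + a) * Real.pi := by
  rw [systemLength, div_mul_cancel₀ _ (Real.sqrt_pos.2 hE).ne']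

/-- Divided by 1/L, the remainder converges to a limit affine in x with slope -√E π ≠ 0. It is
o(1/L) exactly when this limit is 0, which gives existence and uniqueness together. -/
theorem isFiniteSizeEnergy_iff (hV : IsPotential V) (hE : 0 < E)
    (hξ : ∫ s in Iic E, ξ s = ∫ s in Iic E, shiftFn V s) (x : ℝ) :
    IsFiniteSizeEnergy V ξ E a x ↔ x = (1 - 2 * a) * shiftFn V E + andersonExponent V E := by
  have hq := Real.sqrt_pos.2 hE
  have hpi := Real.pi_pos
  have hL : ∀ N : ℕ, systemLength E a N * √E = (N + a) * Real.pi := systemLength_mul_sqrt hE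
  have hLt := tendsto_length hq hL
  have hlim := (tendsto_energy_shift hV hq hL).sub_const (√E * Real.pi * x)
  have hval : shiftFn V E = negPhase V √E / Real.pi := by
    rw [shiftFn_of_pos hE, negPhase_of_pos hq]
  have hval2 : andersonExponent V E = negPhase V √E ^ 2 / Real.pi ^ 2 := by
    rw [andersonExponent, negPhase_of_pos hq, neg_sq]
  rw [IsFiniteSizeEnergy, Asymptotics.isLittleO_iff_tendsto' (by
    filter_upwards [hLt.eventually_gt_atTop 0] with N hN h0
    exact absurd h0 (by positivity))]
  have hcongr : (fun N : ℕ => (groundStateEnergy V (systemLength E a N) N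
      - groundStateEnergy 0 (systemLength E a N) N - (∫ s in Iic E, ξ s)
      - √E * Real.pi / systemLength E a N * x) / (1 / systemLength E a N)) =ᶠ[atTop]
      fun N : ℕ => systemLength E a N * ((∑ n ∈ Finset.range N,
        (momentum V (systemLength E a N) (n + 1) ^ 2 -
          ((n + 1 : ℕ) * (Real.pi / systemLength E a N)) ^ 2)) -
        1 / Real.pi * ∫ s in (0 : ℝ)..√E, 2 * s * negPhase V s) - √E * Real.pi * x := by
    filter_upwards [hLt.eventually_gt_atTop 0] with N hN
    rw [groundStateEnergy_eq hV hN, groundStateEnergy_zero hN, hξ, integral_Iic_shiftFn hE,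
      Finset.sum_sub_distrib]
    generalize ∑ n ∈ Finset.range N, momentum V (systemLength E a N) (n + 1) ^ 2 = A
    generalize ∑ n ∈ Finset.range N, ((n + 1 : ℕ) * (Real.pi / systemLength E a N)) ^ 2 = B
    field_simp
  rw [tendsto_congr' hcongr, hval, hval2]
  constructor
  · intro h
    have h2 := tendsto_nhds_unique h hlim
    have h3 : √E * Real.pi * x = √E * Real.pi * ((1 - 2 * a) * (negPhase V √E / Real.pi) +
        negPhase V √E ^ 2 / Real.pi ^ 2) := by
      have e : √E * Real.pi * ((1 - 2 * a) * (negPhase V √E / Real.pi) +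
        negPhase V √E ^ 2 / Real.pi ^ 2) =
        (1 - 2 * a) * (√E * negPhase V √E) + √E * negPhase V √E ^ 2 / Real.pi := by
        field_simp
      rw [e]
      linarith
    exact mul_left_cancel₀ (mul_pos hq hpi).ne' h3
  · rintro rfl
    convert hlim using 2
    field_simp
    ring

/-- A vanishing δ forces V sin² θ = 0 almost everywhere, so the angle is the free one, θ = kx. As
sin(kx) vanishes only on a countable set, V = 0 almost everywhere. -/
theorem phaseShift_ne_zero (hV : IsPotential V) {k : ℝ} (hk : 0 < k)
    (hne : ¬ V =ᵐ[volume.restrict (Ioi 0)] 0) : phaseShift V k ≠ 0 := by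
  intro h0
  rw [phaseShift_eq hV hk, neg_eq_zero, setIntegral_eq_zero_iff_of_nonneg_ae
    (Eventually.of_forall fun t => mul_nonneg (hV.nonneg t) (by positivity))
    (integrable_sin_sq_pruferAngle hV hk)] at h0
  have hθ : ∀ x, 0 ≤ x → pruferAngle V k x = k * x := fun x hx => by
    have h1 := partialPhase_eq hV hk hx
    rw [intervalIntegral.integral_zero_ae, neg_zero, partialPhase] at h1
    · linarith
    · rw [EventuallyEq, ae_restrict_iff' measurableSet_Ioi] at h0
      filter_upwards [h0] with t ht htx
      rw [uIoc_of_le hx] at htx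
      exact ht htx.1
  refine hne ?_
  have hcount : ∀ᵐ x, x ∉ range fun n : ℤ => n * Real.pi / k :=
    (countable_range _).ae_notMem volume
  filter_upwards [h0, ae_restrict_of_ae hcount, ae_restrict_mem measurableSet_Ioi] with x h1 h2 h3
  have h3' : 0 < x := h3
  simp only [Pi.zero_apply, mul_eq_zero, div_eq_zero_iff] at h1
  rcases h1 with h1 | h1 | h1
  · exact h1
  · exfalso
    rw [hθ x h3'.le, sq_eq_zero_iff, Real.sin_eq_zero_iff] at h1
    obtain ⟨n, hn⟩ := h1
    exact h2 ⟨n, by beta_reduce; rw [hn]; field_simp⟩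
  · exact absurd h1 hk.ne'

end FiniteSize

theorem corollary1 (V : ℝ → ℝ) (hV_meas : Measurable V) (hV_nonneg : ∀ x : ℝ, 0 < x → 0 ≤ V x)
    (hV_int : IntegrableOn (fun x => V x * (1 + x ^ 2)) (Ioi 0)) :
    (∃ ξ : ℝ → ℝ, IsSpectralShiftFunction (dirichletOperator 0 (Ioi 0))
        (dirichletOperator V (Ioi 0)) ξ ∧ ContinuousOn ξ (Ioi 0)) ∧
    ∀ ξ : ℝ → ℝ, IsSpectralShiftFunction (dirichletOperator 0 (Ioi 0))
        (dirichletOperator V (Ioi 0)) ξ → ContinuousOn ξ (Ioi 0) →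
      ∀ E : ℝ, 0 < E →
        (∀ a x : ℝ, IsFiniteSizeEnergy V ξ E a x ↔
          x = (1 - 2 * a) * ξ E + andersonExponent V E) ∧
        (∀ x : ℝ, IsFiniteSizeEnergy V ξ E (1 / 2) x ↔ x = andersonExponent V E) ∧
        (∀ x : ℝ, IsFiniteSizeEnergy V ξ E 0 x ↔ x = ξ E + andersonExponent V E) ∧
        (¬ V =ᵐ[volume.restrict (Ioi 0)] 0 → ∀ a b x y : ℝ, a ≠ b →
          IsFiniteSizeEnergy V ξ E a x → IsFiniteSizeEnergy V ξ E b y → x ≠ y) := by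
  -- The hypotheses say nothing about the sign or the integrability of V on the negative axis;
  -- cutting it off there changes no object in the statement.
  set W := (Ioi 0).indicator V with hW
  have hVW : ∀ x, 0 < x → V x = W x := fun x hx => (indicator_of_mem (mem_Ioi.2 hx) V).symm
  have hpot : IsPotential W := isPotential_indicator hV_meas hV_nonneg hV_int
  have hop : dirichletOperator V (Ioi 0) = dirichletOperator W (Ioi 0) :=
    dirichletOperator_congr (by rw [closure_Ioi]) hVW
  have hexists : IsSpectralShiftFunction (dirichletOperator 0 (Ioi 0))
      (dirichletOperator V (Ioi 0)) (shiftFn W) := by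
    rw [hop]
    exact isSpectralShiftFunction_shiftFn hpot
  have hcont := continuousOn_shiftFn hpot
  refine ⟨⟨shiftFn W, hexists, hcont⟩, fun ξ hξ hξc E hE => ?_⟩
  have heq := hξ.eqOn hexists hξc hcont
  -- The two shift functions agree almost everywhere below 0 by the vanishing condition and
  -- everywhere above 0 by uniqueness; the single point 0 is negligible.
  have hint : ∫ s in Iic E, ξ s = ∫ s in Iic E, shiftFn W s := by
    refine integral_congr_ae (ae_restrict_of_ae ?_)
    have h0 : ∀ᵐ x : ℝ, x ≠ 0 := by simp [ae_iff]
    filter_upwards [hξ.eq_zero, hexists.eq_zero, h0] with x h1 h2 h3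
    rcases lt_or_gt_of_ne h3 with h | h
    · rw [h1 h, h2 h]
    · exact heq h
  have hiff : ∀ a x : ℝ, IsFiniteSizeEnergy V ξ E a x ↔
      x = (1 - 2 * a) * ξ E + andersonExponent V E := fun a x => by
    rw [heq hE, andersonExponent, phaseShift_congr hVW, ← andersonExponent,
      ← isFiniteSizeEnergy_iff hpot hE hint, IsFiniteSizeEnergy, groundStateEnergy_congr hVW,
      ← IsFiniteSizeEnergy]
  refine ⟨hiff, fun x => ?_, fun x => ?_, fun hne a b x y hab hx hy hxy => ?_⟩
  · rw [hiff]; norm_num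
  · rw [hiff]; norm_num
  · rw [hiff] at hx hy
    have hneW : ¬ W =ᵐ[volume.restrict (Ioi 0)] 0 := fun h => hne (by
      filter_upwards [h, ae_restrict_mem measurableSet_Ioi] with t ht ht0
      rw [hVW t ht0, ht])
    have hδ := phaseShift_ne_zero hpot (Real.sqrt_pos.2 hE) hneW
    have hξE : ξ E ≠ 0 := by
      rw [heq hE, shiftFn_of_pos hE]
      exact div_ne_zero (neg_ne_zero.2 hδ) Real.pi_ne_zero
    -- Equal finite-size energies would cancel ζ(E) and leave (a - b) ξ(E) = 0.
    have h : (a - b) * ξ E = 0 := by linarith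
    exact (mul_ne_zero (sub_ne_zero.2 hab) hξE) h
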